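/- Let $0<p_*<p^*\le\underline p<\overline p$, and let $A:L^2(\underline p,\overline p)\to L^2(p_*,p^*)$ be the linear map $F\mapsto\tau$ from the slowness distribution function to the traveltimes of reflected rays, $$\tau(p)=(AF)(p)=2\int_{\underline p}^{\overline p}\frac{1}{\sqrt{q^2-p^2}}\,q^3F(q)\,dq,\qquad p_*<p<p^*.$$ Put $e=(\overline p/\underline p)^2$; for $p\in[p_*,p^*]$ let $t(p)=1+2\,\frac{1-(p/\underline p)^2}{e-1}$ and $\rho(p)=t(p)-\sqrt{t(p)^2-1}$; let $\rho_*=\rho(p_*)$, $\rho^*=\rho(p^*)$, and $$\alpha=\frac1{\rho^*},\qquad s=\frac{\rho^*+\rho_*+2}{\rho^*-\rho_*},\qquad \beta=s+\sqrt{s^2-1}.$$ (So $\alpha=1$ exactly when $p^*=\underline p$, that is, when the rays can become horizontal.) A discretization is a pair $(\mathcal P,\mathcal Q)$ of orthogonal projectors on $L^2(p_*,p^*)$ and $L^2(\underline p,\overline p)$; it is reasonable for $A$ if $\|\mathcal P A\mathcal Q\|\ge\frac12\|A\|$. If $\mathcal Q$ has rank $N\geq 1$, the condition number of $\mathcal P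 A\mathcal Q$ is $\kappa_N=\sigma_1/\sigma_N$, where $\sigma_1\ge\dots\ge\sigma_N\ge0$ are the singular values of $\mathcal P A\mathcal Q$ restricted to the range of $\mathcal Q$; $\kappa_N=\infty$ if $\sigma_N=0$. Fix $p_*,\underline p,\overline p$. Then there are a constant $C>0$ and, for each $p^*\in(p_*,\underline p]$, constants $C_\alpha,C_\beta>0$ (depending on $p^*$, hence on $\alpha$ and $\beta$ respectively), all of them independent of $N$ and of the discretization, such that for every $p^*\in(p_*,\underline p]$ and every $N\ge1$: (i) For every discretization $(\mathcal P,\mathcal Q)$ that is reasonable for $A$ and in which $\mathcal Q$ has rank $N$, $$\kappa_N\ge C_\alpha\,N\,\alpha^N\qquad\text{and}\qquad \kappa_N\ge C\,N^{-1/4}\,e^{c\sqrt N},\quad c=\sqrt2\,\log(1+\sqrt2)=1.2464\ldots$$ The constant $C$ does not depend on $p^*$; the second bound is the useful one when $\alpha=1$. (ii) There is a discretization $(\mathcal P_N,\mathcal Q_N)$, with both projectors of rank $N$, such that $$\kappa_N\le C_\beta\,N^{1/4}\,\beta^N,$$ and one can take for $\mathcal Q_N$ the orthogonal projector onto the polynomials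 in $q^2$ of degree at most $N-1$, where $q$ is the slowness variable on $(\underline p,\overline p)$. -/

import Mathlib

open MeasureTheory
open scoped ENNReal

noncomputable section

/-- The Hilbert space `L²(a, b)` of real square-integrable functions on the interval `(a, b)`. -/
abbrev L2 (a b : ℝ) : Type := Lp ℝ 2 (volume.restrict (Set.Ioo a b))

/-- The ordering of the slownesses of a reflected-ray experiment: the observed horizontal
slownesses fill `[pStar, pTop]` (these are `p_*` and `p^*`) and the physical slownesses of the
medium fill `[pLo, pHi]` (the minimum and the maximum of `1 / c`).
The case `pTop = pLo` of horizontal rays is allowed. -/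
structure ReflectedGeometry (pStar pTop pLo pHi : ℝ) : Prop where
  pos : 0 < pStar
  observed : pStar < pTop
  reflected : pTop ≤ pLo
  medium : pLo < pHi

/-! ### The operator from the slowness distribution to the traveltimes -/

/-- The traveltime `τ(p) = 2 ∫ q³ F(q) / √(q² - p²) dq`, the integral being over `[pLo, pHi]`. -/
def traveltime (pLo pHi : ℝ) (F : ℝ → ℝ) (p : ℝ) : ℝ :=
  2 * ∫ q in Set.Ioo pLo pHi, 1 / √(q ^ 2 - p ^ 2) * (q ^ 3 * F q)

theorem memLp_rpow_right {a b : ℝ} :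
    MemLp (fun q : ℝ => (q - a) ^ (-(1 / 4) : ℝ)) 2 (volume.restrict (Set.Ioo a b)) := by
  rw [memLp_two_iff_integrable_sq (Measurable.aestronglyMeasurable (by fun_prop))]
  rcases le_or_gt b a with hab | hab
  · simp [Set.Ioo_eq_empty (not_lt.mpr hab)]
  have h1 : IntervalIntegrable (fun x : ℝ => x ^ (-(1 / 2) : ℝ)) volume 0 (b - a) :=
    intervalIntegral.intervalIntegrable_rpow' (by norm_num)
  have h2 := h1.comp_sub_right a
  simp only [zero_add, sub_add_cancel] at h2
  rw [intervalIntegrable_iff_integrableOn_Ioo_of_le hab.le] at h2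
  refine h2.congr ?_
  filter_upwards [ae_restrict_mem measurableSet_Ioo] with q hq
  have h3 : 0 ≤ q - a := by linarith [hq.1]
  rw [← Real.rpow_natCast, ← Real.rpow_mul h3]
  norm_num

theorem memLp_rpow_left {a b c : ℝ} (hbc : b ≤ c) :
    MemLp (fun p : ℝ => (c - p) ^ (-(1 / 4) : ℝ)) 2 (volume.restrict (Set.Ioo a b)) := by
  refine MemLp.mono_measure (ν := volume.restrict (Set.Ioo a b))
    (μ := volume.restrict (Set.Ioo a c))
    (Measure.restrict_mono (Set.Ioo_subset_Ioo_right hbc) le_rfl) ?_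
  rw [memLp_two_iff_integrable_sq (Measurable.aestronglyMeasurable (by fun_prop))]
  rcases le_or_gt c a with hab | hab
  · simp [Set.Ioo_eq_empty (not_lt.mpr hab)]
  have h1 : IntervalIntegrable (fun x : ℝ => x ^ (-(1 / 2) : ℝ)) volume 0 (c - a) :=
    intervalIntegral.intervalIntegrable_rpow' (by norm_num)
  have h2 := (h1.comp_sub_left c).symm
  simp only [sub_zero, sub_sub_cancel] at h2
  rw [intervalIntegrable_iff_integrableOn_Ioo_of_le hab.le] at h2
  refine h2.congr ?_
  filter_upwards [ae_restrict_mem measurableSet_Ioo] with q hq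
  have h3 : 0 ≤ c - q := by linarith [hq.2]
  rw [← Real.rpow_natCast, ← Real.rpow_mul h3]
  norm_num

/-- The kernel is dominated by a product of two square-integrable functions. -/
theorem kernel_le {pStar pTop pLo pHi : ℝ} (h : ReflectedGeometry pStar pTop pLo pHi)
    {p q : ℝ} (hp : p ∈ Set.Ioo pStar pTop) (hq : q ∈ Set.Ioo pLo pHi) :
    1 / √(q ^ 2 - p ^ 2) * q ^ 3 ≤
      (pLo - p) ^ (-(1 / 4) : ℝ) * ((pHi ^ 3 / √pLo) * (q - pLo) ^ (-(1 / 4) : ℝ)) := by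
  have hp0 : 0 < p := h.pos.trans hp.1
  have hpl : 0 < pLo - p := by linarith [hp.2, h.reflected]
  have hql : 0 < q - pLo := by linarith [hq.1]
  have hlo : 0 < pLo := by linarith
  have hq0 : 0 < q := by linarith
  set u := (pLo - p) ^ ((1 / 4) : ℝ) with hu
  set v := (q - pLo) ^ ((1 / 4) : ℝ) with hv
  have hu0 : 0 < u := Real.rpow_pos_of_pos hpl _
  have hv0 : 0 < v := Real.rpow_pos_of_pos hql _
  have hu4 : u ^ 4 = pLo - p := by
    rw [hu, ← Real.rpow_natCast, ← Real.rpow_mul hpl.le]; norm_num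
  have hv4 : v ^ 4 = q - pLo := by
    rw [hv, ← Real.rpow_natCast, ← Real.rpow_mul hql.le]; norm_num
  have h1 : √pLo * (u * v) ≤ √(q ^ 2 - p ^ 2) := by
    apply Real.le_sqrt_of_sq_le
    have h2 : (√pLo * (u * v)) ^ 2 = pLo * (u ^ 2 * v ^ 2) := by
      rw [mul_pow, Real.sq_sqrt hlo.le]; ring
    have h3 : u ^ 2 * v ^ 2 ≤ q - p := by
      nlinarith [sq_nonneg (u ^ 2 - v ^ 2), sq_nonneg u, sq_nonneg v,
        mul_nonneg (sq_nonneg u) (sq_nonneg v)]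
    have h4 : pLo ≤ q + p := by linarith
    rw [h2]
    calc pLo * (u ^ 2 * v ^ 2) ≤ (q + p) * (q - p) := by
          apply mul_le_mul h4 h3 (by positivity) (by linarith)
      _ = _ := by ring
  have hpos : 0 < √pLo * (u * v) := by positivity
  have h5 : 1 / √(q ^ 2 - p ^ 2) ≤ 1 / (√pLo * (u * v)) := one_div_le_one_div_of_le hpos h1
  have h6 : q ^ 3 ≤ pHi ^ 3 := pow_le_pow_left₀ hq0.le hq.2.le 3
  rw [Real.rpow_neg hpl.le, Real.rpow_neg hql.le, ← hu, ← hv]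
  calc 1 / √(q ^ 2 - p ^ 2) * q ^ 3 ≤ 1 / (√pLo * (u * v)) * pHi ^ 3 := by
        apply mul_le_mul h5 h6 (by positivity) (by positivity)
    _ = _ := by field_simp

/-- The norm of the factor of the dominating function that depends on `q`. -/
def kernelBound (pLo pHi : ℝ) : ℝ :=
  2 * ‖(memLp_rpow_right (a := pLo) (b := pHi)).const_mul (pHi ^ 3 / √pLo) |>.toLp‖

theorem integrable_kernel {pStar pTop pLo pHi : ℝ} (h : ReflectedGeometry pStar pTop pLo pHi)
    (F : L2 pLo pHi) {p : ℝ} (hp : p ∈ Set.Ioo pStar pTop) :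
    Integrable (fun q => 1 / √(q ^ 2 - p ^ 2) * (q ^ 3 * F q))
      (volume.restrict (Set.Ioo pLo pHi)) := by
  have hb := (memLp_rpow_right (a := pLo) (b := pHi)).const_mul (pHi ^ 3 / √pLo)
  have h1 := (hb.integrable_mul (Lp.memLp F)).const_mul ((pLo - p) ^ (-(1 / 4) : ℝ))
  refine h1.mono (by fun_prop) ?_
  filter_upwards [ae_restrict_mem measurableSet_Ioo] with q hq
  have hq0 : 0 < q := by linarith [hq.1, h.pos, h.observed, h.reflected]
  have hk := kernel_le h hp hq
  have hk0 : 0 ≤ 1 / √(q ^ 2 - p ^ 2) * q ^ 3 := by positivity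
  simp only [Pi.mul_apply]
  rw [← mul_assoc, ← mul_assoc, norm_mul _ (F q), norm_mul _ (F q), Real.norm_of_nonneg hk0]
  gcongr
  exact hk.trans (le_abs_self _)

theorem abs_traveltime_le {pStar pTop pLo pHi : ℝ} (h : ReflectedGeometry pStar pTop pLo pHi)
    (F : L2 pLo pHi) {p : ℝ} (hp : p ∈ Set.Ioo pStar pTop) :
    |traveltime pLo pHi F p| ≤
      (kernelBound pLo pHi * ‖F‖) * (pLo - p) ^ (-(1 / 4) : ℝ) := by
  have hb := (memLp_rpow_right (a := pLo) (b := pHi)).const_mul (pHi ^ 3 / √pLo)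
  set a := (pLo - p) ^ (-(1 / 4) : ℝ) with ha
  have ha0 : 0 ≤ a := Real.rpow_nonneg (by linarith [hp.2, h.reflected]) _
  have hpH : 0 < pHi := by linarith [h.pos, h.observed, h.reflected, h.medium]
  have h1 : Integrable (fun q => a * ((pHi ^ 3 / √pLo * (q - pLo) ^ (-(1 / 4) : ℝ)) * |F q|))
      (volume.restrict (Set.Ioo pLo pHi)) :=
    (hb.integrable_mul (Lp.memLp F).norm).const_mul a
  have h2 : |∫ q in Set.Ioo pLo pHi, 1 / √(q ^ 2 - p ^ 2) * (q ^ 3 * F q)| ≤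
      ∫ q in Set.Ioo pLo pHi, a * ((pHi ^ 3 / √pLo * (q - pLo) ^ (-(1 / 4) : ℝ)) * |F q|) := by
    rw [← Real.norm_eq_abs]
    refine norm_integral_le_of_norm_le h1 ?_
    filter_upwards [ae_restrict_mem measurableSet_Ioo] with q hq
    have hq0 : 0 < q := by linarith [hq.1, h.pos, h.observed, h.reflected]
    have hk := kernel_le h hp hq
    have hk0 : 0 ≤ 1 / √(q ^ 2 - p ^ 2) * q ^ 3 := by positivity
    rw [← mul_assoc, ← mul_assoc, norm_mul, Real.norm_of_nonneg hk0, Real.norm_eq_abs]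
    gcongr
  have h3 : ∫ q in Set.Ioo pLo pHi, (pHi ^ 3 / √pLo * (q - pLo) ^ (-(1 / 4) : ℝ)) * |F q| ≤
      ‖hb.toLp‖ * ‖F‖ := by
    have h4 := real_inner_le_norm hb.toLp ((Lp.memLp F).norm.toLp)
    have h5 : ‖(Lp.memLp F).norm.toLp‖ = ‖F‖ := by
      rw [Lp.norm_toLp, Lp.norm_def, eLpNorm_norm]
    rw [h5, L2.inner_def] at h4
    refine le_trans (le_of_eq ?_) h4
    refine integral_congr_ae ?_
    filter_upwards [hb.coeFn_toLp, (Lp.memLp F).norm.coeFn_toLp] with q e1 e2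
    rw [e1, e2]
    simp [mul_comm]
  rw [integral_const_mul] at h2
  rw [traveltime, abs_mul, abs_two, kernelBound]
  calc _ ≤ 2 * (a * (‖hb.toLp‖ * ‖F‖)) := by gcongr; exact h2.trans (by gcongr)
    _ = _ := by ring

theorem aestronglyMeasurable_traveltime (pStar pTop pLo pHi : ℝ) (F : L2 pLo pHi) :
    AEStronglyMeasurable (traveltime pLo pHi F) (volume.restrict (Set.Ioo pStar pTop)) := by
  have h1 : StronglyMeasurable (fun z : ℝ × ℝ => 1 / √(z.2 ^ 2 - z.1 ^ 2) * (z.2 ^ 3 * F z.2)) := by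
    have hF : Measurable F := (Lp.stronglyMeasurable F).measurable
    apply Measurable.stronglyMeasurable
    fun_prop
  have h2 := h1.integral_prod_right' (ν := volume.restrict (Set.Ioo pLo pHi))
  exact (h2.const_mul 2).aestronglyMeasurable

theorem memLp_traveltime {pStar pTop pLo pHi : ℝ} (h : ReflectedGeometry pStar pTop pLo pHi)
    (F : L2 pLo pHi) :
    MemLp (traveltime pLo pHi F) 2 (volume.restrict (Set.Ioo pStar pTop)) := by
  refine MemLp.of_le_mul (c := kernelBound pLo pHi * ‖F‖)
    (memLp_rpow_left (a := pStar) h.reflected)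
    (aestronglyMeasurable_traveltime pStar pTop pLo pHi F) ?_
  filter_upwards [ae_restrict_mem measurableSet_Ioo] with p hp
  rw [Real.norm_eq_abs, Real.norm_of_nonneg
    (Real.rpow_nonneg (by linarith [hp.2, h.reflected]) _)]
  exact abs_traveltime_le h F hp

/-- The operator `A : L²(pLo, pHi) → L²(pStar, pTop)`, `F ↦ τ`. -/
def reflectedOp {pStar pTop pLo pHi : ℝ} (h : ReflectedGeometry pStar pTop pLo pHi) :
    L2 pLo pHi →L[ℝ] L2 pStar pTop :=
  LinearMap.mkContinuous
    { toFun := fun F => (memLp_traveltime h F).toLp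
      map_add' := by
        intro F G
        rw [← MemLp.toLp_add]
        refine MemLp.toLp_congr _ _ ?_
        filter_upwards [ae_restrict_mem measurableSet_Ioo] with p hp
        simp only [traveltime, Pi.add_apply]
        rw [← mul_add, ← integral_add (integrable_kernel h F hp) (integrable_kernel h G hp)]
        congr 1
        refine integral_congr_ae ?_
        filter_upwards [Lp.coeFn_add F G] with q hq
        rw [hq, Pi.add_apply]
        ring
      map_smul' := by
        intro c F
        simp only [RingHom.id_apply]
        rw [← MemLp.toLp_const_smul c (memLp_traveltime h F)]
        refine MemLp.toLp_congr _ _ ?_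
        filter_upwards with p
        simp only [traveltime, Pi.smul_apply, smul_eq_mul]
        rw [mul_left_comm c 2, ← integral_const_mul c]
        refine congrArg (fun t : ℝ => 2 * t) (integral_congr_ae ?_)
        filter_upwards [Lp.coeFn_smul c F] with q hq
        rw [hq, Pi.smul_apply, smul_eq_mul]
        ring }
    (kernelBound pLo pHi * ‖(memLp_rpow_left (a := pStar) h.reflected).toLp‖) (by
      intro F
      have hb : 0 ≤ kernelBound pLo pHi * ‖F‖ := by unfold kernelBound; positivity
      rw [mul_right_comm]
      refine Lp.norm_le_mul_norm_of_ae_le_mul ?_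
      filter_upwards [ae_restrict_mem measurableSet_Ioo, (memLp_traveltime h F).coeFn_toLp,
        (memLp_rpow_left (a := pStar) h.reflected).coeFn_toLp] with p hp e1 e2
      simp only [LinearMap.coe_mk, AddHom.coe_mk]
      rw [e1, e2, Real.norm_eq_abs, Real.norm_of_nonneg
        (Real.rpow_nonneg (by linarith [hp.2, h.reflected]) _)]
      exact abs_traveltime_le h F hp)

theorem reflectedOp_ae {pStar pTop pLo pHi : ℝ} (h : ReflectedGeometry pStar pTop pLo pHi)
    (F : L2 pLo pHi) :
    reflectedOp h F =ᵐ[volume.restrict (Set.Ioo pStar pTop)] traveltime pLo pHi F :=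
  (memLp_traveltime h F).coeFn_toLp

/-! ### The rates -/

/-- `t - √(t² - 1)` with `t = 1 + 2 (1 - (p / pLo)²) / (e - 1)`, where `e = (pHi / pLo)²` is the
contrast; this gives `ρ_*` for `p = p_*` and `ρ^*` for `p = p^*`. -/
def rho (pLo pHi p : ℝ) : ℝ :=
  (1 + 2 * ((1 - (p / pLo) ^ 2) / ((pHi / pLo) ^ 2 - 1))) -
    √((1 + 2 * ((1 - (p / pLo) ^ 2) / ((pHi / pLo) ^ 2 - 1))) ^ 2 - 1)

/-- `α = 1 / ρ^*`. -/
def alphaRate (pTop pLo pHi : ℝ) : ℝ := 1 / rho pLo pHi pTop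

/-- `s = (ρ^* + ρ_* + 2) / (ρ^* - ρ_*)`. -/
def betaArg (pStar pTop pLo pHi : ℝ) : ℝ :=
  (rho pLo pHi pTop + rho pLo pHi pStar + 2) / (rho pLo pHi pTop - rho pLo pHi pStar)

/-- `β = s + √(s² - 1)`. -/
def betaRate (pStar pTop pLo pHi : ℝ) : ℝ :=
  betaArg pStar pTop pLo pHi + √(betaArg pStar pTop pLo pHi ^ 2 - 1)

/-- The constant `√2 · log (1 + √2) = 1.2464…`, which is the maximum over `0 < δ < 1` of
`√(log δ · log ((1 - √δ) / (1 + √δ)))`, attained at `δ = 3 - 2√2 = 0.1715…`. -/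
def rootExpRate : ℝ := √2 * Real.log (1 + √2)

/-! ### Discretizations and condition numbers -/

section Discretization

variable {E F : Type*} [NormedAddCommGroup E] [InnerProductSpace ℝ E]
  [NormedAddCommGroup F] [InnerProductSpace ℝ F]

/-- The discretization `P A Q` of `A`, where `P` and `Q` are the orthogonal projectors onto `U` and
`V`, is reasonable for `A` if `‖P A Q‖ ≥ ‖A‖ / 2`. -/
def IsReasonable (A : E →L[ℝ] F) (U : Submodule ℝ F) [U.HasOrthogonalProjection]
    (V : Submodule ℝ E) [V.HasOrthogonalProjection] : Prop :=
  (1 / 2 : ℝ) * ‖A‖ ≤ ‖U.starProjection ∘L A ∘L V.starProjection‖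

/-- `P A Q` as a linear map on the range `V` of `Q` (it vanishes on the orthogonal complement). -/
def discretized (A : E →L[ℝ] F) (U : Submodule ℝ F) [U.HasOrthogonalProjection]
    (V : Submodule ℝ E) : V →ₗ[ℝ] F :=
  (U.starProjection ∘L A ∘L V.subtypeL : V →L[ℝ] F)

/-- The singular values of `P A Q` on the range of `Q`, in decreasing order, from index `0` to
index `dim V - 1`. The codomain is cut down to the range of the map, which is finite-dimensional;
this does not change the singular values. -/
def discretizedSingularValue (A : E →L[ℝ] F) (U : Submodule ℝ F) [U.HasOrthogonalProjection]
    (V : Submodule ℝ E) [FiniteDimensional ℝ V] (i : ℕ) : ℝ :=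
  (discretized A U V).rangeRestrict.singularValues i

open Classical in
/-- The condition number `σ₁ / σ_N` of `P A Q`, where `N = dim V` is the rank of `Q`. It is infinite
if `P A Q` is not injective on the range of `Q`. -/
def condNumber (A : E →L[ℝ] F) (U : Submodule ℝ F) [U.HasOrthogonalProjection]
    (V : Submodule ℝ E) [FiniteDimensional ℝ V] : ℝ≥0∞ :=
  if discretizedSingularValue A U V (Module.finrank ℝ V - 1) = 0 then ⊤
  else ENNReal.ofReal (discretizedSingularValue A U V 0 /
    discretizedSingularValue A U V (Module.finrank ℝ V - 1))

end Discretization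

/-! ### Polynomials in the squared slowness -/

theorem memLp_poly_sq (a b : ℝ) (f : Polynomial ℝ) :
    MemLp (fun q : ℝ => f.eval (q ^ 2)) 2 (volume.restrict (Set.Ioo a b)) := by
  have hc : Continuous fun q : ℝ => f.eval (q ^ 2) := by fun_prop
  obtain ⟨C, hC⟩ := (isCompact_Icc (a := a) (b := b)).exists_bound_of_continuousOn hc.continuousOn
  refine MemLp.of_bound hc.aestronglyMeasurable C ?_
  filter_upwards [ae_restrict_mem measurableSet_Ioo] with q hq
  exact hC q (Set.Ioo_subset_Icc_self hq)

/-- The map that sends a polynomial `f` to the function `q ↦ f(q²)` in `L²(a, b)`. -/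
def polySq (a b : ℝ) : Polynomial ℝ →ₗ[ℝ] L2 a b where
  toFun f := (memLp_poly_sq a b f).toLp
  map_add' f g := by
    rw [← MemLp.toLp_add]
    exact MemLp.toLp_congr _ _ (by filter_upwards with q; simp)
  map_smul' c f := by
    simp only [RingHom.id_apply]
    rw [← MemLp.toLp_const_smul]
    exact MemLp.toLp_congr _ _ (by filter_upwards with q; simp)

/-- The subspace of `L²(a, b)` of the polynomials in `q²` of degree at most `N - 1` in `q²`
(that is, of degree less than `N`). -/
def polySqSubspace (a b : ℝ) (N : ℕ) : Submodule ℝ (L2 a b) :=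
  (Polynomial.degreeLT ℝ N).map (polySq a b)

instance (a b : ℝ) (N : ℕ) : FiniteDimensional ℝ (polySqSubspace a b N) := by
  have : FiniteDimensional ℝ (Polynomial.degreeLT ℝ N) :=
    (Polynomial.degreeLTEquiv ℝ N).symm.finiteDimensional
  unfold polySqSubspace
  infer_instance

end

/-!
# Conditioning of the inversion of traveltimes of reflected rays

Both lower bounds rest on one remark (`le_condNumber`). If some nonzero `F` in the range `V` of the
projector satisfies `‖A F‖ ≤ ε ‖F‖`, then the least singular value is at most `ε`; since the
discretization is reasonable, the greatest one is at least `‖A‖ / 2`, and the condition number is at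
least `‖A‖ / (2 ε)`. As `V` has dimension `N`, an `F` can be found that is annihilated by any
`N - 1` given functionals, so it is enough to approximate the kernel `1 / √(q² - p²)` by a sum
of `N - 1` products.

For the rate `α`, put `x = 1 - (q² - pLo²) / κ` in `[-1, 1]` and
`(ρ + 1 / ρ) / 2 = 1 + (pLo² - p²) / κ`, where `κ = (pHi² - pLo²) / 2`. Up to a factor depending on
`p` alone, the kernel is the generating function `1 / √(1 - 2 ρ x + ρ²) = ∑ ρⁿ Pₙ(x)` of the
Legendre polynomials (`kernel_eq_legendreGen`). Truncation leaves a remainder whose norm in `x` is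
of order `ρᴺ / √N`; one more factor `1 / √N` is gained on integrating over `p`, because `ρ` stays
close to `ρ^*` only within a distance of order `1 / N` of `p^*` (`exists_exp_le_condNumber_of_lt`).

The root-exponential bound does not see `p^*`. With `u = pLo² - p²` and `v = q² - pLo²` the kernel is
`(u + v) ^ (-1/2)`. For every `g > 0` the maps `u ↦ (u - g) / (u + g)` and `v ↦ (v - g) / (v + g)`
turn it into `(1 - z w) ^ (-1/2)` (`inv_sqrt_add_eq`), and the binomial series gives an error `γᴹ`
with `M + 1` terms as long as `|z| ≤ γ`. The values of `u` are cut into geometric pieces of ratio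
`γ²`, with `γ = √2 - 1`. The `k`-th piece is short, so that `m - k` terms are enough for a
uniform total error `γᵐ`, up to a factor `√m`; hence `N` is about `m² / 2`, and
`γ ^ (-m) = exp (√(2 N) log (1 + √2))` (`exists_rootExp_le_condNumber`).

For the upper bound let `F(q) = f(q²)` with `f` of degree less than `N`. Then `q² f(q²)` is a
combination of `P₀, …, P_N` in the variable `x`, and integration against the generating function
makes of the traveltime, up to a factor bounded above and below, a polynomial `H(ρ)` of degree at
most `N` whose coefficients are those of `q² f(q²)` in the Legendre basis, rescaled
(`traveltime_polySq`). So `F` is controlled by `∑ Hₖ²`, the mean square of `H` on the unit circle,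
and what remains is to bound it by the norm of `H` on `[ρ_*, ρ^*]` (`exists_sum_coeff_sq_le`). This is
an estimate of Bernstein type. The Chebyshev coefficients of `H` on that interval are controlled by
its norm there, after multiplication by `1 - x²`, which makes up for the singular weight of the
Chebyshev polynomials; the `k`-th polynomial grows like the `k`-th power of the parameter of the
ellipse through the given point with foci `ρ_*` and `ρ^*`. On the unit circle that parameter is
largest at `-1`, where it is `β`, and the Gaussian decay of its powers around `-1` saves the factor
`√N` that makes the power of `N` in the bound equal to `1/4`. Projecting onto the image of the polynomials
under `A` then realizes the bound (`condNumber_map_le`).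
-/

/-! ### Singular values and condition numbers -/

section SingularValues

open Module InnerProductSpace

variable {E F : Type*} [NormedAddCommGroup E] [InnerProductSpace ℝ E] [FiniteDimensional ℝ E]
  [NormedAddCommGroup F] [InnerProductSpace ℝ F] [FiniteDimensional ℝ F]

theorem norm_sq_apply_eq_sum_singularValues (T : E →ₗ[ℝ] F) (x : E) :
    ‖T x‖ ^ 2 = ∑ i : Fin (finrank ℝ E), T.singularValues i ^ 2 *
      (T.isSymmetric_adjoint_comp_self.eigenvectorBasis rfl).repr x i ^ 2 := by
  set b := T.isSymmetric_adjoint_comp_self.eigenvectorBasis rfl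
  have h1 : ‖T x‖ ^ 2 = inner ℝ (b.repr ((LinearMap.adjoint T ∘ₗ T) x)) (b.repr x) := by
    rw [LinearIsometryEquiv.inner_map_map, LinearMap.comp_apply, LinearMap.adjoint_inner_left,
      real_inner_self_eq_norm_sq]
  rw [h1, PiLp.inner_apply]
  refine Finset.sum_congr rfl fun i _ => ?_
  rw [LinearMap.IsSymmetric.eigenvectorBasis_apply_self_apply, T.sq_singularValues_fin rfl i]
  simp
  ring

theorem singularValues_last_mul_norm_le (T : E →ₗ[ℝ] F) (x : E) :
    T.singularValues (finrank ℝ E - 1) * ‖x‖ ≤ ‖T x‖ := by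
  refine le_of_sq_le_sq ?_ (norm_nonneg _)
  rw [norm_sq_apply_eq_sum_singularValues, mul_pow,
    ← LinearIsometryEquiv.norm_map (T.isSymmetric_adjoint_comp_self.eigenvectorBasis rfl).repr x,
    EuclideanSpace.real_norm_sq_eq, Finset.mul_sum]
  refine Finset.sum_le_sum fun i _ => mul_le_mul_of_nonneg_right ?_ (sq_nonneg _)
  exact pow_le_pow_left₀ (T.singularValues_nonneg _) (T.singularValues_antitone (by omega)) 2

theorem norm_apply_le_singularValues_zero (T : E →ₗ[ℝ] F) (x : E) :
    ‖T x‖ ≤ T.singularValues 0 * ‖x‖ := by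
  refine le_of_sq_le_sq ?_ (mul_nonneg (T.singularValues_nonneg _) (norm_nonneg _))
  rw [norm_sq_apply_eq_sum_singularValues, mul_pow,
    ← LinearIsometryEquiv.norm_map (T.isSymmetric_adjoint_comp_self.eigenvectorBasis rfl).repr x,
    EuclideanSpace.real_norm_sq_eq, Finset.mul_sum]
  refine Finset.sum_le_sum fun i _ => mul_le_mul_of_nonneg_right ?_ (sq_nonneg _)
  exact pow_le_pow_left₀ (T.singularValues_nonneg _) (T.singularValues_antitone (by omega)) 2

theorem exists_norm_apply_eq_singularValues (T : E →ₗ[ℝ] F) {i : ℕ} (hi : i < finrank ℝ E) :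
    ∃ x : E, x ≠ 0 ∧ ‖T x‖ = T.singularValues i * ‖x‖ := by
  obtain ⟨x, hx⟩ := (T.hasEigenvalue_adjoint_comp_self_sq_singularValues hi).exists_hasEigenvector
  refine ⟨x, hx.2, ?_⟩
  rw [← sq_eq_sq₀ (norm_nonneg _) (mul_nonneg (T.singularValues_nonneg _) (norm_nonneg _)),
    ← real_inner_self_eq_norm_sq, ← LinearMap.adjoint_inner_left, ← LinearMap.comp_apply,
    hx.apply_eq_smul]
  simp [inner_smul_left, mul_pow]

end SingularValues

section ConditionNumber

open Module

variable {E F : Type*} [NormedAddCommGroup E] [InnerProductSpace ℝ E]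
  [NormedAddCommGroup F] [InnerProductSpace ℝ F]

theorem norm_rangeRestrict_discretized (A : E →L[ℝ] F) (U : Submodule ℝ F)
    [U.HasOrthogonalProjection] (V : Submodule ℝ E) (x : V) :
    ‖(discretized A U V).rangeRestrict x‖ = ‖U.starProjection (A x)‖ := rfl

/-- A nonzero vector of `V` on which `A` is small bounds the smallest singular value from above,
and reasonableness bounds the largest one from below. -/
theorem le_condNumber (A : E →L[ℝ] F) (U : Submodule ℝ F) [U.HasOrthogonalProjection]
    (V : Submodule ℝ E) [FiniteDimensional ℝ V] (hA : IsReasonable A U V) {ε : ℝ} (hε : 0 < ε)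
    {x : E} (hxV : x ∈ V) (hx0 : x ≠ 0) (hx : ‖A x‖ ≤ ε * ‖x‖) :
    ENNReal.ofReal (‖A‖ / (2 * ε)) ≤ condNumber A U V := by
  unfold condNumber
  split_ifs with h0
  · exact le_top
  set T := (discretized A U V).rangeRestrict
  have h1 : discretizedSingularValue A U V (finrank ℝ V - 1) ≤ ε := by
    have h2 := singularValues_last_mul_norm_le T ⟨x, hxV⟩
    rw [norm_rangeRestrict_discretized] at h2
    have h3 : ‖U.starProjection (A x)‖ ≤ ε * ‖x‖ := (U.norm_starProjection_apply_le _).trans hx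
    exact le_of_mul_le_mul_right (h2.trans h3) (by simpa using hx0)
  have hpos : 0 < discretizedSingularValue A U V (finrank ℝ V - 1) :=
    lt_of_le_of_ne (T.singularValues_nonneg _) (Ne.symm h0)
  have h2 : (1 / 2 : ℝ) * ‖A‖ ≤ discretizedSingularValue A U V 0 := by
    refine hA.trans (ContinuousLinearMap.opNorm_le_bound _ (T.singularValues_nonneg 0) fun y => ?_)
    have h3 := norm_apply_le_singularValues_zero T (V.orthogonalProjectionOnto y)
    rw [norm_rangeRestrict_discretized] at h3
    refine h3.trans ?_
    exact mul_le_mul_of_nonneg_left (V.norm_orthogonalProjectionOnto_apply_le y)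
      (T.singularValues_nonneg 0)
  refine ENNReal.ofReal_le_ofReal ?_
  calc ‖A‖ / (2 * ε) = (1 / 2 * ‖A‖) / ε := by field_simp
    _ ≤ _ := div_le_div₀ (by linarith [norm_nonneg A]) h2 hpos h1

/-- If `A` is bounded below by `c` on `V`, projecting onto `A V` loses nothing, and the condition
number is at most `‖A‖ / c`. -/
theorem condNumber_map_le (A : E →L[ℝ] F) (V : Submodule ℝ E) [FiniteDimensional ℝ V]
    (hV : 1 ≤ finrank ℝ V) {c : ℝ} (hc : 0 < c) (hAV : ∀ x ∈ V, c * ‖x‖ ≤ ‖A x‖) :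
    finrank ℝ (V.map (A : E →ₗ[ℝ] F)) = finrank ℝ V ∧
      condNumber A (V.map (A : E →ₗ[ℝ] F)) V ≤ ENNReal.ofReal (‖A‖ / c) := by
  set U := V.map (A : E →ₗ[ℝ] F) with hU
  set T := (discretized A U V).rangeRestrict
  have hT : ∀ x : V, ‖T x‖ = ‖A x‖ := by
    intro x
    rw [norm_rangeRestrict_discretized, U.starProjection_eq_self_iff.mpr]
    exact Submodule.mem_map_of_mem x.2
  have hlast : c ≤ discretizedSingularValue A U V (finrank ℝ V - 1) := by
    obtain ⟨x, hx0, hx⟩ := exists_norm_apply_eq_singularValues T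
      (i := finrank ℝ V - 1) (by omega)
    rw [hT] at hx
    have h1 := hAV x x.2
    rw [hx] at h1
    exact le_of_mul_le_mul_right h1 (by simpa using hx0)
  have hfirst : discretizedSingularValue A U V 0 ≤ ‖A‖ := by
    obtain ⟨x, hx0, hx⟩ := exists_norm_apply_eq_singularValues T (i := 0) (by omega)
    rw [hT] at hx
    have h1 := A.le_opNorm x
    rw [hx] at h1
    exact le_of_mul_le_mul_right h1 (norm_pos_iff.mpr hx0)
  constructor
  · have hinj : Function.Injective ((A : E →ₗ[ℝ] F).domRestrict V) := by
      rw [← LinearMap.ker_eq_bot, LinearMap.ker_eq_bot']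
      intro x hx
      have h1 := hAV x x.2
      have h2 : A (x : E) = 0 := hx
      rw [h2, norm_zero] at h1
      have h3 : ‖(x : E)‖ ≤ 0 := by
        by_contra! h
        nlinarith
      simpa using h3
    rw [← LinearMap.finrank_range_of_inj hinj, LinearMap.range_domRestrict]
  · unfold condNumber
    rw [if_neg (hc.trans_le hlast).ne']
    exact ENNReal.ofReal_le_ofReal (div_le_div₀ (norm_nonneg _) hfirst hc hlast)

/-- Fewer than `dim V` linear functionals have a common nonzero zero in `V`. -/
theorem exists_mem_ne_zero_forall_apply_eq_zero {ι : Type*} [Fintype ι] (V : Submodule ℝ E)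
    [FiniteDimensional ℝ V] (L : ι → E →ₗ[ℝ] ℝ) (h : Fintype.card ι < finrank ℝ V) :
    ∃ x ∈ V, x ≠ 0 ∧ ∀ i, L i x = 0 := by
  have h1 : LinearMap.ker ((LinearMap.pi L).domRestrict V) ≠ ⊥ :=
    LinearMap.ker_ne_bot_of_finrank_lt (by simpa using h)
  obtain ⟨x, hx, hx0⟩ := Submodule.exists_mem_ne_zero_of_ne_bot h1
  refine ⟨x, x.2, by simpa using hx0, fun i => ?_⟩
  have h2 : (LinearMap.pi L) (x : E) = 0 := hx
  exact congrFun h2 i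

end ConditionNumber

/-! ### The binomial series of `(1 - z) ^ (-1/2)` -/

/-- The coefficients `(2n choose n) / 4ⁿ` of the power series of `(1 - z) ^ (-1/2)`. -/
noncomputable def invSqrtCoeff (n : ℕ) : ℝ := (n.centralBinom : ℝ) / 4 ^ n

theorem invSqrtCoeff_zero : invSqrtCoeff 0 = 1 := by simp [invSqrtCoeff]

theorem succ_mul_invSqrtCoeff (n : ℕ) :
    ((n : ℝ) + 1) * invSqrtCoeff (n + 1) = (n + 1 / 2) * invSqrtCoeff n := by
  have h : ((n : ℝ) + 1) * (n + 1).centralBinom = 2 * (2 * n + 1) * n.centralBinom := by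
    exact_mod_cast Nat.succ_mul_centralBinom_succ n
  unfold invSqrtCoeff
  rw [mul_div_assoc', h]
  field_simp
  ring

theorem invSqrtCoeff_pos (n : ℕ) : 0 < invSqrtCoeff n := by
  unfold invSqrtCoeff
  have := n.centralBinom_pos
  positivity

theorem invSqrtCoeff_le_one (n : ℕ) : invSqrtCoeff n ≤ 1 := by
  induction n with
  | zero => simp [invSqrtCoeff_zero]
  | succ n ih =>
    have h := succ_mul_invSqrtCoeff n
    have h0 := invSqrtCoeff_pos n
    by_contra! h1
    nlinarith

theorem sum_antidiagonal_invSqrtCoeff (n : ℕ) :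
    ∑ ij ∈ Finset.HasAntidiagonal.antidiagonal n, invSqrtCoeff ij.1 * invSqrtCoeff ij.2 = 1 := by
  induction n with
  | zero => simp [invSqrtCoeff_zero]
  | succ n ih =>
    -- `i + j = n + 1` and the symmetry `i ↔ j` turn the sum weighted by `n + 1` into twice the
    -- sum weighted by `i`, to which the recursion applies.
    have h1 : ((n : ℝ) + 1) * ∑ ij ∈ Finset.HasAntidiagonal.antidiagonal (n + 1),
        invSqrtCoeff ij.1 * invSqrtCoeff ij.2 =
        2 * ∑ ij ∈ Finset.HasAntidiagonal.antidiagonal (n + 1), (ij.1 : ℝ) * (invSqrtCoeff ij.1 * invSqrtCoeff ij.2) := by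
      have h2 : ∑ ij ∈ Finset.HasAntidiagonal.antidiagonal (n + 1), (ij.1 : ℝ) * (invSqrtCoeff ij.1 * invSqrtCoeff ij.2) =
          ∑ ij ∈ Finset.HasAntidiagonal.antidiagonal (n + 1), (ij.2 : ℝ) * (invSqrtCoeff ij.1 * invSqrtCoeff ij.2) := by
        rw [← Finset.Nat.sum_antidiagonal_swap]
        refine Finset.sum_congr rfl fun ij _ => ?_
        simp [mul_comm]
      rw [two_mul]
      nth_rw 2 [h2]
      rw [← Finset.sum_add_distrib, Finset.mul_sum]
      refine Finset.sum_congr rfl fun ij hij => ?_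
      rw [← add_mul]
      congr 1
      exact_mod_cast (Finset.HasAntidiagonal.mem_antidiagonal.mp hij).symm
    have h3 : ∑ ij ∈ Finset.HasAntidiagonal.antidiagonal (n + 1), (ij.1 : ℝ) * (invSqrtCoeff ij.1 * invSqrtCoeff ij.2) =
        ∑ ij ∈ Finset.HasAntidiagonal.antidiagonal n, ((ij.1 : ℝ) + 1 / 2) * (invSqrtCoeff ij.1 * invSqrtCoeff ij.2) := by
      rw [Finset.Nat.sum_antidiagonal_succ]
      simp only [Nat.cast_zero, zero_mul, zero_add]
      refine Finset.sum_congr rfl fun ij _ => ?_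
      rw [← mul_assoc, ← mul_assoc, ← succ_mul_invSqrtCoeff]
      push_cast
      ring
    have h4 : 2 * ∑ ij ∈ Finset.HasAntidiagonal.antidiagonal n, ((ij.1 : ℝ) + 1 / 2) * (invSqrtCoeff ij.1 * invSqrtCoeff ij.2) =
        ((n : ℝ) + 1) * ∑ ij ∈ Finset.HasAntidiagonal.antidiagonal n, invSqrtCoeff ij.1 * invSqrtCoeff ij.2 := by
      have h2 : ∑ ij ∈ Finset.HasAntidiagonal.antidiagonal n, ((ij.1 : ℝ) + 1 / 2) * (invSqrtCoeff ij.1 * invSqrtCoeff ij.2) =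
          ∑ ij ∈ Finset.HasAntidiagonal.antidiagonal n, ((ij.2 : ℝ) + 1 / 2) * (invSqrtCoeff ij.1 * invSqrtCoeff ij.2) := by
        rw [← Finset.Nat.sum_antidiagonal_swap]
        refine Finset.sum_congr rfl fun ij _ => ?_
        simp [mul_comm]
      rw [two_mul]
      nth_rw 2 [h2]
      rw [← Finset.sum_add_distrib, Finset.mul_sum]
      refine Finset.sum_congr rfl fun ij hij => ?_
      rw [← add_mul]
      congr 1
      have : (ij.1 : ℝ) + ij.2 = n := by exact_mod_cast (Finset.HasAntidiagonal.mem_antidiagonal.mp hij)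
      linarith
    rw [h3, h4, ih] at h1
    have h5 : ((n : ℝ) + 1) ≠ 0 := by positivity
    exact mul_left_cancel₀ h5 h1

theorem summable_invSqrtCoeff_mul_pow {r : ℝ} (h0 : 0 ≤ r) (h1 : r < 1) :
    Summable fun n => invSqrtCoeff n * r ^ n := by
  refine Summable.of_nonneg_of_le (fun n => ?_) (fun n => ?_) (summable_geometric_of_lt_one h0 h1)
  · exact mul_nonneg (invSqrtCoeff_pos n).le (pow_nonneg h0 n)
  · exact mul_le_of_le_one_left (pow_nonneg h0 n) (invSqrtCoeff_le_one n)

theorem summable_norm_invSqrtCoeff_mul_pow {z : ℂ} (hz : ‖z‖ < 1) :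
    Summable fun n => ‖(invSqrtCoeff n : ℂ) * z ^ n‖ := by
  refine (summable_invSqrtCoeff_mul_pow (norm_nonneg z) hz).congr fun n => ?_
  rw [norm_mul, norm_pow, Complex.norm_real, Real.norm_of_nonneg (invSqrtCoeff_pos n).le]

/-- The square of the binomial series is the geometric series. -/
theorem tsum_invSqrtCoeff_sq_mul {z : ℂ} (hz : ‖z‖ < 1) :
    (∑' n, (invSqrtCoeff n : ℂ) * z ^ n) * (∑' n, (invSqrtCoeff n : ℂ) * z ^ n) * (1 - z) = 1 := by
  rw [tsum_mul_tsum_eq_tsum_sum_antidiagonal_of_summable_norm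
    (summable_norm_invSqrtCoeff_mul_pow hz) (summable_norm_invSqrtCoeff_mul_pow hz)]
  have h : ∀ n, ∑ kl ∈ Finset.HasAntidiagonal.antidiagonal n, (invSqrtCoeff kl.1 : ℂ) * z ^ kl.1 *
      ((invSqrtCoeff kl.2 : ℂ) * z ^ kl.2) = z ^ n := by
    intro n
    have h2 : ∀ kl ∈ Finset.HasAntidiagonal.antidiagonal n, (invSqrtCoeff kl.1 : ℂ) * z ^ kl.1 *
        ((invSqrtCoeff kl.2 : ℂ) * z ^ kl.2) =
        ((invSqrtCoeff kl.1 * invSqrtCoeff kl.2 : ℝ) : ℂ) * z ^ n := by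
      intro kl hkl
      rw [← Finset.HasAntidiagonal.mem_antidiagonal.mp hkl, pow_add]
      push_cast
      ring
    rw [Finset.sum_congr rfl h2, ← Finset.sum_mul, ← Complex.ofReal_sum,
      sum_antidiagonal_invSqrtCoeff]
    simp
  simp_rw [h]
  rw [tsum_geometric_of_norm_lt_one hz]
  have : 1 - z ≠ 0 := by
    intro h
    rw [sub_eq_zero] at h
    simp [← h] at hz
  field_simp

theorem hasSum_invSqrtCoeff {x : ℝ} (hx : |x| < 1) :
    HasSum (fun n => invSqrtCoeff n * x ^ n) (1 / √(1 - x)) := by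
  have hz : ‖(x : ℂ)‖ < 1 := by simpa using hx
  have hs : Summable fun n => invSqrtCoeff n * x ^ n := by
    refine Summable.of_norm ((summable_norm_invSqrtCoeff_mul_pow hz).congr fun n => ?_)
    rw [← Complex.ofReal_pow, ← Complex.ofReal_mul, Complex.norm_real]
  have hsq : ∀ y : ℝ, |y| < 1 →
      (∑' n, invSqrtCoeff n * y ^ n) * (∑' n, invSqrtCoeff n * y ^ n) * (1 - y) = 1 := by
    intro y hy
    have h1 := tsum_invSqrtCoeff_sq_mul (z := (y : ℂ)) (by simpa using hy)
    have h2 : ∑' n, (invSqrtCoeff n : ℂ) * (y : ℂ) ^ n = ((∑' n, invSqrtCoeff n * y ^ n : ℝ) : ℂ) := by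
      rw [Complex.ofReal_tsum]
      push_cast
      rfl
    rw [h2] at h1
    exact_mod_cast h1
  -- The square determines the sum up to sign. The sum is positive: it is so at `0`, it is
  -- continuous and it has no zero.
  have hpos : 0 < ∑' n, invSqrtCoeff n * x ^ n := by
    by_contra! hneg
    have hcont : ContinuousOn (fun y : ℝ => ∑' n, invSqrtCoeff n * y ^ n) (Set.uIcc 0 x) := by
      refine continuousOn_tsum (u := fun n => invSqrtCoeff n * |x| ^ n) (fun n => by fun_prop)
        (summable_invSqrtCoeff_mul_pow (abs_nonneg x) hx) fun n y hy => ?_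
      rw [norm_mul, norm_pow, Real.norm_of_nonneg (invSqrtCoeff_pos n).le, Real.norm_eq_abs]
      have h1 : |y| ≤ |x| := by
        have := Set.abs_sub_left_of_mem_uIcc hy
        simpa using this
      gcongr
      exact (invSqrtCoeff_pos n).le
    have h0 : ∑' n, invSqrtCoeff n * (0 : ℝ) ^ n = 1 := by
      rw [tsum_eq_single 0 (fun n hn => by simp [hn])]
      simp [invSqrtCoeff_zero]
    obtain ⟨y, hy, hy0⟩ := intermediate_value_uIcc hcont
      (show (0 : ℝ) ∈ Set.uIcc _ _ from Set.mem_uIcc.mpr (Or.inr ⟨hneg, by rw [h0]; norm_num⟩))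
    have h1 : |y| ≤ |x| := by
      have := Set.abs_sub_left_of_mem_uIcc hy
      simpa using this
    have h2 := hsq y (h1.trans_lt hx)
    simp only at hy0
    rw [hy0] at h2
    simp at h2
  have h1x : 0 < 1 - x := by linarith [(abs_lt.mp hx).2]
  have h3 := hsq x hx
  have h4 : ∑' n, invSqrtCoeff n * x ^ n = 1 / √(1 - x) := by
    rw [eq_div_iff (Real.sqrt_pos.mpr h1x).ne',
      ← sq_eq_sq₀ (by positivity) zero_le_one, mul_pow, Real.sq_sqrt h1x.le]
    linarith
  rw [← h4]
  exact hs.hasSum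

/-! ### Legendre polynomials -/

open Polynomial in
/-- The Legendre polynomial of degree `n`, written through the Chebyshev polynomials
`T_{i-j}` with `i + j = n`. This is the coefficient of `ρⁿ` in the product of the binomial
series of `(1 - ρ e^{iθ}) ^ (-1/2)` and `(1 - ρ e^{-iθ}) ^ (-1/2)`. -/
noncomputable def legendre (n : ℕ) : ℝ[X] :=
  ∑ ij ∈ Finset.HasAntidiagonal.antidiagonal n,
    C (invSqrtCoeff ij.1 * invSqrtCoeff ij.2) * Chebyshev.T ℝ ((ij.1 : ℤ) - ij.2)

theorem abs_eval_chebyshevT_le_one {x : ℝ} (hx : |x| ≤ 1) (n : ℤ) :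
    |(Polynomial.Chebyshev.T ℝ n).eval x| ≤ 1 := by
  have h := abs_le.mp hx
  rw [← Real.cos_arccos h.1 h.2, Polynomial.Chebyshev.T_real_cos]
  exact Real.abs_cos_le_one _

theorem abs_eval_legendre_le_one {x : ℝ} (hx : |x| ≤ 1) (n : ℕ) : |(legendre n).eval x| ≤ 1 := by
  rw [legendre, Polynomial.eval_finsetSum, ← sum_antidiagonal_invSqrtCoeff n]
  refine (Finset.abs_sum_le_sum_abs _ _).trans (Finset.sum_le_sum fun ij _ => ?_)
  have h0 := mul_pos (invSqrtCoeff_pos ij.1) (invSqrtCoeff_pos ij.2)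
  rw [Polynomial.eval_mul, Polynomial.eval_C, abs_mul, abs_of_pos h0]
  exact mul_le_of_le_one_right h0.le (abs_eval_chebyshevT_le_one hx _)

theorem coeff_chebyshevT_nonneg_of_natAbs_le {n : ℕ} {k : ℤ} (hk : k.natAbs ≤ n) :
    0 ≤ (Polynomial.Chebyshev.T ℝ k).coeff n := by
  rcases hk.lt_or_eq with h | h
  · rw [Polynomial.coeff_eq_zero_of_natDegree_lt]
    simpa using h
  · rw [← h, ← Polynomial.Chebyshev.natDegree_T ℝ k, Polynomial.coeff_natDegree,
      Polynomial.Chebyshev.leadingCoeff_T]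
    positivity

theorem natDegree_legendre_le (n : ℕ) : (legendre n).natDegree ≤ n := by
  refine Polynomial.natDegree_sum_le_of_forall_le _ _ fun ij hij => ?_
  have h := Finset.HasAntidiagonal.mem_antidiagonal.mp hij
  refine (Polynomial.natDegree_C_mul_le _ _).trans ?_
  rw [Polynomial.Chebyshev.natDegree_T]
  omega

theorem coeff_legendre_pos (n : ℕ) : 0 < (legendre n).coeff n := by
  rw [legendre, Polynomial.finsetSum_coeff]
  have hnn : ∀ ij ∈ Finset.HasAntidiagonal.antidiagonal n,
      0 ≤ (Polynomial.C (invSqrtCoeff ij.1 * invSqrtCoeff ij.2) *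
        Polynomial.Chebyshev.T ℝ ((ij.1 : ℤ) - ij.2)).coeff n := by
    intro ij hij
    have h := Finset.HasAntidiagonal.mem_antidiagonal.mp hij
    rw [Polynomial.coeff_C_mul]
    exact mul_nonneg (mul_pos (invSqrtCoeff_pos _) (invSqrtCoeff_pos _)).le
      (coeff_chebyshevT_nonneg_of_natAbs_le (by omega))
  refine Finset.sum_pos' hnn ⟨(n, 0), by simp, ?_⟩
  rw [Polynomial.coeff_C_mul]
  refine mul_pos (mul_pos (invSqrtCoeff_pos _) (invSqrtCoeff_pos _)) ?_
  have h : (Polynomial.Chebyshev.T ℝ (n : ℤ)).coeff n = (Polynomial.Chebyshev.T ℝ (n : ℤ)).leadingCoeff := by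
    rw [Polynomial.leadingCoeff, Polynomial.Chebyshev.natDegree_T, Int.natAbs_natCast]
  simp only [Nat.cast_zero, sub_zero, h, Polynomial.Chebyshev.leadingCoeff_T]
  positivity

/-- The Legendre polynomials as a sequence with one polynomial for each degree. -/
noncomputable def legendreSequence : Polynomial.Sequence ℝ where
  elems' := legendre
  degree_eq' n := by
    refine le_antisymm (Polynomial.natDegree_le_iff_degree_le.mp (natDegree_legendre_le n)) ?_
    exact Polynomial.le_degree_of_ne_zero (coeff_legendre_pos n).ne'

/-- A polynomial of degree less than `m` is a combination of the first `m` members of a sequence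
of polynomials with one member for each degree. -/
theorem exists_eq_sum_of_degree_lt (S : Polynomial.Sequence ℝ) {f : Polynomial ℝ} {m : ℕ}
    (hf : f.degree < m) :
    ∃ a : ℕ → ℝ, f = ∑ n ∈ Finset.range m, Polynomial.C (a n) * S n := by
  have h1 : f ∈ Submodule.span ℝ (S '' Set.Iio m) := by
    rw [S.span_degreeLT fun i _ => isUnit_iff_ne_zero.mpr
      (Polynomial.leadingCoeff_ne_zero.mpr (S.ne_zero i)), Polynomial.mem_degreeLT]
    exact hf
  have h2 : (Set.Iio m : Set ℕ) = (Finset.range m : Finset ℕ) := by ext; simp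
  rw [h2, Submodule.mem_span_image_finset_iff_exists_fun] at h1
  obtain ⟨c, hc⟩ := h1
  refine ⟨fun n => if h : n ∈ Finset.range m then c ⟨n, h⟩ else 0, ?_⟩
  rw [← hc, ← Finset.sum_coe_sort (Finset.range m)]
  refine Finset.sum_congr rfl fun n _ => ?_
  rw [Polynomial.smul_eq_C_mul]
  simp only [dif_pos n.2]

/-- The generating function of the Legendre polynomials. -/
theorem hasSum_legendre {ρ x : ℝ} (h0 : 0 ≤ ρ) (h1 : ρ < 1) (hx : |x| ≤ 1) :
    HasSum (fun n => ρ ^ n * (legendre n).eval x) (1 / √(1 - 2 * ρ * x + ρ ^ 2)) := by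
  have hx' := abs_le.mp hx
  set θ := Real.arccos x with hθ
  have hcos : Real.cos θ = x := Real.cos_arccos hx'.1 hx'.2
  set z : ℂ := ρ * Complex.exp (θ * Complex.I) with hz
  set w : ℂ := ρ * Complex.exp (-(θ * Complex.I)) with hw
  have hzn : ‖z‖ = ρ := by
    rw [hz, norm_mul, Complex.norm_exp_ofReal_mul_I, Complex.norm_real, Real.norm_of_nonneg h0, mul_one]
  have hwz : w = (starRingEnd ℂ) z := by
    rw [hw, hz, map_mul, Complex.conj_ofReal, ← Complex.exp_conj, map_mul, Complex.conj_I,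
      Complex.conj_ofReal]
    ring_nf
  have hwn : ‖w‖ = ρ := by rw [hwz, RCLike.norm_conj, hzn]
  have hz1 : ‖z‖ < 1 := hzn ▸ h1
  have hw1 : ‖w‖ < 1 := hwn ▸ h1
  have hsz := summable_norm_invSqrtCoeff_mul_pow hz1
  have hsw := summable_norm_invSqrtCoeff_mul_pow hw1
  have hprod := (summable_norm_sum_mul_antidiagonal_of_summable_norm hsz hsw).of_norm.hasSum
  rw [← tsum_mul_tsum_eq_tsum_sum_antidiagonal_of_summable_norm hsz hsw] at hprod
  have hterm : ∀ n, (∑ kl ∈ Finset.HasAntidiagonal.antidiagonal n, (invSqrtCoeff kl.1 : ℂ) * z ^ kl.1 *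
      ((invSqrtCoeff kl.2 : ℂ) * w ^ kl.2)).re = ρ ^ n * (legendre n).eval x := by
    intro n
    rw [legendre, Polynomial.eval_finsetSum, Finset.mul_sum, Complex.re_sum]
    refine Finset.sum_congr rfl fun kl hkl => ?_
    have h := Finset.HasAntidiagonal.mem_antidiagonal.mp hkl
    rw [Polynomial.eval_mul, Polynomial.eval_C, ← hcos, Polynomial.Chebyshev.T_real_cos]
    have h2 : (invSqrtCoeff kl.1 : ℂ) * z ^ kl.1 * ((invSqrtCoeff kl.2 : ℂ) * w ^ kl.2) =
        ((invSqrtCoeff kl.1 * invSqrtCoeff kl.2 * ρ ^ n : ℝ) : ℂ) *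
          Complex.exp (((((kl.1 : ℤ) - kl.2 : ℤ) : ℝ) * θ : ℝ) * Complex.I) := by
      rw [hz, hw, mul_pow, mul_pow, ← Complex.exp_nat_mul, ← Complex.exp_nat_mul, ← h, pow_add]
      have h3 : Complex.exp (((((kl.1 : ℤ) - kl.2 : ℤ) : ℝ) * θ : ℝ) * Complex.I) =
          Complex.exp (kl.1 * (θ * Complex.I)) * Complex.exp (kl.2 * -(θ * Complex.I)) := by
        rw [← Complex.exp_add]
        congr 1
        push_cast
        ring
      rw [h3]
      push_cast
      ring
    rw [h2, Complex.re_ofReal_mul, Complex.exp_ofReal_mul_I_re]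
    ring
  have hval : ((∑' n, (invSqrtCoeff n : ℂ) * z ^ n) * (∑' n, (invSqrtCoeff n : ℂ) * w ^ n)).re =
      1 / √(1 - 2 * ρ * x + ρ ^ 2) := by
    have h3 : ∑' n, (invSqrtCoeff n : ℂ) * w ^ n =
        (starRingEnd ℂ) (∑' n, (invSqrtCoeff n : ℂ) * z ^ n) := by
      rw [Complex.conj_tsum]
      refine tsum_congr fun n => ?_
      rw [map_mul, map_pow, Complex.conj_ofReal, hwz]
    rw [h3, Complex.mul_conj, Complex.ofReal_re, Complex.normSq_eq_norm_sq]
    have h4 := congrArg norm (tsum_invSqrtCoeff_sq_mul hz1)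
    rw [norm_mul, norm_mul, norm_one] at h4
    have h5 : ‖1 - z‖ = √(1 - 2 * ρ * x + ρ ^ 2) := by
      rw [Complex.norm_def]
      congr 1
      rw [Complex.normSq_apply, hz]
      simp only [Complex.sub_re, Complex.sub_im, Complex.one_re, Complex.one_im,
        Complex.re_ofReal_mul, Complex.im_ofReal_mul, Complex.exp_ofReal_mul_I_re,
        Complex.exp_ofReal_mul_I_im]
      rw [← hcos]
      nlinarith [Real.sin_sq_add_cos_sq θ]
    rw [← h5, eq_div_iff, sq]
    · exact h4
    · intro h
      rw [h, mul_zero] at h4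
      exact zero_ne_one h4
  rw [← hval]
  have := Complex.hasSum_re hprod
  simp_rw [hterm] at this
  exact this

/-! ### Orthogonality of the Legendre polynomials -/

/-- The generating function `1 / √(1 - 2ρx + ρ²)` of the Legendre polynomials. -/
noncomputable def legendreGen (ρ x : ℝ) : ℝ := 1 / √(1 - 2 * ρ * x + ρ ^ 2)

theorem one_sub_two_mul_add_sq_pos {ρ x : ℝ} (h0 : 0 ≤ ρ) (h1 : ρ < 1) (hx : x ≤ 1) :
    0 < 1 - 2 * ρ * x + ρ ^ 2 := by
  nlinarith [mul_nonneg h0 (sub_nonneg.mpr hx), sq_pos_of_pos (sub_pos.mpr h1)]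

theorem continuousOn_legendreGen {ρ : ℝ} (h0 : 0 ≤ ρ) (h1 : ρ < 1) :
    ContinuousOn (legendreGen ρ) (Set.Icc (-1) 1) := by
  unfold legendreGen
  refine ContinuousOn.div (by fun_prop) (by fun_prop) fun x hx => ?_
  exact (Real.sqrt_pos.mpr (one_sub_two_mul_add_sq_pos h0 h1 hx.2)).ne'

theorem uIcc_neg_one_one : Set.uIcc (-1 : ℝ) 1 = Set.Icc (-1) 1 := Set.uIcc_of_le (by norm_num)

theorem integral_legendreGen_mul_legendreGen_sq {r s : ℝ} (hr : 0 < r) (hr1 : r < 1) (hs : 0 < s)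
    (hs1 : s < 1) :
    ∫ x in (-1 : ℝ)..1, legendreGen (r ^ 2) x * legendreGen (s ^ 2) x =
      (Real.log (1 + r * s) - Real.log (1 - r * s)) / (r * s) := by
  have hr2 : r ^ 2 < 1 := by nlinarith
  have hs2 : s ^ 2 < 1 := by nlinarith
  have hrs : r * s < 1 := by nlinarith
  have hA : ∀ x ∈ Set.uIcc (-1 : ℝ) 1, 0 < 1 - 2 * r ^ 2 * x + (r ^ 2) ^ 2 := fun x hx =>
    one_sub_two_mul_add_sq_pos (by positivity) hr2 (uIcc_neg_one_one ▸ hx).2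
  have hB : ∀ x ∈ Set.uIcc (-1 : ℝ) 1, 0 < 1 - 2 * s ^ 2 * x + (s ^ 2) ^ 2 := fun x hx =>
    one_sub_two_mul_add_sq_pos (by positivity) hs2 (uIcc_neg_one_one ▸ hx).2
  have hder : ∀ x ∈ Set.uIcc (-1 : ℝ) 1, HasDerivAt (fun x => -(1 / (r * s)) *
      Real.log (s * √(1 - 2 * r ^ 2 * x + (r ^ 2) ^ 2) + r * √(1 - 2 * s ^ 2 * x + (s ^ 2) ^ 2)))
      (legendreGen (r ^ 2) x * legendreGen (s ^ 2) x) x := by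
    intro x hx
    have hA' := Real.sqrt_pos.mpr (hA x hx)
    have hB' := Real.sqrt_pos.mpr (hB x hx)
    have h1 : HasDerivAt (fun x => 1 - 2 * r ^ 2 * x + (r ^ 2) ^ 2) (-(2 * r ^ 2)) x := by
      have := ((hasDerivAt_id x).const_mul (2 * r ^ 2)).const_sub 1 |>.add_const ((r ^ 2) ^ 2)
      simpa using this
    have h2 : HasDerivAt (fun x => 1 - 2 * s ^ 2 * x + (s ^ 2) ^ 2) (-(2 * s ^ 2)) x := by
      have := ((hasDerivAt_id x).const_mul (2 * s ^ 2)).const_sub 1 |>.add_const ((s ^ 2) ^ 2)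
      simpa using this
    have h3 := (((h1.sqrt (hA x hx).ne').const_mul s).add ((h2.sqrt (hB x hx).ne').const_mul r)).log
      (by simp only [Pi.add_apply]; positivity)
    refine (h3.const_mul (-(1 / (r * s)))).congr_deriv ?_
    simp only [legendreGen, Pi.add_apply]
    set a := √(1 - 2 * r ^ 2 * x + (r ^ 2) ^ 2)
    set b := √(1 - 2 * s ^ 2 * x + (s ^ 2) ^ 2)
    have : s * a + r * b ≠ 0 := by positivity
    field_simp
    ring
  have hc : ContinuousOn (fun x => legendreGen (r ^ 2) x * legendreGen (s ^ 2) x)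
      (Set.uIcc (-1) 1) := by
    rw [uIcc_neg_one_one]
    exact (continuousOn_legendreGen (by positivity) hr2).mul
      (continuousOn_legendreGen (by positivity) hs2)
  rw [intervalIntegral.integral_eq_sub_of_hasDerivAt hder hc.intervalIntegrable]
  have e1 : √(1 - 2 * r ^ 2 * 1 + (r ^ 2) ^ 2) = 1 - r ^ 2 := by
    rw [show 1 - 2 * r ^ 2 * 1 + (r ^ 2) ^ 2 = (1 - r ^ 2) ^ 2 by ring, Real.sqrt_sq (by linarith)]
  have e2 : √(1 - 2 * s ^ 2 * 1 + (s ^ 2) ^ 2) = 1 - s ^ 2 := by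
    rw [show 1 - 2 * s ^ 2 * 1 + (s ^ 2) ^ 2 = (1 - s ^ 2) ^ 2 by ring, Real.sqrt_sq (by linarith)]
  have e3 : √(1 - 2 * r ^ 2 * -1 + (r ^ 2) ^ 2) = 1 + r ^ 2 := by
    rw [show 1 - 2 * r ^ 2 * -1 + (r ^ 2) ^ 2 = (1 + r ^ 2) ^ 2 by ring,
      Real.sqrt_sq (by positivity)]
  have e4 : √(1 - 2 * s ^ 2 * -1 + (s ^ 2) ^ 2) = 1 + s ^ 2 := by
    rw [show 1 - 2 * s ^ 2 * -1 + (s ^ 2) ^ 2 = (1 + s ^ 2) ^ 2 by ring,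
      Real.sqrt_sq (by positivity)]
  rw [e1, e2, e3, e4, show s * (1 - r ^ 2) + r * (1 - s ^ 2) = (r + s) * (1 - r * s) by ring,
    show s * (1 + r ^ 2) + r * (1 + s ^ 2) = (r + s) * (1 + r * s) by ring,
    Real.log_mul (by positivity) (by linarith), Real.log_mul (by positivity) (by positivity)]
  field_simp
  ring

theorem hasSum_integral_legendreGen_mul_legendreGen {ρ σ : ℝ} (hρ : 0 < ρ) (hρ1 : ρ < 1)
    (hσ : 0 < σ) (hσ1 : σ < 1) :
    HasSum (fun n : ℕ => σ ^ n * (2 * ρ ^ n / (2 * n + 1)))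
      (∫ x in (-1 : ℝ)..1, legendreGen ρ x * legendreGen σ x) := by
  have hr := Real.sqrt_pos.mpr hρ
  have hs := Real.sqrt_pos.mpr hσ
  have hr1 : √ρ < 1 := by rw [Real.sqrt_lt' one_pos]; simpa using hρ1
  have hs1 : √σ < 1 := by rw [Real.sqrt_lt' one_pos]; simpa using hσ1
  have h1 := integral_legendreGen_mul_legendreGen_sq hr hr1 hs hs1
  rw [Real.sq_sqrt hρ.le, Real.sq_sqrt hσ.le] at h1
  rw [h1]
  have hrs : √ρ * √σ < 1 := by nlinarith
  have h2 := (Real.hasSum_log_sub_log_of_abs_lt_one (x := √ρ * √σ)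
    (by rwa [abs_of_pos (by positivity)])).div_const (√ρ * √σ)
  refine h2.congr_fun fun n => ?_
  have h3 : (√ρ * √σ) ^ (2 * n + 1) = ρ ^ n * σ ^ n * (√ρ * √σ) := by
    rw [pow_succ, pow_mul, mul_pow √ρ, Real.sq_sqrt hρ.le, Real.sq_sqrt hσ.le, mul_pow]
  rw [h3]
  field_simp

/-- Two power series with bounded coefficients that agree on `(0, 1)` have the same
coefficients. -/
theorem eq_of_hasSum_pow_mul {a c : ℕ → ℝ} {A B : ℝ} (ha : ∀ n, |a n| ≤ A) (hc : ∀ n, |c n| ≤ B)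
    {f : ℝ → ℝ} (h1 : ∀ σ, 0 < σ → σ < 1 → HasSum (fun n => σ ^ n * a n) (f σ))
    (h2 : ∀ σ, 0 < σ → σ < 1 → HasSum (fun n => σ ^ n * c n) (f σ)) (n : ℕ) : a n = c n := by
  induction n using Nat.strong_induction_on with
  | _ m ih =>
    by_contra hne
    set e := |a m - c m| with he
    have hepos : 0 < e := abs_pos.mpr (sub_ne_zero.mpr hne)
    have hD : ∀ n, |a n - c n| ≤ A + B := fun n => (abs_sub _ _).trans (add_le_add (ha n) (hc n))
    have hDe : e ≤ A + B := hD m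
    -- The choice of `σ` makes the tail of the difference after its first nonzero term too small.
    set σ := e / (2 * (A + B + e)) with hσ
    have hσ0 : 0 < σ := by apply div_pos hepos; linarith
    have hσe : σ * (2 * (A + B + e)) = e := div_mul_cancel₀ _ (by linarith)
    have hσ1 : σ < 1 := by rw [hσ, div_lt_one (by linarith)]; linarith
    have h3 : HasSum (fun n => σ ^ n * (a n - c n)) 0 := by
      have := (h1 σ hσ0 hσ1).sub (h2 σ hσ0 hσ1)
      simpa [mul_sub] using this
    rw [← hasSum_nat_add_iff' (m + 1), Finset.sum_range_succ, Finset.sum_eq_zero (s := Finset.range m)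
      (fun i hi => by rw [ih i (Finset.mem_range.mp hi)]; ring)] at h3
    have h4 : HasSum (fun n => σ ^ (n + (m + 1)) * (A + B)) (σ ^ (m + 1) * (A + B) * (1 - σ)⁻¹) := by
      refine ((hasSum_geometric_of_lt_one hσ0.le hσ1).mul_left (σ ^ (m + 1) * (A + B))).congr_fun ?_
      intro n
      rw [pow_add]
      ring
    have h5 : |0 - (0 + σ ^ m * (a m - c m))| ≤ σ ^ (m + 1) * (A + B) * (1 - σ)⁻¹ := by
      rw [← h3.tsum_eq, ← Real.norm_eq_abs]
      refine tsum_of_norm_bounded h4 fun n => ?_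
      rw [norm_mul, norm_pow, Real.norm_of_nonneg hσ0.le, Real.norm_eq_abs]
      exact mul_le_mul_of_nonneg_left (hD _) (by positivity)
    rw [zero_sub, zero_add, abs_neg, abs_mul, abs_of_pos (pow_pos hσ0 m), pow_succ, ← he, mul_assoc,
      mul_assoc] at h5
    have h6 := le_of_mul_le_mul_left h5 (pow_pos hσ0 m)
    have h7 : 0 < 1 - σ := by linarith
    rw [← mul_assoc, ← div_eq_mul_inv, le_div_iff₀ h7] at h6
    nlinarith

theorem hasSum_integral_legendreGen_mul {ρ : ℝ} (h0 : 0 ≤ ρ) (h1 : ρ < 1) {φ : ℝ → ℝ}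
    (hφ : ContinuousOn φ (Set.Icc (-1) 1)) :
    HasSum (fun n => ρ ^ n * ∫ x in (-1 : ℝ)..1, (legendre n).eval x * φ x)
      (∫ x in (-1 : ℝ)..1, legendreGen ρ x * φ x) := by
  have hmem : ∀ x ∈ Set.uIoc (-1 : ℝ) 1, x ∈ Set.Icc (-1 : ℝ) 1 := fun x hx => by
    rw [Set.uIoc_of_le (by norm_num)] at hx
    exact Set.Ioc_subset_Icc_self hx
  have hφ' : ContinuousOn φ (Set.uIcc (-1) 1) := by rwa [uIcc_neg_one_one]
  have h2 : HasSum (fun n => ∫ x in (-1 : ℝ)..1, ρ ^ n * (legendre n).eval x * φ x)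
      (∫ x in (-1 : ℝ)..1, legendreGen ρ x * φ x) := by
    refine intervalIntegral.hasSum_integral_of_dominated_convergence
      (fun n x => ρ ^ n * |φ x|) (fun n => ?_) (fun n => ?_) ?_ ?_ ?_
    · refine ContinuousOn.aestronglyMeasurable ?_ measurableSet_uIoc
      refine ContinuousOn.mul (by fun_prop) (hφ.mono hmem)
    · refine Filter.Eventually.of_forall fun x hx => ?_
      rw [norm_mul, norm_mul, norm_pow, Real.norm_of_nonneg h0, Real.norm_eq_abs, Real.norm_eq_abs]
      have := abs_eval_legendre_le_one (abs_le.mpr (hmem x hx)) n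
      have h3 := mul_le_mul_of_nonneg_left this (pow_nonneg h0 n)
      rw [mul_one] at h3
      exact mul_le_mul_of_nonneg_right h3 (abs_nonneg _)
    · exact Filter.Eventually.of_forall fun x _ => (summable_geometric_of_lt_one h0 h1).mul_right _
    · simp_rw [tsum_mul_right]
      exact (hφ'.abs.intervalIntegrable).const_mul _
    · refine Filter.Eventually.of_forall fun x hx => ?_
      exact (hasSum_legendre h0 h1 (abs_le.mpr (hmem x hx))).mul_right (φ x)
  refine h2.congr_fun fun n => ?_
  rw [← intervalIntegral.integral_const_mul]
  exact intervalIntegral.integral_congr fun x _ => by ring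

theorem abs_integral_legendre_mul_le {φ : ℝ → ℝ} {B : ℝ} (hB : ∀ x ∈ Set.Icc (-1 : ℝ) 1, |φ x| ≤ B)
    (n : ℕ) : |∫ x in (-1 : ℝ)..1, (legendre n).eval x * φ x| ≤ B * 2 := by
  have h := intervalIntegral.norm_integral_le_of_norm_le_const (a := (-1 : ℝ)) (b := 1) (C := B)
    (f := fun x => (legendre n).eval x * φ x) fun x hx => by
      rw [Set.uIoc_of_le (by norm_num)] at hx
      have hx' := Set.Ioc_subset_Icc_self hx
      rw [norm_mul, Real.norm_eq_abs, Real.norm_eq_abs]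
      exact (mul_le_of_le_one_left (abs_nonneg _)
        (abs_eval_legendre_le_one (abs_le.mpr hx') n)).trans (hB x hx')
  rw [Real.norm_eq_abs] at h
  norm_num at h
  exact h

theorem two_mul_div_le_two {y : ℝ} (hy0 : 0 ≤ y) (hy1 : y ≤ 1) (n : ℕ) : |2 * y / (2 * n + 1)| ≤ 2 := by
  rw [abs_of_nonneg (by positivity), div_le_iff₀ (by positivity)]
  nlinarith [(Nat.cast_nonneg n : (0 : ℝ) ≤ n)]

theorem integral_legendre_mul_legendreGen {ρ : ℝ} (h0 : 0 < ρ) (h1 : ρ < 1) (m : ℕ) :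
    ∫ x in (-1 : ℝ)..1, (legendre m).eval x * legendreGen ρ x = 2 * ρ ^ m / (2 * m + 1) := by
  obtain ⟨B, hB⟩ := isCompact_Icc.exists_bound_of_continuousOn (continuousOn_legendreGen h0.le h1)
  refine eq_of_hasSum_pow_mul (a := fun m => ∫ x in (-1 : ℝ)..1, (legendre m).eval x * legendreGen ρ x)
    (c := fun m => 2 * ρ ^ m / (2 * m + 1)) (A := B * 2) (B := 2)
    (f := fun σ => ∫ x in (-1 : ℝ)..1, legendreGen σ x * legendreGen ρ x)
    (abs_integral_legendre_mul_le hB)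
    (fun n => two_mul_div_le_two (pow_nonneg h0.le n) (pow_le_one₀ h0.le h1.le) n)
    (fun σ hσ hσ1 => hasSum_integral_legendreGen_mul hσ.le hσ1 (continuousOn_legendreGen h0.le h1))
    (fun σ hσ hσ1 => ?_) m
  have := hasSum_integral_legendreGen_mul_legendreGen h0 h1 hσ hσ1
  simp_rw [mul_comm (legendreGen ρ _)] at this
  exact this

theorem integral_legendre_mul_legendre (n m : ℕ) :
    ∫ x in (-1 : ℝ)..1, (legendre n).eval x * (legendre m).eval x =
      if n = m then 2 / (2 * (m : ℝ) + 1) else 0 := by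
  refine eq_of_hasSum_pow_mul
    (a := fun n => ∫ x in (-1 : ℝ)..1, (legendre n).eval x * (legendre m).eval x)
    (c := fun n => if n = m then 2 / (2 * (m : ℝ) + 1) else 0) (A := 1 * 2) (B := 2)
    (f := fun σ => ∫ x in (-1 : ℝ)..1, legendreGen σ x * (legendre m).eval x)
    (abs_integral_legendre_mul_le fun x hx => abs_eval_legendre_le_one (abs_le.mpr hx) m)
    (fun n => ?_)
    (fun σ hσ hσ1 => hasSum_integral_legendreGen_mul hσ.le hσ1 (by fun_prop))
    (fun σ hσ hσ1 => ?_) n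
  · split_ifs
    · simpa using two_mul_div_le_two zero_le_one le_rfl m
    · simp
  · have := integral_legendre_mul_legendreGen hσ hσ1 m
    simp_rw [mul_comm (legendreGen σ _)]
    rw [this]
    convert! hasSum_single m (f := fun n => σ ^ n * if n = m then 2 / (2 * (m : ℝ) + 1) else 0) ?_ using 1
    · simp; ring
    · intro n hn
      simp [hn]

/-- Parseval's identity for Legendre polynomials. -/
theorem integral_sum_legendre_sq (a : ℕ → ℝ) (m : ℕ) :
    ∫ x in (-1 : ℝ)..1, (∑ n ∈ Finset.range m, a n * (legendre n).eval x) ^ 2 =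
      ∑ n ∈ Finset.range m, a n ^ 2 * (2 / (2 * n + 1)) := by
  have h1 : ∀ x : ℝ, (∑ n ∈ Finset.range m, a n * (legendre n).eval x) ^ 2 =
      ∑ n ∈ Finset.range m, ∑ k ∈ Finset.range m,
        a n * a k * ((legendre n).eval x * (legendre k).eval x) := by
    intro x
    rw [sq, Finset.sum_mul_sum]
    exact Finset.sum_congr rfl fun n _ => Finset.sum_congr rfl fun k _ => by ring
  simp_rw [h1]
  rw [intervalIntegral.integral_finsetSum fun n _ => Continuous.intervalIntegrable (by fun_prop) _ _]
  refine Finset.sum_congr rfl fun n hn => ?_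
  rw [intervalIntegral.integral_finsetSum fun n _ => Continuous.intervalIntegrable (by fun_prop) _ _]
  simp_rw [intervalIntegral.integral_const_mul, integral_legendre_mul_legendre]
  rw [Finset.sum_eq_single_of_mem n hn fun k _ hk => by rw [if_neg hk.symm, mul_zero]]
  rw [if_pos rfl]
  ring

theorem integral_sum_legendre_mul_legendreGen {ρ : ℝ} (h0 : 0 < ρ) (h1 : ρ < 1) (a : ℕ → ℝ)
    (m : ℕ) :
    ∫ x in (-1 : ℝ)..1, (∑ n ∈ Finset.range m, a n * (legendre n).eval x) * legendreGen ρ x =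
      ∑ n ∈ Finset.range m, a n * (2 * ρ ^ n / (2 * n + 1)) := by
  have hc : ContinuousOn (legendreGen ρ) (Set.uIcc (-1) 1) := by
    rw [uIcc_neg_one_one]
    exact continuousOn_legendreGen h0.le h1
  simp_rw [Finset.sum_mul, mul_assoc]
  rw [intervalIntegral.integral_finsetSum fun n _ => ContinuousOn.intervalIntegrable
    (u := fun x => a n * ((legendre n).eval x * legendreGen ρ x))
    (ContinuousOn.mul (by fun_prop) (ContinuousOn.mul (by fun_prop) hc))]
  refine Finset.sum_congr rfl fun n _ => ?_
  rw [intervalIntegral.integral_const_mul, integral_legendre_mul_legendreGen h0 h1]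

/-- The truncation error of the Legendre expansion of the generating function. -/
theorem integral_legendreGen_sub_sum_sq_le {ρ : ℝ} (h0 : 0 < ρ) (h1 : ρ < 1) (m : ℕ) :
    ∫ x in (-1 : ℝ)..1, (legendreGen ρ x -
      ∑ n ∈ Finset.range m, ρ ^ n * (legendre n).eval x) ^ 2 ≤
        2 * ρ ^ (2 * m) / ((2 * m + 1) * (1 - ρ)) := by
  have hc : ContinuousOn (legendreGen ρ) (Set.uIcc (-1) 1) := by
    rw [uIcc_neg_one_one]
    exact continuousOn_legendreGen h0.le h1
  set S : ℝ → ℝ := fun x => ∑ n ∈ Finset.range m, ρ ^ n * (legendre n).eval x with hS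
  have hSc : Continuous S := by fun_prop
  have i1 : IntervalIntegrable (fun x => legendreGen ρ x * legendreGen ρ x) volume (-1) 1 :=
    (hc.mul hc).intervalIntegrable
  have i2 : IntervalIntegrable (fun x => 2 * (S x * legendreGen ρ x)) volume (-1) 1 :=
    (continuousOn_const.mul (hSc.continuousOn.mul hc)).intervalIntegrable
  have i3 : IntervalIntegrable (fun x => S x ^ 2) volume (-1) 1 :=
    (hSc.pow 2).intervalIntegrable _ _
  have h2 : ∫ x in (-1 : ℝ)..1, (legendreGen ρ x - S x) ^ 2 =
      (∫ x in (-1 : ℝ)..1, legendreGen ρ x * legendreGen ρ x) -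
        ∑ n ∈ Finset.range m, ρ ^ n * (2 * ρ ^ n / (2 * n + 1)) := by
    calc ∫ x in (-1 : ℝ)..1, (legendreGen ρ x - S x) ^ 2
        = ∫ x in (-1 : ℝ)..1, (legendreGen ρ x * legendreGen ρ x - 2 * (S x * legendreGen ρ x) +
            S x ^ 2) := intervalIntegral.integral_congr fun x _ => by ring
      _ = _ := by
        rw [intervalIntegral.integral_add (i1.sub i2) i3, intervalIntegral.integral_sub i1 i2,
          intervalIntegral.integral_const_mul, integral_sum_legendre_mul_legendreGen h0 h1,
          integral_sum_legendre_sq]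
        have : ∑ n ∈ Finset.range m, (ρ ^ n) ^ 2 * (2 / (2 * (n : ℝ) + 1)) =
            ∑ n ∈ Finset.range m, ρ ^ n * (2 * ρ ^ n / (2 * n + 1)) :=
          Finset.sum_congr rfl fun n _ => by ring
        rw [this]
        ring
  rw [h2]
  have h3 := (hasSum_nat_add_iff' m).mpr (hasSum_integral_legendreGen_mul_legendreGen h0 h1 h0 h1)
  have h4 : HasSum (fun n => 2 * ρ ^ (2 * m) / (2 * m + 1) * ρ ^ n)
      (2 * ρ ^ (2 * m) / (2 * m + 1) * (1 - ρ)⁻¹) :=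
    (hasSum_geometric_of_lt_one h0.le h1).mul_left _
  refine (hasSum_le (fun n => ?_) h3 h4).trans (le_of_eq ?_)
  · have e1 : ρ ^ (n + m) * (2 * ρ ^ (n + m) / (2 * ((n + m : ℕ) : ℝ) + 1)) =
        2 * ρ ^ (2 * m) * (ρ ^ n * ρ ^ n) / (2 * ((n + m : ℕ) : ℝ) + 1) := by
      rw [pow_add, pow_mul']
      ring
    have e2 : 2 * ρ ^ (2 * m) / (2 * m + 1) * ρ ^ n = 2 * ρ ^ (2 * m) * (ρ ^ n * 1) / (2 * m + 1) := by
      ring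
    rw [e1, e2]
    have hp : ρ ^ n ≤ 1 := pow_le_one₀ h0.le h1.le
    have hp0 := pow_pos h0 n
    push_cast
    gcongr
    linarith [(Nat.cast_nonneg n : (0 : ℝ) ≤ n)]
  · have : 1 - ρ ≠ 0 := by linarith
    field_simp

/-! ### Square-integrable functions and the size of the traveltime operator -/

theorem integral_mul_eq_inner {a b : ℝ} {φ : ℝ → ℝ} (hφ : MemLp φ 2 (volume.restrict (Set.Ioo a b)))
    (F : L2 a b) : inner ℝ hφ.toLp F = ∫ q in Set.Ioo a b, φ q * F q := by
  rw [L2.inner_def]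
  refine integral_congr_ae ?_
  filter_upwards [hφ.coeFn_toLp] with q hq
  rw [hq]
  simp [mul_comm]

theorem norm_sq_eq_integral {a b : ℝ} (F : L2 a b) : ‖F‖ ^ 2 = ∫ q in Set.Ioo a b, F q ^ 2 := by
  rw [← real_inner_self_eq_norm_sq, L2.inner_def]
  exact integral_congr_ae (Filter.Eventually.of_forall fun q => by simp [sq])

theorem norm_toLp_sq_eq_integral {a b : ℝ} {φ : ℝ → ℝ}
    (hφ : MemLp φ 2 (volume.restrict (Set.Ioo a b))) :
    ‖hφ.toLp‖ ^ 2 = ∫ q in Set.Ioo a b, φ q ^ 2 := by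
  rw [norm_sq_eq_integral]
  refine integral_congr_ae ?_
  filter_upwards [hφ.coeFn_toLp] with q hq
  rw [hq]

theorem sq_integral_mul_le {a b : ℝ} {φ : ℝ → ℝ} (hφ : MemLp φ 2 (volume.restrict (Set.Ioo a b)))
    (F : L2 a b) :
    (∫ q in Set.Ioo a b, φ q * F q) ^ 2 ≤ (∫ q in Set.Ioo a b, φ q ^ 2) * ‖F‖ ^ 2 := by
  rw [← integral_mul_eq_inner hφ, ← norm_toLp_sq_eq_integral hφ, ← mul_pow, ← sq_abs]
  exact pow_le_pow_left₀ (abs_nonneg _) (abs_real_inner_le_norm _ _) 2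

/-- The linear functional `F ↦ ∫ φ F` on `L²(a, b)`. -/
noncomputable def integralFunctional {a b : ℝ} {φ : ℝ → ℝ}
    (hφ : MemLp φ 2 (volume.restrict (Set.Ioo a b))) : L2 a b →ₗ[ℝ] ℝ :=
  (innerSL ℝ hφ.toLp : L2 a b →ₗ[ℝ] ℝ)

theorem integralFunctional_apply {a b : ℝ} {φ : ℝ → ℝ}
    (hφ : MemLp φ 2 (volume.restrict (Set.Ioo a b))) (F : L2 a b) :
    integralFunctional hφ F = ∫ q in Set.Ioo a b, φ q * F q :=
  integral_mul_eq_inner hφ F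

theorem memLp_of_continuousOn {a b : ℝ} {φ : ℝ → ℝ} (hφ : ContinuousOn φ (Set.Icc a b)) :
    MemLp φ 2 (volume.restrict (Set.Ioo a b)) := by
  obtain ⟨C, hC⟩ := isCompact_Icc.exists_bound_of_continuousOn hφ
  refine MemLp.of_bound ((hφ.mono Set.Ioo_subset_Icc_self).aestronglyMeasurable measurableSet_Ioo) C ?_
  filter_upwards [ae_restrict_mem measurableSet_Ioo] with q hq
  exact hC q (Set.Ioo_subset_Icc_self hq)

section Geometry

variable {pStar pTop pLo pHi : ℝ}

theorem ReflectedGeometry.pLo_pos (h : ReflectedGeometry pStar pTop pLo pHi) : 0 < pLo :=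
  (h.pos.trans h.observed).trans_le h.reflected

theorem ReflectedGeometry.pHi_pos (h : ReflectedGeometry pStar pTop pLo pHi) : 0 < pHi :=
  h.pLo_pos.trans h.medium

theorem integrableOn_traveltime_sq (h : ReflectedGeometry pStar pTop pLo pHi) (F : L2 pLo pHi) :
    IntegrableOn (fun p => traveltime pLo pHi F p ^ 2) (Set.Ioo pStar pTop) :=
  (memLp_traveltime h F).integrable_sq

theorem norm_reflectedOp_sq (h : ReflectedGeometry pStar pTop pLo pHi) (F : L2 pLo pHi) :
    ‖reflectedOp h F‖ ^ 2 = ∫ p in Set.Ioo pStar pTop, traveltime pLo pHi F p ^ 2 := by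
  rw [norm_sq_eq_integral]
  refine integral_congr_ae ?_
  filter_upwards [reflectedOp_ae h F] with p hp
  rw [hp]

theorem norm_reflectedOp_sq_le (h : ReflectedGeometry pStar pTop pLo pHi) (F : L2 pLo pHi)
    {Φ : ℝ → ℝ} (hΦ : IntegrableOn Φ (Set.Ioo pStar pTop))
    (hle : ∀ p ∈ Set.Ioo pStar pTop, traveltime pLo pHi F p ^ 2 ≤ Φ p * ‖F‖ ^ 2) :
    ‖reflectedOp h F‖ ^ 2 ≤ (∫ p in Set.Ioo pStar pTop, Φ p) * ‖F‖ ^ 2 := by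
  rw [norm_reflectedOp_sq, ← integral_mul_const]
  exact setIntegral_mono_on (integrableOn_traveltime_sq h F) (hΦ.mul_const _) measurableSet_Ioo hle

/-- If `F` is orthogonal to `q³ R(q)`, the kernel may be replaced by its difference from `R`. -/
theorem traveltime_sq_le_of_orthogonal (h : ReflectedGeometry pStar pTop pLo pHi) (F : L2 pLo pHi)
    {p : ℝ} (hp : p ∈ Set.Ioo pStar pTop) {R M : ℝ → ℝ} (hR : ContinuousOn R (Set.Icc pLo pHi))
    (hRF : ∫ q in Set.Ioo pLo pHi, (q ^ 3 * R q) * F q = 0)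
    (hM : IntegrableOn M (Set.Ioo pLo pHi))
    (hle : ∀ q ∈ Set.Ioo pLo pHi, (1 / √(q ^ 2 - p ^ 2) - R q) ^ 2 ≤ M q) :
    traveltime pLo pHi F p ^ 2 ≤ 4 * pHi ^ 6 * (∫ q in Set.Ioo pLo pHi, M q) * ‖F‖ ^ 2 := by
  have hq3 : ContinuousOn (fun q => q ^ 3 * R q) (Set.Icc pLo pHi) :=
    (continuousOn_pow 3).mul hR
  have hK : ContinuousOn (fun q => 1 / √(q ^ 2 - p ^ 2)) (Set.Icc pLo pHi) := by
    refine ContinuousOn.div (by fun_prop) (by fun_prop) fun q hq => ?_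
    have h0 : 0 < p := h.pos.trans hp.1
    have h1 : p < q := hp.2.trans_le (h.reflected.trans hq.1)
    exact (Real.sqrt_pos.mpr (by nlinarith)).ne'
  have hψ : MemLp (fun q => (1 / √(q ^ 2 - p ^ 2) - R q) * q ^ 3) 2
      (volume.restrict (Set.Ioo pLo pHi)) :=
    memLp_of_continuousOn ((hK.sub hR).mul (continuousOn_pow 3))
  have h1 : traveltime pLo pHi F p =
      2 * ∫ q in Set.Ioo pLo pHi, ((1 / √(q ^ 2 - p ^ 2) - R q) * q ^ 3) * F q := by
    have i2 : Integrable (fun q => (q ^ 3 * R q) * F q) (volume.restrict (Set.Ioo pLo pHi)) :=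
      (memLp_of_continuousOn hq3).integrable_mul (Lp.memLp F)
    have h2 := integral_sub (integrable_kernel h F hp) i2
    rw [hRF, sub_zero] at h2
    rw [traveltime, ← h2]
    congr 1
    exact integral_congr_ae (Filter.Eventually.of_forall fun q => by ring)
  rw [h1, mul_pow]
  have h3 := sq_integral_mul_le hψ F
  have h4 : ∫ q in Set.Ioo pLo pHi, ((1 / √(q ^ 2 - p ^ 2) - R q) * q ^ 3) ^ 2 ≤
      pHi ^ 6 * ∫ q in Set.Ioo pLo pHi, M q := by
    rw [← integral_const_mul]
    refine setIntegral_mono_on hψ.integrable_sq (hM.const_mul _) measurableSet_Ioo fun q hq => ?_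
    have h5 : (0 : ℝ) ≤ q := (h.pLo_pos.trans hq.1).le
    have h6 : q ^ 6 ≤ pHi ^ 6 := pow_le_pow_left₀ h5 hq.2.le 6
    calc ((1 / √(q ^ 2 - p ^ 2) - R q) * q ^ 3) ^ 2
        = q ^ 6 * (1 / √(q ^ 2 - p ^ 2) - R q) ^ 2 := by ring
      _ ≤ pHi ^ 6 * M q := mul_le_mul h6 (hle q hq) (sq_nonneg _) (by positivity)
  calc 2 ^ 2 * _ ≤ 2 ^ 2 * (pHi ^ 6 * (∫ q in Set.Ioo pLo pHi, M q) * ‖F‖ ^ 2) := by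
        gcongr
        exact h3.trans (mul_le_mul_of_nonneg_right h4 (sq_nonneg _))
    _ = _ := by ring

/-- Testing on the constant function `1` bounds the norm of the operator from below. -/
theorem norm_reflectedOp_ge (h : ReflectedGeometry pStar pTop pLo pHi) :
    (2 * pLo ^ 3 * (pHi - pLo) / pHi) ^ 2 / (pHi - pLo) * (pTop - pStar) ≤ ‖reflectedOp h‖ ^ 2 := by
  have hlo := h.pLo_pos
  have hhi := h.pHi_pos
  have hL : 0 < pHi - pLo := sub_pos.mpr h.medium
  have hone : MemLp (fun _ : ℝ => (1 : ℝ)) 2 (volume.restrict (Set.Ioo pLo pHi)) :=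
    memLp_of_continuousOn continuousOn_const
  set F : L2 pLo pHi := hone.toLp with hF
  set c := 2 * pLo ^ 3 * (pHi - pLo) / pHi with hc
  have hc0 : 0 ≤ c := by positivity
  have hFn : ‖F‖ ^ 2 = pHi - pLo := by
    rw [hF, norm_toLp_sq_eq_integral]
    simp [hL.le]
  have hτ : ∀ p ∈ Set.Ioo pStar pTop, c ≤ traveltime pLo pHi F p := by
    intro p hp
    have hp0 : 0 < p := h.pos.trans hp.1
    have h1 : ∫ _ in Set.Ioo pLo pHi, pLo ^ 3 / pHi ≤
        ∫ q in Set.Ioo pLo pHi, 1 / √(q ^ 2 - p ^ 2) * (q ^ 3 * F q) := by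
      refine integral_mono_ae (integrable_const _) (integrable_kernel h F hp) ?_
      filter_upwards [ae_restrict_mem measurableSet_Ioo, hone.coeFn_toLp] with q hq e
      have h2 : p < q := hp.2.trans_le (h.reflected.trans hq.1.le)
      have h3 : 0 < √(q ^ 2 - p ^ 2) := Real.sqrt_pos.mpr (by nlinarith)
      have h4 : √(q ^ 2 - p ^ 2) ≤ pHi := by
        rw [Real.sqrt_le_left hhi.le]
        nlinarith [hq.2, hq.1]
      have h5 : pLo ^ 3 ≤ q ^ 3 := pow_le_pow_left₀ hlo.le hq.1.le 3
      rw [hF, e, mul_one, one_div, ← div_eq_inv_mul]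
      have hq0 : 0 < q := hp0.trans h2
      exact div_le_div₀ (by positivity) h5 h3 h4
    have h6 : ∫ _ in Set.Ioo pLo pHi, pLo ^ 3 / pHi = (pHi - pLo) * (pLo ^ 3 / pHi) := by
      simp [hL.le]
    rw [h6] at h1
    rw [traveltime, hc]
    calc 2 * pLo ^ 3 * (pHi - pLo) / pHi = 2 * ((pHi - pLo) * (pLo ^ 3 / pHi)) := by ring
      _ ≤ _ := by gcongr
  have h1 : c ^ 2 * (pTop - pStar) ≤ ‖reflectedOp h F‖ ^ 2 := by
    rw [norm_reflectedOp_sq]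
    have h2 : ∫ _ in Set.Ioo pStar pTop, c ^ 2 = c ^ 2 * (pTop - pStar) := by
      simp [h.observed.le, mul_comm]
    rw [← h2]
    refine setIntegral_mono_on (integrableOn_const (by simp)) (integrableOn_traveltime_sq h F)
      measurableSet_Ioo fun p hp => ?_
    exact pow_le_pow_left₀ hc0 (hτ p hp) 2
  have h2 : ‖reflectedOp h F‖ ^ 2 ≤ ‖reflectedOp h‖ ^ 2 * (pHi - pLo) := by
    rw [← hFn, ← mul_pow]
    exact pow_le_pow_left₀ (norm_nonneg _) ((reflectedOp h).le_opNorm F) 2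
  rw [div_mul_eq_mul_div, div_le_iff₀ hL]
  exact h1.trans h2

theorem norm_reflectedOp_pos (h : ReflectedGeometry pStar pTop pLo pHi) : 0 < ‖reflectedOp h‖ := by
  have h1 := norm_reflectedOp_ge h
  have hlo := h.pLo_pos
  have hhi := h.pHi_pos
  have hL : 0 < pHi - pLo := sub_pos.mpr h.medium
  have hO : 0 < pTop - pStar := sub_pos.mpr h.observed
  have h2 : 0 < (2 * pLo ^ 3 * (pHi - pLo) / pHi) ^ 2 / (pHi - pLo) * (pTop - pStar) := by positivity
  by_contra! h3
  have h4 : ‖reflectedOp h‖ = 0 := le_antisymm h3 (norm_nonneg _)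
  rw [h4] at h1
  linarith

end Geometry

/-! ### Expansion of the kernel on one dyadic piece -/

theorem abs_pow_sub_one_le {w : ℝ} (hw : |w| ≤ 1) (n : ℕ) : |w ^ n - 1| ≤ n * (1 - w) := by
  induction n with
  | zero => simp
  | succ n ih =>
    have h1 : w ^ (n + 1) - 1 = w * (w ^ n - 1) - (1 - w) := by ring
    have h2 : 0 ≤ 1 - w := by linarith [(abs_le.mp hw).2]
    rw [h1]
    calc |w * (w ^ n - 1) - (1 - w)| ≤ |w * (w ^ n - 1)| + |1 - w| := abs_sub _ _
      _ ≤ n * (1 - w) + (1 - w) := by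
        rw [abs_mul, abs_of_nonneg h2]
        exact add_le_add ((mul_le_of_le_one_left (abs_nonneg _) hw).trans ih) le_rfl
      _ = _ := by push_cast; ring

/-- The coefficients of the approximant to `(1 - zw) ^ (-1/2)` as a polynomial in `w` of degree
`M`: the binomial series up to degree `M - 1`, and at degree `M` the whole tail of the series
at `w = 1`, so that the approximation is exact at `w = 1`. -/
noncomputable def expansionCoeff (M : ℕ) (z : ℝ) (n : ℕ) : ℝ :=
  if n < M then invSqrtCoeff n * z ^ n else ∑' k, invSqrtCoeff (k + M) * z ^ (k + M)

theorem abs_inv_sqrt_sub_expansion_le {z w γ : ℝ} (hz : |z| ≤ γ) (hγ : γ < 1) (hw : |w| ≤ 1)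
    (M : ℕ) :
    |1 / √(1 - z * w) - ∑ n ∈ Finset.range (M + 1), expansionCoeff M z n * w ^ n| ≤
      γ ^ M * (γ / (1 - γ) ^ 2) * (1 - w) := by
  have hγ0 : 0 ≤ γ := (abs_nonneg z).trans hz
  have hz1 : |z| < 1 := hz.trans_lt hγ
  have hzw : |z * w| < 1 := by
    rw [abs_mul]
    exact (mul_le_of_le_one_right (abs_nonneg _) hw).trans_lt hz1
  have h1 := (hasSum_nat_add_iff' M).mpr (hasSum_invSqrtCoeff hzw)
  have h2 : HasSum (fun k => w ^ M * (invSqrtCoeff (k + M) * z ^ (k + M)))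
      (w ^ M * ∑' k, invSqrtCoeff (k + M) * z ^ (k + M)) :=
    (((summable_nat_add_iff M).mpr (hasSum_invSqrtCoeff hz1).summable).hasSum).mul_left _
  have h3 := h1.sub h2
  have h4 : 1 / √(1 - z * w) - ∑ n ∈ Finset.range (M + 1), expansionCoeff M z n * w ^ n =
      1 / √(1 - z * w) - ∑ i ∈ Finset.range M, invSqrtCoeff i * (z * w) ^ i -
        w ^ M * ∑' k, invSqrtCoeff (k + M) * z ^ (k + M) := by
    rw [Finset.sum_range_succ]
    have : ∑ n ∈ Finset.range M, expansionCoeff M z n * w ^ n =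
        ∑ i ∈ Finset.range M, invSqrtCoeff i * (z * w) ^ i := by
      refine Finset.sum_congr rfl fun n hn => ?_
      rw [expansionCoeff, if_pos (Finset.mem_range.mp hn), mul_pow]
      ring
    rw [this, expansionCoeff, if_neg (lt_irrefl M)]
    ring
  rw [h4, ← h3.tsum_eq, ← Real.norm_eq_abs]
  have h5 : HasSum (fun n : ℕ => γ ^ M * (n * γ ^ n) * (1 - w))
      (γ ^ M * (γ / (1 - γ) ^ 2) * (1 - w)) :=
    ((hasSum_coe_mul_geometric_of_norm_lt_one
      (by rwa [Real.norm_of_nonneg hγ0])).mul_left (γ ^ M)).mul_right (1 - w)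
  refine tsum_of_norm_bounded h5 fun n => ?_
  have h6 : invSqrtCoeff (n + M) * (z * w) ^ (n + M) - w ^ M * (invSqrtCoeff (n + M) * z ^ (n + M)) =
      invSqrtCoeff (n + M) * (z ^ (n + M) * (w ^ M * (w ^ n - 1))) := by
    rw [mul_pow]
    ring
  have h7 : 0 ≤ 1 - w := by linarith [(abs_le.mp hw).2]
  rw [h6, norm_mul, norm_mul, norm_mul, Real.norm_of_nonneg (invSqrtCoeff_pos _).le, norm_pow, norm_pow,
    Real.norm_eq_abs, Real.norm_eq_abs, Real.norm_eq_abs]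
  calc invSqrtCoeff (n + M) * (|z| ^ (n + M) * (|w| ^ M * |w ^ n - 1|))
      ≤ 1 * (γ ^ (n + M) * (1 * (n * (1 - w)))) := by
        gcongr
        · exact invSqrtCoeff_le_one _
        · exact pow_le_one₀ (abs_nonneg _) hw
        · exact abs_pow_sub_one_le hw n
    _ = _ := by rw [pow_add]; ring

/-- The variables `z = (u - g) / (u + g)` and `w = (v - g) / (v + g)` turn the kernel
`(u + v) ^ (-1/2)` into `(1 - zw) ^ (-1/2)` up to factors depending on one variable only. -/
theorem inv_sqrt_add_eq {u v g : ℝ} (hu : 0 < u) (hv : 0 < v) (hg : 0 < g) :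
    1 / √(u + v) = √(2 * g / (u + g)) / √(g + v) *
      (1 / √(1 - (u - g) / (u + g) * ((v - g) / (v + g)))) := by
  have h1 : 1 - (u - g) / (u + g) * ((v - g) / (v + g)) = 2 * g / (u + g) * ((u + v) / (g + v)) := by
    field_simp
    ring
  rw [h1, Real.sqrt_mul (by positivity), Real.sqrt_div (by positivity : 0 ≤ u + v)]
  have h2 : √(2 * g / (u + g)) ≠ 0 := (Real.sqrt_pos.mpr (by positivity)).ne'
  have h3 : √(g + v) ≠ 0 := (Real.sqrt_pos.mpr (by positivity)).ne'
  have h4 : √(u + v) ≠ 0 := (Real.sqrt_pos.mpr (by positivity)).ne'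
  field_simp

theorem sq_inv_sqrt_add_sub_expansion_le {u v g γ : ℝ} (hu : 0 < u) (hv : 0 < v) (hg : 0 < g)
    (hz : |(u - g) / (u + g)| ≤ γ) (hγ : γ < 1) (M : ℕ) :
    (1 / √(u + v) - ∑ n ∈ Finset.range (M + 1), √(2 * g / (u + g)) *
      expansionCoeff M ((u - g) / (u + g)) n * (((v - g) / (v + g)) ^ n / √(g + v))) ^ 2 ≤
      8 * (γ / (1 - γ) ^ 2) ^ 2 * (γ ^ M) ^ 2 * (g / (g + v) ^ 2) := by
  set z := (u - g) / (u + g) with hzdef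
  set w := (v - g) / (v + g) with hwdef
  have hw : |w| ≤ 1 := by
    rw [hwdef, abs_div, abs_of_pos (by positivity : 0 < v + g), div_le_one (by positivity), abs_le]
    constructor <;> linarith
  have h1w : 1 - w = 2 * g / (g + v) := by rw [hwdef]; field_simp; ring
  have h1 : 1 / √(u + v) - ∑ n ∈ Finset.range (M + 1), √(2 * g / (u + g)) *
      expansionCoeff M z n * (w ^ n / √(g + v)) =
      √(2 * g / (u + g)) / √(g + v) *
        (1 / √(1 - z * w) - ∑ n ∈ Finset.range (M + 1), expansionCoeff M z n * w ^ n) := by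
    rw [inv_sqrt_add_eq hu hv hg, mul_sub, Finset.mul_sum]
    congr 1
    exact Finset.sum_congr rfl fun n _ => by ring
  rw [h1, mul_pow, div_pow, Real.sq_sqrt (by positivity), Real.sq_sqrt (by positivity), ← sq_abs (_ - _)]
  have h2 := abs_inv_sqrt_sub_expansion_le hz hγ hw M
  have hγ0 : 0 ≤ γ := (abs_nonneg z).trans hz
  calc 2 * g / (u + g) / (g + v) * |1 / √(1 - z * w) -
        ∑ n ∈ Finset.range (M + 1), expansionCoeff M z n * w ^ n| ^ 2
      ≤ 2 / (g + v) * (γ ^ M * (γ / (1 - γ) ^ 2) * (1 - w)) ^ 2 := by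
        gcongr
        rw [div_le_iff₀ (by positivity)]
        linarith
    _ = 8 * (γ / (1 - γ) ^ 2) ^ 2 * (γ ^ M) ^ 2 * ((g / (g + v) ^ 2) * (g / (g + v))) := by
        rw [h1w]
        field_simp
        ring
    _ ≤ 8 * (γ / (1 - γ) ^ 2) ^ 2 * (γ ^ M) ^ 2 * ((g / (g + v) ^ 2) * 1) := by
        gcongr
        rw [div_le_one (by positivity)]
        linarith
    _ = _ := by rw [mul_one]

theorem setIntegral_div_sq_le {g c a b : ℝ} (hg : 0 < g) (hc : 0 < c) (hab : a ≤ b) :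
    ∫ q in Set.Ioo a b, g / (g + c * (q - a)) ^ 2 ≤ 1 / c := by
  rw [← integral_Ioc_eq_integral_Ioo, ← intervalIntegral.integral_of_le hab]
  have hpos : ∀ x ∈ Set.uIcc a b, 0 < g + c * (x - a) := fun x hx => by
    rw [Set.uIcc_of_le hab] at hx
    have := mul_nonneg hc.le (sub_nonneg.mpr hx.1)
    linarith
  have hder : ∀ x ∈ Set.uIcc a b, HasDerivAt (fun x => -(g / c) * (g + c * (x - a))⁻¹)
      (g / (g + c * (x - a)) ^ 2) x := by
    intro x hx
    have h1 : HasDerivAt (fun x => g + c * (x - a)) c x := by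
      have := (((hasDerivAt_id x).sub_const a).const_mul c).const_add g
      simpa using this
    refine ((h1.inv (hpos x hx).ne').const_mul (-(g / c))).congr_deriv ?_
    field_simp
  have hcont : ContinuousOn (fun q => g / (g + c * (q - a)) ^ 2) (Set.uIcc a b) :=
    ContinuousOn.div (by fun_prop) (by fun_prop) fun x hx => (pow_pos (hpos x hx) 2).ne'
  rw [intervalIntegral.integral_eq_sub_of_hasDerivAt hder hcont.intervalIntegrable]
  have hb := hpos b Set.right_mem_uIcc
  have h2 : 0 ≤ g / c * (g + c * (b - a))⁻¹ := by positivity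
  have h3 : g / c * (g + c * (a - a))⁻¹ = 1 / c := by
    rw [sub_self, mul_zero, add_zero]
    field_simp
  linarith

/-! ### The traveltime of a distribution orthogonal to the dyadic test functions -/

section Dyadic

variable {pStar pTop pLo pHi : ℝ}

/-- The function `w(v)ⁿ / √(g + v)` with `v = q² - pLo²` and `w(v) = (v - g) / (v + g)`. -/
noncomputable def dyadicTest (pLo g : ℝ) (n : ℕ) (q : ℝ) : ℝ :=
  ((q ^ 2 - pLo ^ 2 - g) / (q ^ 2 - pLo ^ 2 + g)) ^ n / √(g + (q ^ 2 - pLo ^ 2))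

theorem continuousOn_dyadicTest (hlo : 0 < pLo) {g : ℝ} (hg : 0 < g) (n : ℕ) :
    ContinuousOn (dyadicTest pLo g n) (Set.Icc pLo pHi) := by
  have h1 : ∀ q ∈ Set.Icc pLo pHi, 0 < q ^ 2 - pLo ^ 2 + g := fun q hq => by nlinarith [hq.1]
  refine ContinuousOn.div (ContinuousOn.pow (ContinuousOn.div (by fun_prop) (by fun_prop)
    fun q hq => (h1 q hq).ne') n) (by fun_prop) fun q hq => ?_
  exact (Real.sqrt_pos.mpr (by linarith [h1 q hq])).ne'

theorem memLp_dyadicTest (hlo : 0 < pLo) {g : ℝ} (hg : 0 < g) (n : ℕ) :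
    MemLp (fun q => q ^ 3 * dyadicTest pLo g n q) 2 (volume.restrict (Set.Ioo pLo pHi)) :=
  memLp_of_continuousOn ((continuousOn_pow 3).mul (continuousOn_dyadicTest hlo hg n))

theorem traveltime_sq_le_of_dyadic (h : ReflectedGeometry pStar pTop pLo pHi) (F : L2 pLo pHi)
    {p : ℝ} (hp : p ∈ Set.Ioo pStar pTop) {g γ : ℝ} (hg : 0 < g) (hγ : γ < 1)
    (hz : |(pLo ^ 2 - p ^ 2 - g) / (pLo ^ 2 - p ^ 2 + g)| ≤ γ) (M : ℕ)
    (hF : ∀ n ≤ M, ∫ q in Set.Ioo pLo pHi, (q ^ 3 * dyadicTest pLo g n q) * F q = 0) :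
    traveltime pLo pHi F p ^ 2 ≤
      16 * pHi ^ 6 / pLo * (γ / (1 - γ) ^ 2) ^ 2 * (γ ^ M) ^ 2 * ‖F‖ ^ 2 := by
  have hlo := h.pLo_pos
  have hhi := h.pHi_pos
  have hp0 : 0 < p := h.pos.trans hp.1
  have hpl : p < pLo := hp.2.trans_le h.reflected
  set u := pLo ^ 2 - p ^ 2 with hu
  have hu0 : 0 < u := by nlinarith
  set c : ℕ → ℝ := fun n => √(2 * g / (u + g)) * expansionCoeff M ((u - g) / (u + g)) n with hc
  set R : ℝ → ℝ := fun q => ∑ n ∈ Finset.range (M + 1), c n * dyadicTest pLo g n q with hR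
  have hRc : ContinuousOn R (Set.Icc pLo pHi) :=
    continuousOn_finsetSum _ fun n _ => continuousOn_const.mul (continuousOn_dyadicTest hlo hg n)
  have hRF : ∫ q in Set.Ioo pLo pHi, (q ^ 3 * R q) * F q = 0 := by
    have h1 : ∀ q, (q ^ 3 * R q) * F q =
        ∑ n ∈ Finset.range (M + 1), c n * ((q ^ 3 * dyadicTest pLo g n q) * F q) := by
      intro q
      rw [hR, Finset.mul_sum, Finset.sum_mul]
      exact Finset.sum_congr rfl fun n _ => by ring
    simp_rw [h1]
    have hi : ∀ n, Integrable (fun q => c n * ((q ^ 3 * dyadicTest pLo g n q) * F q))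
        (volume.restrict (Set.Ioo pLo pHi)) := fun n =>
      ((memLp_dyadicTest hlo hg n).integrable_mul (Lp.memLp F)).const_mul (c n)
    rw [integral_finsetSum _ fun n _ => hi n]
    refine Finset.sum_eq_zero fun n hn => ?_
    rw [integral_const_mul, hF n (by simpa [Nat.lt_succ_iff] using hn), mul_zero]
  set K := 8 * (γ / (1 - γ) ^ 2) ^ 2 * (γ ^ M) ^ 2 with hK
  set Maj : ℝ → ℝ := fun q => K * (g / (g + 2 * pLo * (q - pLo)) ^ 2) with hMaj
  have hMint : IntegrableOn Maj (Set.Ioo pLo pHi) := by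
    refine ((ContinuousOn.mul continuousOn_const (ContinuousOn.div (by fun_prop) (by fun_prop)
      fun q hq => ?_)).integrableOn_Icc (μ := volume) (a := pLo) (b := pHi)).mono_set Set.Ioo_subset_Icc_self
    have := mul_nonneg (mul_pos two_pos hlo).le (sub_nonneg.mpr hq.1)
    positivity
  have hle : ∀ q ∈ Set.Ioo pLo pHi, (1 / √(q ^ 2 - p ^ 2) - R q) ^ 2 ≤ Maj q := by
    intro q hq
    have hv0 : 0 < q ^ 2 - pLo ^ 2 := by nlinarith [hq.1]
    have h1 := sq_inv_sqrt_add_sub_expansion_le hu0 hv0 hg hz hγ M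
    rw [show u + (q ^ 2 - pLo ^ 2) = q ^ 2 - p ^ 2 by rw [hu]; ring] at h1
    refine h1.trans ?_
    have h2 : 2 * pLo * (q - pLo) ≤ q ^ 2 - pLo ^ 2 := by nlinarith [hq.1, sq_nonneg (q - pLo)]
    have h3 : 0 ≤ 2 * pLo * (q - pLo) := mul_nonneg (by positivity) (by linarith [hq.1])
    simp only [hMaj, ← hK]
    gcongr
  have h1 := traveltime_sq_le_of_orthogonal h F hp hRc hRF hMint hle
  refine h1.trans ?_
  have h2 : ∫ q in Set.Ioo pLo pHi, Maj q ≤ K * (1 / (2 * pLo)) := by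
    rw [hMaj, integral_const_mul]
    exact mul_le_mul_of_nonneg_left (setIntegral_div_sq_le hg (by positivity) h.medium.le)
      (by positivity)
  calc 4 * pHi ^ 6 * (∫ q in Set.Ioo pLo pHi, Maj q) * ‖F‖ ^ 2
      ≤ 4 * pHi ^ 6 * (K * (1 / (2 * pLo))) * ‖F‖ ^ 2 := by gcongr
    _ = _ := by rw [hK]; field_simp; ring

end Dyadic

/-! ### The root-exponential lower bound -/

/-- The average of an increasing function over an initial interval is at most its average over the
whole interval. -/
theorem mul_integral_le_mul_integral_of_monotone {f : ℝ → ℝ} {a b c : ℝ} (hab : a < b) (hbc : b ≤ c)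
    (hf : ∀ x y, a < x → x ≤ y → y < c → f x ≤ f y) (hi : IntervalIntegrable f volume a c) :
    (c - a) * ∫ x in a..b, f x ≤ (b - a) * ∫ x in a..c, f x := by
  rcases hbc.eq_or_lt with rfl | hbc
  · exact le_rfl
  have hac := hab.trans hbc
  have i1 : IntervalIntegrable f volume a b :=
    hi.mono_set (by rw [Set.uIcc_of_le hab.le, Set.uIcc_of_le hac.le]; exact Set.Icc_subset_Icc_right hbc.le)
  have i2 : IntervalIntegrable f volume b c :=
    hi.mono_set (by rw [Set.uIcc_of_le hbc.le, Set.uIcc_of_le hac.le]; exact Set.Icc_subset_Icc_left hab.le)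
  have h1 : ∫ x in a..b, f x ≤ ∫ _ in a..b, f b :=
    intervalIntegral.integral_mono_on_of_le_Ioo hab.le i1 intervalIntegrable_const
      fun x hx => hf x b hx.1 hx.2.le hbc
  have h2 : ∫ _ in b..c, f b ≤ ∫ x in b..c, f x :=
    intervalIntegral.integral_mono_on_of_le_Ioo hbc.le intervalIntegrable_const i2
      fun x hx => hf b x hab hx.1.le hx.2
  rw [intervalIntegral.integral_const, smul_eq_mul] at h1 h2
  rw [← intervalIntegral.integral_add_adjacent_intervals i1 i2]
  nlinarith [mul_le_mul_of_nonneg_left h1 (sub_pos.mpr hbc).le,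
    mul_le_mul_of_nonneg_left h2 (sub_pos.mpr hab).le]

theorem sqrt_two_sub_one_pos : 0 < √2 - 1 := by
  rw [sub_pos]
  exact Real.lt_sqrt_of_sq_lt (by norm_num)

theorem sqrt_two_sub_one_lt_one : √2 - 1 < 1 := by
  have : √2 < 2 := by rw [Real.sqrt_lt' two_pos]; norm_num
  linarith

/-- With `γ = √2 - 1` the Möbius map `u ↦ (u - g) / (u + g)` sends `[γ g, g / γ]` to `[-γ, γ]`. -/
theorem abs_moebius_le {u g : ℝ} (hg : 0 < g) (h1 : (√2 - 1) * g ≤ u) (h2 : (√2 - 1) * u ≤ g) :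
    |(u - g) / (u + g)| ≤ √2 - 1 := by
  set γ := √2 - 1 with hγ
  have hγ0 : 0 < γ := sqrt_two_sub_one_pos
  have hγ1 : γ < 1 := sqrt_two_sub_one_lt_one
  have hq : γ ^ 2 + 2 * γ = 1 := by
    rw [hγ]
    nlinarith [Real.sq_sqrt (show (0 : ℝ) ≤ 2 by norm_num)]
  have hu : 0 < u := (mul_pos hγ0 hg).trans_le h1
  rw [abs_div, abs_of_pos (by positivity : 0 < u + g), div_le_iff₀ (by positivity), abs_le]
  constructor
  · nlinarith
  · nlinarith

section RootExponential

variable {pStar pTop pLo pHi : ℝ}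

/-- The scale `g` of the `k`-th dyadic piece, on which `pLo² - p²` lies between
`γ^(2k+2) (pLo² - pStar²)` and `γ^(2k) (pLo² - pStar²)` with `γ = √2 - 1`. -/
noncomputable def dyadicScale (pStar pLo : ℝ) (k : ℕ) : ℝ :=
  (pLo ^ 2 - pStar ^ 2) * (√2 - 1) ^ (2 * k + 1)

theorem ReflectedGeometry.sq_sub_sq_pos (h : ReflectedGeometry pStar pTop pLo pHi) :
    0 < pLo ^ 2 - pStar ^ 2 := by
  nlinarith [h.pos, h.observed, h.reflected]

theorem dyadicScale_pos (h : ReflectedGeometry pStar pTop pLo pHi) (k : ℕ) :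
    0 < dyadicScale pStar pLo k :=
  mul_pos h.sq_sub_sq_pos (pow_pos sqrt_two_sub_one_pos _)

/-- `F` is orthogonal to the test functions of the first `4m` dyadic pieces: to `m - k + 1` of them
on the `k`-th piece, but to one at least. -/
def DyadicOrthogonal (pStar : ℝ) {pLo pHi : ℝ} (m : ℕ) (F : L2 pLo pHi) : Prop :=
  ∀ k < 4 * m, ∀ n ≤ m - k,
    ∫ q in Set.Ioo pLo pHi, (q ^ 3 * dyadicTest pLo (dyadicScale pStar pLo k) n q) * F q = 0

/-- The majorant of the squared traveltime of an orthogonal distribution, as a function of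
`s = pLo - p`. -/
noncomputable def dyadicMajorant (ε s : ℝ) : ℝ := 1 / (s + ε) + s ^ (-(3 / 4) : ℝ)

theorem exists_traveltime_sq_le_dyadicMajorant (pStar pLo pHi : ℝ) :
    ∃ C : ℝ, 0 < C ∧ ∀ (pTop : ℝ), ReflectedGeometry pStar pTop pLo pHi → ∀ (m : ℕ) (F : L2 pLo pHi),
      DyadicOrthogonal pStar m F → ∀ p ∈ Set.Ioo pStar pTop, traveltime pLo pHi F p ^ 2 ≤
        C * (√2 - 1) ^ (2 * m) * dyadicMajorant ((√2 - 1) ^ (2 * m)) (pLo - p) * ‖F‖ ^ 2 := by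
  by_cases hex : ∃ pTop, ReflectedGeometry pStar pTop pLo pHi
  swap
  · exact ⟨1, one_pos, fun pTop h => (hex ⟨pTop, h⟩).elim⟩
  obtain ⟨pT, hT⟩ := hex
  have hlo := hT.pLo_pos
  have hhi := hT.pHi_pos
  set a := pLo ^ 2 - pStar ^ 2 with ha
  have ha0 : 0 < a := hT.sq_sub_sq_pos
  set γ := √2 - 1 with hγ
  have hγ0 : 0 < γ := sqrt_two_sub_one_pos
  have hγ1 : γ < 1 := sqrt_two_sub_one_lt_one
  set C1 := 16 * pHi ^ 6 / pLo * (γ / (1 - γ) ^ 2) ^ 2 with hC1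
  have hC1p : 0 < C1 := by
    have : 0 < 1 - γ := by linarith
    positivity
  set C2 := kernelBound pLo pHi ^ 2 * (a / pLo) ^ (1 / 4 : ℝ) with hC2
  have hC2p : 0 ≤ C2 := by positivity
  refine ⟨C1 * (a / pLo + 1) + C2, by positivity, fun pTop h m F hF p hp => ?_⟩
  set ε := γ ^ (2 * m) with hε
  have hε0 : 0 < ε := by positivity
  have hp0 : 0 < p := h.pos.trans hp.1
  have hs : 0 < pLo - p := by linarith [hp.2, h.reflected]
  set s := pLo - p with hsdef
  set u := pLo ^ 2 - p ^ 2 with hu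
  have hu0 : 0 < u := by nlinarith
  have hua : u ≤ a := by nlinarith [hp.1, h.pos]
  have hsu : pLo * s ≤ u := by nlinarith
  obtain ⟨k, hk1, hk2⟩ := exists_nat_pow_near_of_lt_one (x := u / a) (y := γ ^ 2) (by positivity)
    ((div_le_one ha0).mpr hua) (by positivity) (by nlinarith)
  rw [lt_div_iff₀ ha0] at hk1
  rw [div_le_iff₀ ha0] at hk2
  have hsε : 0 < s + ε := by positivity
  have hs34 : 0 < s ^ (-(3 / 4) : ℝ) := Real.rpow_pos_of_pos hs _
  suffices hmain : traveltime pLo pHi F p ^ 2 ≤ C1 * (a / pLo + 1) * ε * (1 / (s + ε)) * ‖F‖ ^ 2 ∨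
      traveltime pLo pHi F p ^ 2 ≤ C2 * ε * s ^ (-(3 / 4) : ℝ) * ‖F‖ ^ 2 by
    have e1 : 0 ≤ C1 * (a / pLo + 1) * ε * (1 / (s + ε)) * ‖F‖ ^ 2 := by positivity
    have e2 : 0 ≤ C2 * ε * s ^ (-(3 / 4) : ℝ) * ‖F‖ ^ 2 := by positivity
    have e3 : 0 ≤ C2 * ε * (1 / (s + ε)) * ‖F‖ ^ 2 := by positivity
    have e4 : 0 ≤ C1 * (a / pLo + 1) * ε * s ^ (-(3 / 4) : ℝ) * ‖F‖ ^ 2 := by positivity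
    have e5 : (C1 * (a / pLo + 1) + C2) * ε * dyadicMajorant ε s * ‖F‖ ^ 2 =
        C1 * (a / pLo + 1) * ε * (1 / (s + ε)) * ‖F‖ ^ 2 + C2 * ε * s ^ (-(3 / 4) : ℝ) * ‖F‖ ^ 2 +
        C2 * ε * (1 / (s + ε)) * ‖F‖ ^ 2 + C1 * (a / pLo + 1) * ε * s ^ (-(3 / 4) : ℝ) * ‖F‖ ^ 2 := by
      rw [dyadicMajorant]; ring
    rw [e5]
    rcases hmain with h1 | h1 <;> linarith
  by_cases hk : k < 4 * m
  · left
    have hg := dyadicScale_pos h k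
    have hgdef : dyadicScale pStar pLo k = (γ ^ 2) ^ k * a * γ := by
      rw [dyadicScale, ← ha, ← hγ, pow_succ γ (2 * k), pow_mul]; ring
    have h1 := traveltime_sq_le_of_dyadic h F hp hg hγ1 (abs_moebius_le hg
      (by rw [← hγ, hgdef]; rw [pow_succ] at hk1; linarith)
      (by rw [← hγ, hgdef]; nlinarith)) (m - k) (hF k hk)
    rw [← hC1] at h1
    refine h1.trans ?_
    have h2 : (γ ^ (m - k)) ^ 2 ≤ (a / pLo + 1) * ε * (1 / (s + ε)) := by
      rw [mul_one_div, le_div_iff₀ hsε]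
      have h3 : s ≤ γ ^ (2 * k) * (a / pLo) := by
        rw [mul_div_assoc', le_div_iff₀ hlo, pow_mul]
        linarith
      have h4 : (γ ^ (m - k)) ^ 2 * γ ^ (2 * k) ≤ ε := by
        rw [← pow_mul, ← pow_add]
        exact pow_le_pow_of_le_one hγ0.le hγ1.le (by omega)
      have h5 : (γ ^ (m - k)) ^ 2 ≤ 1 := pow_le_one₀ (by positivity) (pow_le_one₀ hγ0.le hγ1.le)
      calc (γ ^ (m - k)) ^ 2 * (s + ε) ≤ (γ ^ (m - k)) ^ 2 * (γ ^ (2 * k) * (a / pLo) + ε) := by gcongr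
        _ = ((γ ^ (m - k)) ^ 2 * γ ^ (2 * k)) * (a / pLo) + (γ ^ (m - k)) ^ 2 * ε := by ring
        _ ≤ ε * (a / pLo) + 1 * ε := by gcongr
        _ = _ := by ring
    calc C1 * (γ ^ (m - k)) ^ 2 * ‖F‖ ^ 2
        ≤ C1 * ((a / pLo + 1) * ε * (1 / (s + ε))) * ‖F‖ ^ 2 := by gcongr
      _ = _ := by ring
  · right
    have h1 := abs_traveltime_le h F hp
    rw [← hsdef] at h1
    have h2 : traveltime pLo pHi F p ^ 2 ≤ (kernelBound pLo pHi * ‖F‖ * s ^ (-(1 / 4) : ℝ)) ^ 2 := by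
      rw [← sq_abs]
      exact pow_le_pow_left₀ (abs_nonneg _) h1 2
    have h3 : (s ^ (-(1 / 4) : ℝ)) ^ 2 = s ^ (1 / 4 : ℝ) * s ^ (-(3 / 4) : ℝ) := by
      rw [← Real.rpow_natCast, ← Real.rpow_mul hs.le, ← Real.rpow_add hs]
      norm_num
    have h4 : s ^ (1 / 4 : ℝ) ≤ (a / pLo) ^ (1 / 4 : ℝ) * ε := by
      have h5 : s ≤ a / pLo * ε ^ 4 := by
        rw [div_mul_eq_mul_div, le_div_iff₀ hlo]
        have h6 : (γ ^ 2) ^ k ≤ ε ^ 4 := by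
          rw [hε, ← pow_mul, ← pow_mul]
          exact pow_le_pow_of_le_one hγ0.le hγ1.le (by omega)
        nlinarith
      have h6 : (ε ^ 4) ^ (1 / 4 : ℝ) = ε := by
        rw [← Real.rpow_natCast, ← Real.rpow_mul hε0.le]
        norm_num
      calc s ^ (1 / 4 : ℝ) ≤ (a / pLo * ε ^ 4) ^ (1 / 4 : ℝ) := by gcongr
        _ = _ := by rw [Real.mul_rpow (by positivity) (by positivity), h6]
    refine h2.trans ?_
    calc (kernelBound pLo pHi * ‖F‖ * s ^ (-(1 / 4) : ℝ)) ^ 2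
        = kernelBound pLo pHi ^ 2 * (s ^ (1 / 4 : ℝ) * s ^ (-(3 / 4) : ℝ)) * ‖F‖ ^ 2 := by
          rw [← h3]; ring
      _ ≤ kernelBound pLo pHi ^ 2 * (((a / pLo) ^ (1 / 4 : ℝ) * ε) * s ^ (-(3 / 4) : ℝ)) * ‖F‖ ^ 2 := by
          gcongr
      _ = _ := by rw [hC2]; ring

theorem intervalIntegrable_dyadicMajorant {ε L : ℝ} (hε : 0 < ε) (hL : 0 ≤ L) :
    IntervalIntegrable (dyadicMajorant ε) volume 0 L := by
  refine IntervalIntegrable.add ?_ (intervalIntegral.intervalIntegrable_rpow' (by norm_num))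
  refine ContinuousOn.intervalIntegrable (ContinuousOn.div (by fun_prop) (by fun_prop) fun x hx => ?_)
  rw [Set.uIcc_of_le hL] at hx
  linarith [hx.1]

theorem integral_dyadicMajorant_le {L : ℝ} (hL : 0 ≤ L) (m : ℕ) :
    ∫ s in (0 : ℝ)..L, dyadicMajorant ((√2 - 1) ^ (2 * m)) s ≤
      (L + 4 * L ^ (1 / 4 : ℝ) - 2 * Real.log (√2 - 1)) * (m + 1) := by
  have hγ0 := sqrt_two_sub_one_pos
  have hγ1 := sqrt_two_sub_one_lt_one
  set ε := (√2 - 1) ^ (2 * m) with hε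
  have hε0 : 0 < ε := by positivity
  have hε1 : ε ≤ 1 := pow_le_one₀ hγ0.le hγ1.le
  have i1 : IntervalIntegrable (fun s => 1 / (s + ε)) volume 0 L := by
    refine ContinuousOn.intervalIntegrable (ContinuousOn.div (by fun_prop) (by fun_prop) fun x hx => ?_)
    rw [Set.uIcc_of_le hL] at hx
    linarith [hx.1]
  have i2 : IntervalIntegrable (fun s : ℝ => s ^ (-(3 / 4) : ℝ)) volume 0 L :=
    intervalIntegral.intervalIntegrable_rpow' (by norm_num)
  have e1 : ∫ s in (0 : ℝ)..L, 1 / (s + ε) = Real.log (L + ε) - Real.log ε := by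
    rw [intervalIntegral.integral_comp_add_right (fun s => 1 / s), zero_add,
      integral_one_div_of_pos hε0 (by positivity), Real.log_div (by positivity) hε0.ne']
  have e2 : ∫ s in (0 : ℝ)..L, s ^ (-(3 / 4) : ℝ) = 4 * L ^ (1 / 4 : ℝ) := by
    rw [integral_rpow (Or.inl (by norm_num)), show (-(3 / 4) : ℝ) + 1 = 1 / 4 by norm_num,
      Real.zero_rpow (by norm_num)]
    ring
  have e3 : ∫ s in (0 : ℝ)..L, dyadicMajorant ε s =
      Real.log (L + ε) - Real.log ε + 4 * L ^ (1 / 4 : ℝ) := by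
    rw [← e1, ← e2, ← intervalIntegral.integral_add i1 i2]
    rfl
  rw [e3]
  have h1 : Real.log (L + ε) ≤ L := by
    have := Real.log_le_sub_one_of_pos (show 0 < L + ε by positivity)
    linarith
  have h2 : Real.log ε = 2 * m * Real.log (√2 - 1) := by
    rw [hε, Real.log_pow]
    push_cast
    ring
  have h3 : Real.log (√2 - 1) < 0 := Real.log_neg hγ0 hγ1
  have h4 : 0 ≤ L ^ (1 / 4 : ℝ) := Real.rpow_nonneg hL _
  have hm : (0 : ℝ) ≤ m := Nat.cast_nonneg m
  rw [h2]
  nlinarith [mul_nonneg hL hm, mul_nonneg h4 hm]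

theorem exists_norm_reflectedOp_sq_le_of_dyadicOrthogonal (pStar pLo pHi : ℝ) :
    ∃ C : ℝ, 0 < C ∧ ∀ (pTop : ℝ) (h : ReflectedGeometry pStar pTop pLo pHi) (m : ℕ)
      (F : L2 pLo pHi), DyadicOrthogonal pStar m F →
        ‖reflectedOp h F‖ ^ 2 ≤ C * (pTop - pStar) * ((m + 1) * (√2 - 1) ^ (2 * m)) * ‖F‖ ^ 2 := by
  obtain ⟨C, hC, hbound⟩ := exists_traveltime_sq_le_dyadicMajorant pStar pLo pHi
  by_cases hex : ∃ pTop, ReflectedGeometry pStar pTop pLo pHi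
  swap
  · exact ⟨1, one_pos, fun pTop h => (hex ⟨pTop, h⟩).elim⟩
  obtain ⟨pT, hT⟩ := hex
  have hL : 0 < pLo - pStar := by linarith [hT.observed, hT.reflected]
  set L := pLo - pStar with hLdef
  have hγ0 := sqrt_two_sub_one_pos
  have hlog : Real.log (√2 - 1) < 0 := Real.log_neg hγ0 sqrt_two_sub_one_lt_one
  set K := L + 4 * L ^ (1 / 4 : ℝ) - 2 * Real.log (√2 - 1) with hK
  have hK0 : 0 < K := by
    have := Real.rpow_nonneg hL.le (1 / 4 : ℝ)
    linarith
  refine ⟨C * (K / L), by positivity, fun pTop h m F hF => ?_⟩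
  set ε := (√2 - 1) ^ (2 * m) with hε
  have hε0 : 0 < ε := by positivity
  set f : ℝ → ℝ := fun p => dyadicMajorant ε (pLo - p) with hf
  have hfi : IntervalIntegrable f volume pStar pLo := by
    have := (intervalIntegrable_dyadicMajorant hε0 hL.le).comp_sub_left pLo
    simpa [hLdef] using this.symm
  have hfm : ∀ x y, pStar < x → x ≤ y → y < pLo → f x ≤ f y := by
    intro x y _ hxy hy
    have h1 : 0 < pLo - y := by linarith
    simp only [hf, dyadicMajorant]
    have h2 : (pLo - x) ^ (-(3 / 4) : ℝ) ≤ (pLo - y) ^ (-(3 / 4) : ℝ) :=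
      Real.rpow_le_rpow_of_nonpos h1 (by linarith) (by norm_num)
    have h3 : 1 / (pLo - x + ε) ≤ 1 / (pLo - y + ε) :=
      one_div_le_one_div_of_le (by positivity) (by linarith)
    linarith
  have h1 := mul_integral_le_mul_integral_of_monotone h.observed h.reflected hfm hfi
  have h2 : ∫ p in pStar..pLo, f p = ∫ s in (0 : ℝ)..L, dyadicMajorant ε s := by
    rw [hf, intervalIntegral.integral_comp_sub_left (fun s => dyadicMajorant ε s) pLo, sub_self]
  rw [h2] at h1
  have h3 : ∫ p in pStar..pTop, f p ≤ (pTop - pStar) * (K / L) * (m + 1) := by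
    have h4 := h1.trans (mul_le_mul_of_nonneg_left (integral_dyadicMajorant_le hL.le m)
      (sub_pos.mpr h.observed).le)
    rw [← hLdef, ← hK, mul_comm, ← le_div_iff₀ hL] at h4
    refine h4.trans (le_of_eq ?_)
    field_simp
  have hfi' : IntegrableOn f (Set.Ioo pStar pTop) := by
    have := (intervalIntegrable_iff_integrableOn_Ioo_of_le (by linarith)).mp hfi
    exact this.mono_set (Set.Ioo_subset_Ioo_right h.reflected)
  have h5 := norm_reflectedOp_sq_le h F (Φ := fun p => C * ε * f p) (hfi'.const_mul _)
    (hbound pTop h m F hF)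
  rw [integral_const_mul, ← integral_Ioc_eq_integral_Ioo,
    ← intervalIntegral.integral_of_le h.observed.le] at h5
  refine h5.trans ?_
  calc C * ε * (∫ p in pStar..pTop, f p) * ‖F‖ ^ 2
      ≤ C * ε * ((pTop - pStar) * (K / L) * (m + 1)) * ‖F‖ ^ 2 := by gcongr
    _ = _ := by ring

theorem sum_range_sub_add_one_le (m K : ℕ) :
    2 * ∑ k ∈ Finset.range K, (m - k + 1) ≤ m * (m + 1) + 2 * K := by
  induction K generalizing m with
  | zero => simp
  | succ K ih =>
    rw [Finset.sum_range_succ']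
    cases m with
    | zero => simp
    | succ m =>
      have := ih m
      have h2 : ∀ k, m + 1 - (k + 1) + 1 = m - k + 1 := fun k => by omega
      simp_rw [h2]
      simp only [Nat.sub_zero]
      nlinarith

theorem exists_mem_dyadicOrthogonal (h : ReflectedGeometry pStar pTop pLo pHi)
    (V : Submodule ℝ (L2 pLo pHi)) [FiniteDimensional ℝ V] {m : ℕ}
    (hm : m * (m + 9) < 2 * Module.finrank ℝ V) :
    ∃ F ∈ V, F ≠ 0 ∧ DyadicOrthogonal pStar m F := by
  obtain ⟨F, hFV, hF0, hF⟩ := exists_mem_ne_zero_forall_apply_eq_zero V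
    (ι := Σ k : Fin (4 * m), Fin (m - k + 1))
    (fun i => integralFunctional (memLp_dyadicTest h.pLo_pos (dyadicScale_pos h i.1) (i.2 : ℕ))) (by
      rw [Fintype.card_sigma]
      simp only [Fintype.card_fin]
      rw [Fin.sum_univ_eq_sum_range (fun k => m - k + 1)]
      have := sum_range_sub_add_one_le m (4 * m)
      nlinarith)
  refine ⟨F, hFV, hF0, fun k hk n hn => ?_⟩
  have h1 := hF ⟨⟨k, hk⟩, ⟨n, Nat.lt_succ_of_le hn⟩⟩
  rwa [integralFunctional_apply] at h1

/-- The lower bound `C N ^ (-1/4) exp (c √N)` for the condition number. -/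
theorem exists_rootExp_le_condNumber (pStar pLo pHi : ℝ) :
    ∃ C : ℝ, 0 < C ∧
      ∀ (pTop : ℝ) (h : ReflectedGeometry pStar pTop pLo pHi) (N : ℕ), 1 ≤ N →
        ∀ (U : Submodule ℝ (L2 pStar pTop)) [U.HasOrthogonalProjection]
          (V : Submodule ℝ (L2 pLo pHi)) [FiniteDimensional ℝ V],
          Module.finrank ℝ V = N → IsReasonable (reflectedOp h) U V →
            ENNReal.ofReal (C * (N : ℝ) ^ (-(1 / 4) : ℝ) * Real.exp (rootExpRate * √N)) ≤
              condNumber (reflectedOp h) U V := by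
  obtain ⟨C, hC, hbound⟩ := exists_norm_reflectedOp_sq_le_of_dyadicOrthogonal pStar pLo pHi
  by_cases hex : ∃ pTop, ReflectedGeometry pStar pTop pLo pHi
  swap
  · exact ⟨1, one_pos, fun pTop h => (hex ⟨pTop, h⟩).elim⟩
  obtain ⟨pT, hT⟩ := hex
  have hlo := hT.pLo_pos
  have hhi := hT.pHi_pos
  have hL : 0 < pHi - pLo := sub_pos.mpr hT.medium
  set c := (2 * pLo ^ 3 * (pHi - pLo) / pHi) ^ 2 / (pHi - pLo) with hc
  have hc0 : 0 < c := by positivity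
  have hγ0 := sqrt_two_sub_one_pos
  have hγ1 := sqrt_two_sub_one_lt_one
  set γ := √2 - 1 with hγ
  set l := Real.log (1 + √2) with hl
  have hl0 : 0 < l := Real.log_pos (by linarith)
  have hγl : γ⁻¹ = Real.exp l := by
    rw [hl, Real.exp_log (by positivity), hγ, inv_eq_one_div, div_eq_iff hγ0.ne']
    nlinarith [Real.sq_sqrt (show (0 : ℝ) ≤ 2 by norm_num)]
  refine ⟨√(c / C) / (2 * √3) * Real.exp (-(6 * l)), by positivity, ?_⟩
  intro pTop h N hN U _ V _ hV hA
  have hN0 : (1 : ℝ) ≤ N := by exact_mod_cast hN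
  -- `m` is close to the largest integer with `m (m + 9) < 2 N`.
  set r := Nat.sqrt (2 * N) with hr
  have hr1 : r * r ≤ 2 * N := Nat.sqrt_le _
  have hr2 : 2 * N < (r + 1) * (r + 1) := Nat.lt_succ_sqrt _
  set m := r - 5 with hm
  obtain ⟨F, hFV, hF0, hF⟩ := exists_mem_dyadicOrthogonal h V (m := m) (by
    rw [hV]
    rcases le_or_gt r 5 with h5 | h5
    · have : m = 0 := by omega
      rw [this]
      omega
    · obtain ⟨j, hj⟩ : ∃ j, r = j + 5 := ⟨r - 5, by omega⟩
      have : m = j := by omega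
      rw [this]
      rw [hj] at hr1
      nlinarith)
  have hD : 0 < pTop - pStar := sub_pos.mpr h.observed
  set ε := √(C * (pTop - pStar) * (m + 1)) * γ ^ m with hε
  have hε0 : 0 < ε := by positivity
  have hAF : ‖reflectedOp h F‖ ≤ ε * ‖F‖ := by
    refine le_of_sq_le_sq ((hbound pTop h m F hF).trans (le_of_eq ?_)) (by positivity)
    rw [hε, mul_pow, mul_pow, Real.sq_sqrt (by positivity), ← pow_mul, mul_comm m 2]
    ring
  refine le_trans (ENNReal.ofReal_le_ofReal ?_) (le_condNumber _ U V hA hε0 hFV hF0 hAF)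
  have hnorm : √(c * (pTop - pStar)) ≤ ‖reflectedOp h‖ := by
    rw [Real.sqrt_le_left (norm_nonneg _)]
    exact norm_reflectedOp_ge h
  have hsq : √N * √N = N := Real.mul_self_sqrt (by positivity)
  have hsN : 1 ≤ √(N : ℝ) := Real.one_le_sqrt.mpr hN0
  have hs2N : √(2 * N : ℝ) = √2 * √N := Real.sqrt_mul (by norm_num) _
  have hrle : (r : ℝ) ≤ √(2 * N) := Real.le_sqrt_of_sq_le (by rw [sq]; exact_mod_cast hr1)
  have hrge : √(2 * N) < r + 1 := by
    rw [Real.sqrt_lt' (by positivity), sq]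
    exact_mod_cast hr2
  have hmr : (r : ℝ) ≤ m + 5 := by exact_mod_cast (show r ≤ m + 5 by omega)
  have hmr' : (m : ℝ) ≤ r := by exact_mod_cast (show m ≤ r by omega)
  have hm1 : (m : ℝ) + 1 ≤ 3 * √N := by
    have : √2 ≤ 2 := by linarith
    nlinarith
  have hm2 : √((m : ℝ) + 1) ≤ √3 * (N : ℝ) ^ (1 / 4 : ℝ) := by
    calc √((m : ℝ) + 1) ≤ √(3 * √N) := Real.sqrt_le_sqrt hm1
      _ = √3 * √√N := Real.sqrt_mul (by norm_num) _
      _ = _ := by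
        congr 1
        rw [Real.sqrt_eq_rpow, Real.sqrt_eq_rpow, ← Real.rpow_mul (by positivity)]
        norm_num
  have hexp : Real.exp (rootExpRate * √N) * Real.exp (-(6 * l)) ≤ (γ ^ m)⁻¹ := by
    rw [← inv_pow, hγl, ← Real.exp_nat_mul, ← Real.exp_add, Real.exp_le_exp, rootExpRate, ← hl]
    have : √2 * √N ≤ m + 6 := by rw [← hs2N]; linarith
    nlinarith
  have hratio : √(c / C) / (2 * √((m : ℝ) + 1)) * (γ ^ m)⁻¹ ≤ ‖reflectedOp h‖ / (2 * ε) := by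
    rw [le_div_iff₀ (by positivity)]
    refine le_trans (le_of_eq ?_) hnorm
    rw [hε, Real.sqrt_div hc0.le, Real.sqrt_mul hc0.le, Real.sqrt_mul (by positivity : 0 ≤ C * (pTop - pStar)),
      Real.sqrt_mul hC.le]
    have : √((m : ℝ) + 1) ≠ 0 := by positivity
    field_simp
  refine le_trans ?_ hratio
  have hN4 : 0 < (N : ℝ) ^ (1 / 4 : ℝ) := by positivity
  calc √(c / C) / (2 * √3) * Real.exp (-(6 * l)) * (N : ℝ) ^ (-(1 / 4) : ℝ) *
        Real.exp (rootExpRate * √N)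
      = √(c / C) / (2 * (√3 * (N : ℝ) ^ (1 / 4 : ℝ))) *
        (Real.exp (rootExpRate * √N) * Real.exp (-(6 * l))) := by
        rw [Real.rpow_neg (by positivity)]
        field_simp
    _ ≤ √(c / C) / (2 * √((m : ℝ) + 1)) * (γ ^ m)⁻¹ := by gcongr

end RootExponential

/-! ### The inverse Joukowski map and the substitution that produces Legendre polynomials -/

/-- The root `t - √(t² - 1)` in `(0, 1]` of `r + 1 / r = 2 t`, for `t ≥ 1`. -/
noncomputable def joukowskiInv (t : ℝ) : ℝ := t - √(t ^ 2 - 1)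

theorem joukowskiInv_mul {t : ℝ} (ht : 1 ≤ t) : joukowskiInv t * (t + √(t ^ 2 - 1)) = 1 := by
  have := Real.sq_sqrt (show 0 ≤ t ^ 2 - 1 by nlinarith)
  rw [joukowskiInv]
  nlinarith

theorem joukowskiInv_pos {t : ℝ} (ht : 1 ≤ t) : 0 < joukowskiInv t := by
  have h1 := joukowskiInv_mul ht
  have h2 := Real.sqrt_nonneg (t ^ 2 - 1)
  by_contra! h
  nlinarith

theorem joukowskiInv_sq_add_one {t : ℝ} (ht : 1 ≤ t) :
    joukowskiInv t ^ 2 + 1 = 2 * t * joukowskiInv t := by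
  have := Real.sq_sqrt (show 0 ≤ t ^ 2 - 1 by nlinarith)
  rw [joukowskiInv]
  nlinarith

theorem joukowskiInv_le_one {t : ℝ} (ht : 1 ≤ t) : joukowskiInv t ≤ 1 := by
  have h1 := joukowskiInv_mul ht
  have h2 := Real.sqrt_nonneg (t ^ 2 - 1)
  have h3 := joukowskiInv_pos ht
  nlinarith

theorem joukowskiInv_lt_one {t : ℝ} (ht : 1 < t) : joukowskiInv t < 1 := by
  have h1 := joukowskiInv_mul ht.le
  have h2 := Real.sqrt_nonneg (t ^ 2 - 1)
  have h3 := joukowskiInv_pos ht.le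
  nlinarith

theorem joukowskiInv_one : joukowskiInv 1 = 1 := by simp [joukowskiInv]

theorem joukowskiInv_add_mul_le {t t' : ℝ} (ht : 1 ≤ t) (htt : t ≤ t') :
    joukowskiInv t' + (t' - t) * (joukowskiInv t * joukowskiInv t') ≤ joukowskiInv t := by
  have h1 := joukowskiInv_mul ht
  have h2 := joukowskiInv_mul (ht.trans htt)
  have h3 := joukowskiInv_pos ht
  have h4 := joukowskiInv_pos (ht.trans htt)
  have h5 : √(t ^ 2 - 1) ≤ √(t' ^ 2 - 1) := Real.sqrt_le_sqrt (by nlinarith)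
  have h6 : joukowskiInv t = joukowskiInv t * joukowskiInv t' * (t' + √(t' ^ 2 - 1)) := by
    rw [mul_assoc, h2, mul_one]
  have h7 : joukowskiInv t' = joukowskiInv t * joukowskiInv t' * (t + √(t ^ 2 - 1)) := by
    rw [mul_comm (joukowskiInv t), mul_assoc, h1, mul_one]
  have h8 := mul_le_mul_of_nonneg_left h5 (mul_pos h3 h4).le
  nlinarith

theorem joukowskiInv_anti {t t' : ℝ} (ht : 1 ≤ t) (htt : t ≤ t') :
    joukowskiInv t' ≤ joukowskiInv t := by
  have h1 := joukowskiInv_add_mul_le ht htt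
  have h2 := mul_nonneg (sub_nonneg.mpr htt)
    (mul_pos (joukowskiInv_pos ht) (joukowskiInv_pos (ht.trans htt))).le
  linarith

theorem joukowskiInv_strictAnti {t t' : ℝ} (ht : 1 ≤ t) (htt : t < t') :
    joukowskiInv t' < joukowskiInv t := by
  have h1 := joukowskiInv_add_mul_le ht htt.le
  have h2 := mul_pos (sub_pos.mpr htt)
    (mul_pos (joukowskiInv_pos ht) (joukowskiInv_pos (ht.trans htt.le)))
  linarith

theorem joukowskiInv_le_mul_exp {t t' : ℝ} (ht : 1 ≤ t) (htt : t ≤ t') :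
    joukowskiInv t' ≤ joukowskiInv t * Real.exp (-((t' - t) * joukowskiInv t')) := by
  have h1 := joukowskiInv_add_mul_le ht htt
  have h2 := Real.add_one_le_exp (-((t' - t) * joukowskiInv t'))
  have h3 := mul_le_mul_of_nonneg_left h2 (joukowskiInv_pos ht).le
  nlinarith

theorem joukowskiInv_of_add_inv {r : ℝ} (hr : 0 < r) (hr1 : r ≤ 1) :
    joukowskiInv ((r + 1 / r) / 2) = r := by
  rw [joukowskiInv]
  have h1 : ((r + 1 / r) / 2) ^ 2 - 1 = ((1 / r - r) / 2) ^ 2 := by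
    field_simp
    ring
  have h2 : r ≤ 1 / r := by rw [le_div_iff₀ hr]; nlinarith
  rw [h1, Real.sqrt_sq (by linarith)]
  ring

section Substitution

variable {pStar pTop pLo pHi : ℝ}

/-- Half the length of the interval of squared slownesses. -/
noncomputable def halfGap (pLo pHi : ℝ) : ℝ := (pHi ^ 2 - pLo ^ 2) / 2

/-- The variable `t ≥ 1` of the observed slowness. -/
noncomputable def observedArg (pLo pHi p : ℝ) : ℝ := 1 + (pLo ^ 2 - p ^ 2) / halfGap pLo pHi

/-- The variable in `[-1, 1]` of the physical slowness. It decreases from `1` to `-1`. -/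
noncomputable def mediumArg (pLo pHi q : ℝ) : ℝ := 1 - (q ^ 2 - pLo ^ 2) / halfGap pLo pHi

theorem halfGap_pos (h : ReflectedGeometry pStar pTop pLo pHi) : 0 < halfGap pLo pHi := by
  unfold halfGap
  nlinarith [h.pLo_pos, h.medium]

theorem rho_eq_joukowskiInv (hlo : 0 < pLo) (hlohi : pLo < pHi) (p : ℝ) :
    rho pLo pHi p = joukowskiInv (observedArg pLo pHi p) := by
  have h1 : 1 + 2 * ((1 - (p / pLo) ^ 2) / ((pHi / pLo) ^ 2 - 1)) = observedArg pLo pHi p := by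
    have h2 : pHi ^ 2 - pLo ^ 2 ≠ 0 := by nlinarith
    have h3 : (pHi / pLo) ^ 2 - 1 ≠ 0 := by
      rw [div_pow, div_sub_one (by positivity)]
      exact div_ne_zero h2 (by positivity)
    rw [observedArg, halfGap]
    field_simp
  rw [rho, h1, joukowskiInv]

theorem one_le_observedArg (h : ReflectedGeometry pStar pTop pLo pHi) {p : ℝ} (hp0 : 0 ≤ p)
    (hp : p ≤ pLo) : 1 ≤ observedArg pLo pHi p := by
  have h1 := halfGap_pos h
  have h2 : 0 ≤ pLo ^ 2 - p ^ 2 := by nlinarith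
  rw [observedArg]
  linarith [div_nonneg h2 h1.le]

theorem one_lt_observedArg (h : ReflectedGeometry pStar pTop pLo pHi) {p : ℝ} (hp0 : 0 ≤ p)
    (hp : p < pLo) : 1 < observedArg pLo pHi p := by
  have h1 := halfGap_pos h
  have h2 : 0 < pLo ^ 2 - p ^ 2 := by nlinarith
  rw [observedArg]
  linarith [div_pos h2 h1]

theorem mediumArg_mem_Icc (h : ReflectedGeometry pStar pTop pLo pHi) {q : ℝ}
    (hq : q ∈ Set.Icc pLo pHi) : mediumArg pLo pHi q ∈ Set.Icc (-1 : ℝ) 1 := by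
  have h1 := halfGap_pos h
  have hlo := h.pLo_pos
  have h2 : 0 ≤ q ^ 2 - pLo ^ 2 := by nlinarith [hq.1]
  have h3 : (q ^ 2 - pLo ^ 2) / halfGap pLo pHi ≤ 2 := by
    rw [div_le_iff₀ h1, halfGap]
    nlinarith [hq.1, hq.2]
  rw [mediumArg]
  constructor
  · linarith
  · linarith [div_nonneg h2 h1.le]

theorem continuous_mediumArg : Continuous (mediumArg pLo pHi) := by
  unfold mediumArg
  fun_prop

/-- The kernel is a generating function of Legendre polynomials. -/
theorem kernel_eq_legendreGen (h : ReflectedGeometry pStar pTop pLo pHi) {p q : ℝ} (hp0 : 0 ≤ p)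
    (hp : p ≤ pLo) :
    1 / √(q ^ 2 - p ^ 2) = √(2 * rho pLo pHi p / halfGap pLo pHi) *
      legendreGen (rho pLo pHi p) (mediumArg pLo pHi q) := by
  have hκ := halfGap_pos h
  rw [rho_eq_joukowskiInv h.pLo_pos h.medium]
  have ht := one_le_observedArg h hp0 hp
  set t := observedArg pLo pHi p with htdef
  have hr := joukowskiInv_pos ht
  have h1 := joukowskiInv_sq_add_one ht
  set r := joukowskiInv t
  have h2 : 1 - 2 * r * mediumArg pLo pHi q + r ^ 2 = 2 * r / halfGap pLo pHi * (q ^ 2 - p ^ 2) := by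
    have h3 : 1 - 2 * r * mediumArg pLo pHi q + r ^ 2 = 2 * r * (t - mediumArg pLo pHi q) := by
      linarith
    rw [h3, htdef, observedArg, mediumArg]
    field_simp
    ring
  have h4 : √(2 * r / halfGap pLo pHi) ≠ 0 := (Real.sqrt_pos.mpr (by positivity)).ne'
  rw [legendreGen, h2, Real.sqrt_mul (by positivity), one_div, one_div, mul_inv, ← mul_assoc,
    mul_inv_cancel₀ h4, one_mul]

theorem integral_comp_mediumArg (h : ReflectedGeometry pStar pTop pLo pHi) {f : ℝ → ℝ}
    (hf : ContinuousOn f (Set.Icc (-1) 1)) :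
    ∫ q in Set.Ioo pLo pHi, f (mediumArg pLo pHi q) * (2 * q) =
      halfGap pLo pHi * ∫ x in (-1 : ℝ)..1, f x := by
  have hκ := halfGap_pos h
  have hder : ∀ q ∈ Set.uIcc pLo pHi,
      HasDerivAt (mediumArg pLo pHi) (-(2 * q) / halfGap pLo pHi) q := by
    intro q _
    have := (((hasDerivAt_pow 2 q).sub_const (pLo ^ 2)).div_const (halfGap pLo pHi)).const_sub 1
    refine this.congr_deriv ?_
    simp
    ring
  have him : mediumArg pLo pHi '' Set.uIcc pLo pHi ⊆ Set.Icc (-1) 1 := by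
    rintro _ ⟨q, hq, rfl⟩
    rw [Set.uIcc_of_le h.medium.le] at hq
    exact mediumArg_mem_Icc h hq
  have h1 := intervalIntegral.integral_comp_mul_deriv' (g := f) hder (by fun_prop) (hf.mono him)
  have e1 : mediumArg pLo pHi pLo = 1 := by simp [mediumArg]
  have e2 : mediumArg pLo pHi pHi = -1 := by
    rw [mediumArg]
    have : pHi ^ 2 - pLo ^ 2 = 2 * halfGap pLo pHi := by rw [halfGap]; ring
    rw [this]
    field_simp
    norm_num
  rw [e1, e2, intervalIntegral.integral_symm (-1) 1] at h1
  rw [← integral_Ioc_eq_integral_Ioo, ← intervalIntegral.integral_of_le h.medium.le]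
  have h2 : ∀ q, f (mediumArg pLo pHi q) * (2 * q) =
      -halfGap pLo pHi * ((f ∘ mediumArg pLo pHi) q * (-(2 * q) / halfGap pLo pHi)) := by
    intro q
    simp only [Function.comp_apply]
    field_simp
  simp_rw [h2]
  rw [intervalIntegral.integral_const_mul, h1]
  ring

/-! ### The exponential lower bound -/

theorem memLp_legendre_mediumArg (n : ℕ) :
    MemLp (fun q => q ^ 3 * (legendre n).eval (mediumArg pLo pHi q)) 2
      (volume.restrict (Set.Ioo pLo pHi)) := by
  refine memLp_of_continuousOn (Continuous.continuousOn ?_)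
  have := continuous_mediumArg (pLo := pLo) (pHi := pHi)
  fun_prop

theorem rho_pos (h : ReflectedGeometry pStar pTop pLo pHi) {p : ℝ} (hp0 : 0 ≤ p) (hp : p ≤ pLo) :
    0 < rho pLo pHi p := by
  rw [rho_eq_joukowskiInv h.pLo_pos h.medium]
  exact joukowskiInv_pos (one_le_observedArg h hp0 hp)

theorem rho_le_one (h : ReflectedGeometry pStar pTop pLo pHi) {p : ℝ} (hp0 : 0 ≤ p) (hp : p ≤ pLo) :
    rho pLo pHi p ≤ 1 := by
  rw [rho_eq_joukowskiInv h.pLo_pos h.medium]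
  exact joukowskiInv_le_one (one_le_observedArg h hp0 hp)

theorem rho_lt_one (h : ReflectedGeometry pStar pTop pLo pHi) {p : ℝ} (hp0 : 0 ≤ p) (hp : p < pLo) :
    rho pLo pHi p < 1 := by
  rw [rho_eq_joukowskiInv h.pLo_pos h.medium]
  exact joukowskiInv_lt_one (one_lt_observedArg h hp0 hp)

theorem observedArg_sub (p p' : ℝ) :
    observedArg pLo pHi p - observedArg pLo pHi p' = (p' ^ 2 - p ^ 2) / halfGap pLo pHi := by
  rw [observedArg, observedArg]
  ring

theorem rho_mono (h : ReflectedGeometry pStar pTop pLo pHi) {p p' : ℝ} (hp0 : 0 ≤ p) (hpp : p ≤ p')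
    (hp : p' ≤ pLo) : rho pLo pHi p ≤ rho pLo pHi p' := by
  rw [rho_eq_joukowskiInv h.pLo_pos h.medium, rho_eq_joukowskiInv h.pLo_pos h.medium]
  refine joukowskiInv_anti (one_le_observedArg h (hp0.trans hpp) hp) ?_
  rw [← sub_nonneg, observedArg_sub]
  exact div_nonneg (by nlinarith) (halfGap_pos h).le

theorem rho_strictMono (h : ReflectedGeometry pStar pTop pLo pHi) {p p' : ℝ} (hp0 : 0 ≤ p)
    (hpp : p < p') (hp : p' ≤ pLo) : rho pLo pHi p < rho pLo pHi p' := by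
  rw [rho_eq_joukowskiInv h.pLo_pos h.medium, rho_eq_joukowskiInv h.pLo_pos h.medium]
  refine joukowskiInv_strictAnti (one_le_observedArg h (hp0.trans hpp.le) hp) ?_
  rw [← sub_pos, observedArg_sub]
  exact div_pos (by nlinarith) (halfGap_pos h)

theorem rho_le_mul_exp (h : ReflectedGeometry pStar pTop pLo pHi) {p : ℝ}
    (hp : p ∈ Set.Ioo pStar pTop) :
    rho pLo pHi p ≤ rho pLo pHi pTop *
      Real.exp (-(rho pLo pHi pStar * (2 * pStar) / halfGap pLo pHi * (pTop - p))) := by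
  have hκ := halfGap_pos h
  have hp0 : 0 < p := h.pos.trans hp.1
  have hmono := rho_mono h h.pos.le hp.1.le (hp.2.le.trans h.reflected)
  have hst := rho_pos h h.pos.le (h.observed.le.trans h.reflected)
  have htop := rho_pos h (h.pos.trans h.observed).le h.reflected
  have h1 : observedArg pLo pHi pTop ≤ observedArg pLo pHi p := by
    rw [← sub_nonneg, observedArg_sub]
    exact div_nonneg (by nlinarith [hp.2]) hκ.le
  have h2 := joukowskiInv_le_mul_exp (one_le_observedArg h (h.pos.trans h.observed).le h.reflected) h1
  rw [observedArg_sub, ← rho_eq_joukowskiInv h.pLo_pos h.medium,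
    ← rho_eq_joukowskiInv h.pLo_pos h.medium] at h2
  refine h2.trans (mul_le_mul_of_nonneg_left (Real.exp_le_exp.mpr (neg_le_neg ?_)) htop.le)
  rw [div_mul_eq_mul_div, div_mul_eq_mul_div]
  gcongr ?_ / _
  have h3 : 2 * pStar * (pTop - p) ≤ pTop ^ 2 - p ^ 2 := by nlinarith [hp.1, hp.2]
  have h4 : 0 ≤ 2 * pStar * (pTop - p) := mul_nonneg (by linarith [h.pos]) (by linarith [hp.2])
  calc rho pLo pHi pStar * (2 * pStar) * (pTop - p) = (2 * pStar * (pTop - p)) * rho pLo pHi pStar := by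
        ring
    _ ≤ (pTop ^ 2 - p ^ 2) * rho pLo pHi p := mul_le_mul h3 hmono hst.le (h4.trans h3)

theorem traveltime_sq_le_of_legendre (h : ReflectedGeometry pStar pTop pLo pHi) (F : L2 pLo pHi)
    {m : ℕ} (hF : ∀ n < m, ∫ q in Set.Ioo pLo pHi,
      (q ^ 3 * (legendre n).eval (mediumArg pLo pHi q)) * F q = 0)
    {p : ℝ} (hp : p ∈ Set.Ioo pStar pTop) :
    traveltime pLo pHi F p ^ 2 ≤ 8 * pHi ^ 6 / pLo *
      (rho pLo pHi p * rho pLo pHi p ^ (2 * m) / ((2 * m + 1) * (1 - rho pLo pHi p))) * ‖F‖ ^ 2 := by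
  have hlo := h.pLo_pos
  have hhi := h.pHi_pos
  have hκ := halfGap_pos h
  have hp0 : 0 ≤ p := (h.pos.trans hp.1).le
  have hpl : p < pLo := hp.2.trans_le h.reflected
  have hr0 := rho_pos h hp0 hpl.le
  have hr1 := rho_lt_one h hp0 hpl
  set ρ := rho pLo pHi p with hρ
  set κ := halfGap pLo pHi with hκdef
  have hxc := continuous_mediumArg (pLo := pLo) (pHi := pHi)
  set R : ℝ → ℝ := fun q => √(2 * ρ / κ) *
    ∑ n ∈ Finset.range m, ρ ^ n * (legendre n).eval (mediumArg pLo pHi q) with hR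
  have hRc : ContinuousOn R (Set.Icc pLo pHi) := Continuous.continuousOn (by fun_prop)
  have hRF : ∫ q in Set.Ioo pLo pHi, (q ^ 3 * R q) * F q = 0 := by
    have h1 : ∀ q, (q ^ 3 * R q) * F q = ∑ n ∈ Finset.range m, (√(2 * ρ / κ) * ρ ^ n) *
        ((q ^ 3 * (legendre n).eval (mediumArg pLo pHi q)) * F q) := by
      intro q
      rw [hR, ← mul_assoc, Finset.mul_sum, Finset.sum_mul]
      exact Finset.sum_congr rfl fun n _ => by ring
    have hi : ∀ n, Integrable (fun q => (√(2 * ρ / κ) * ρ ^ n) *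
        ((q ^ 3 * (legendre n).eval (mediumArg pLo pHi q)) * F q))
        (volume.restrict (Set.Ioo pLo pHi)) := fun n =>
      ((memLp_legendre_mediumArg n).integrable_mul (Lp.memLp F)).const_mul _
    simp_rw [h1]
    rw [integral_finsetSum _ fun n _ => hi n]
    refine Finset.sum_eq_zero fun n hn => ?_
    rw [integral_const_mul, hF n (Finset.mem_range.mp hn), mul_zero]
  set f : ℝ → ℝ := fun x => (legendreGen ρ x - ∑ n ∈ Finset.range m, ρ ^ n * (legendre n).eval x) ^ 2
    with hf
  have hfc : ContinuousOn f (Set.Icc (-1) 1) :=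
    ((continuousOn_legendreGen hr0.le hr1).sub (Continuous.continuousOn (by fun_prop))).pow 2
  set Maj : ℝ → ℝ := fun q => ρ / (κ * pLo) * (f (mediumArg pLo pHi q) * (2 * q)) with hMaj
  have hMi : IntegrableOn Maj (Set.Ioo pLo pHi) := by
    refine (ContinuousOn.integrableOn_Icc ?_).mono_set Set.Ioo_subset_Icc_self
    exact continuousOn_const.mul ((hfc.comp hxc.continuousOn fun q hq => mediumArg_mem_Icc h hq).mul
      (by fun_prop))
  have hle : ∀ q ∈ Set.Ioo pLo pHi, (1 / √(q ^ 2 - p ^ 2) - R q) ^ 2 ≤ Maj q := by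
    intro q hq
    rw [kernel_eq_legendreGen h hp0 hpl.le, ← hρ, ← hκdef]
    have h1 : (√(2 * ρ / κ) * legendreGen ρ (mediumArg pLo pHi q) - R q) ^ 2 =
        2 * ρ / κ * f (mediumArg pLo pHi q) := by
      rw [hR]
      simp only [hf]
      rw [← mul_sub, mul_pow, Real.sq_sqrt (by positivity)]
    rw [h1]
    simp only [hMaj]
    have hf0 : 0 ≤ f (mediumArg pLo pHi q) := sq_nonneg _
    calc 2 * ρ / κ * f (mediumArg pLo pHi q)
        = ρ / (κ * pLo) * (f (mediumArg pLo pHi q) * (2 * pLo)) := by field_simp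
      _ ≤ _ := by
        have := hq.1.le
        gcongr
  refine (traveltime_sq_le_of_orthogonal h F hp hRc hRF hMi hle).trans ?_
  have h2 : ∫ q in Set.Ioo pLo pHi, Maj q ≤
      ρ / pLo * (2 * ρ ^ (2 * m) / ((2 * m + 1) * (1 - ρ))) := by
    rw [hMaj, integral_const_mul, integral_comp_mediumArg h hfc, ← hκdef]
    calc ρ / (κ * pLo) * (κ * ∫ x in (-1 : ℝ)..1, f x) = ρ / pLo * ∫ x in (-1 : ℝ)..1, f x := by
          field_simp
      _ ≤ _ := by
          gcongr
          exact integral_legendreGen_sub_sum_sq_le hr0 hr1 m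
  calc 4 * pHi ^ 6 * (∫ q in Set.Ioo pLo pHi, Maj q) * ‖F‖ ^ 2
      ≤ 4 * pHi ^ 6 * (ρ / pLo * (2 * ρ ^ (2 * m) / ((2 * m + 1) * (1 - ρ)))) * ‖F‖ ^ 2 := by gcongr
    _ = _ := by ring

theorem setIntegral_exp_le {c a b : ℝ} (hc : 0 < c) (hab : a ≤ b) :
    ∫ p in Set.Ioo a b, Real.exp (-(c * (b - p))) ≤ 1 / c := by
  rw [← integral_Ioc_eq_integral_Ioo, ← intervalIntegral.integral_of_le hab]
  have hder : ∀ x ∈ Set.uIcc a b, HasDerivAt (fun x => 1 / c * Real.exp (-(c * (b - x))))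
      (Real.exp (-(c * (b - x)))) x := by
    intro x _
    have h1 : HasDerivAt (fun x => -(c * (b - x))) c x := by
      have := (((hasDerivAt_id x).const_sub b).const_mul c).neg
      exact this.congr_deriv (by simp)
    refine (h1.exp.const_mul (1 / c)).congr_deriv ?_
    field_simp
  rw [intervalIntegral.integral_eq_sub_of_hasDerivAt hder
    (Continuous.intervalIntegrable (by fun_prop) _ _)]
  have : 0 ≤ 1 / c * Real.exp (-(c * (b - a))) := by positivity
  simp only [sub_self, mul_zero, neg_zero, Real.exp_zero]
  linarith

/-- The bound `C N αᴺ` in the case `pTop < pLo`, that is `α > 1`. -/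
theorem exists_exp_le_condNumber_of_lt (h : ReflectedGeometry pStar pTop pLo pHi)
    (hlt : pTop < pLo) :
    ∃ C : ℝ, 0 < C ∧ ∀ (N : ℕ), 1 ≤ N →
      ∀ (U : Submodule ℝ (L2 pStar pTop)) [U.HasOrthogonalProjection]
        (V : Submodule ℝ (L2 pLo pHi)) [FiniteDimensional ℝ V],
        Module.finrank ℝ V = N → IsReasonable (reflectedOp h) U V →
          ENNReal.ofReal (C * N * alphaRate pTop pLo pHi ^ N) ≤
            condNumber (reflectedOp h) U V := by
  have hlo := h.pLo_pos
  have hhi := h.pHi_pos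
  have hκ := halfGap_pos h
  have hps := h.pos
  have hst := rho_pos h h.pos.le (h.observed.le.trans h.reflected)
  have htop := rho_pos h (h.pos.trans h.observed).le h.reflected
  have htop1 := rho_lt_one h (h.pos.trans h.observed).le hlt
  have hA := norm_reflectedOp_pos h
  set r := rho pLo pHi pStar with hr
  set R := rho pLo pHi pTop with hR
  set c := r * (2 * pStar) / halfGap pLo pHi with hc
  have hc0 : 0 < c := by positivity
  have hR1 : 0 < 1 - R := by linarith
  set D := 8 * pHi ^ 6 / pLo / (r * (1 - R)) / (2 * c) / r with hD
  have hD0 : 0 < D := by positivity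
  refine ⟨‖reflectedOp h‖ / (2 * √D), by positivity, ?_⟩
  intro N hN U _ V _ hV hreas
  have hN0 : (1 : ℝ) ≤ N := by exact_mod_cast hN
  obtain ⟨F, hFV, hF0, hF⟩ := exists_mem_ne_zero_forall_apply_eq_zero V (ι := Fin (N - 1))
    (fun i => integralFunctional (memLp_legendre_mediumArg (pLo := pLo) (pHi := pHi) i))
    (by rw [Fintype.card_fin, hV]; omega)
  have hF' : ∀ n < N - 1, ∫ q in Set.Ioo pLo pHi,
      (q ^ 3 * (legendre n).eval (mediumArg pLo pHi q)) * F q = 0 := by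
    intro n hn
    have := hF ⟨n, hn⟩
    rwa [integralFunctional_apply] at this
  set K := 8 * pHi ^ 6 / pLo / (r * (1 - R)) / r * (R ^ (2 * N) / N) with hK
  have hbound : ∀ p ∈ Set.Ioo pStar pTop, traveltime pLo pHi F p ^ 2 ≤
      K * Real.exp (-((2 * c * N) * (pTop - p))) * ‖F‖ ^ 2 := by
    intro p hp
    refine (traveltime_sq_le_of_legendre h F hF' hp).trans ?_
    have hp0 : 0 ≤ p := (h.pos.trans hp.1).le
    have h1 := rho_le_mul_exp h hp
    rw [← hr, ← hR, ← hc] at h1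
    have h2 : r ≤ rho pLo pHi p := rho_mono h h.pos.le hp.1.le (hp.2.le.trans h.reflected)
    have h3 : rho pLo pHi p ≤ R := rho_mono h hp0 hp.2.le h.reflected
    set ρ := rho pLo pHi p
    have hρ0 : 0 < ρ := hst.trans_le h2
    have h4 : ρ ^ (2 * N) ≤ R ^ (2 * N) * Real.exp (-((2 * c * N) * (pTop - p))) := by
      calc ρ ^ (2 * N) ≤ (R * Real.exp (-(c * (pTop - p)))) ^ (2 * N) := by gcongr
        _ = _ := by
          rw [mul_pow, ← Real.exp_nat_mul]
          congr 2
          push_cast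
          ring
    have h5 : ρ * ρ ^ (2 * (N - 1)) = ρ ^ (2 * N) / ρ := by
      rw [eq_div_iff hρ0.ne']
      obtain ⟨j, rfl⟩ : ∃ j, N = j + 1 := ⟨N - 1, by omega⟩
      simp only [Nat.add_sub_cancel]
      ring
    have h6 : (N : ℝ) ≤ 2 * ((N - 1 : ℕ) : ℝ) + 1 := by
      rw [Nat.cast_sub hN]
      push_cast
      linarith
    rw [h5]
    have hE := Real.exp_pos (-((2 * c * N) * (pTop - p)))
    set E := Real.exp (-((2 * c * N) * (pTop - p)))
    have h7 : ρ ^ (2 * N) / ρ / ((2 * ((N - 1 : ℕ) : ℝ) + 1) * (1 - ρ)) ≤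
        R ^ (2 * N) * E / r / (N * (1 - R)) := by gcongr
    have h8 : R ^ (2 * N) * E / r / (N * (1 - R)) * 1 ≤ R ^ (2 * N) * E / r / (N * (1 - R)) * (1 / r) := by
      gcongr
      rw [le_div_iff₀ hst]
      linarith [h2.trans h3]
    calc _ ≤ 8 * pHi ^ 6 / pLo * (R ^ (2 * N) * E / r / (N * (1 - R)) * (1 / r)) * ‖F‖ ^ 2 := by
          gcongr
          linarith
      _ = _ := by rw [hK]; field_simp
  have hcont : IntegrableOn (fun p => K * Real.exp (-((2 * c * N) * (pTop - p)))) (Set.Ioo pStar pTop) :=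
    (Continuous.integrableOn_Icc (by fun_prop)).mono_set Set.Ioo_subset_Icc_self
  have h1 := norm_reflectedOp_sq_le h F hcont hbound
  rw [integral_const_mul] at h1
  have hK0 : 0 < K := by positivity
  set ε := √D * R ^ N / N with hε
  have hε0 : 0 < ε := by positivity
  have hAF : ‖reflectedOp h F‖ ≤ ε * ‖F‖ := by
    refine le_of_sq_le_sq (h1.trans ?_) (by positivity)
    rw [mul_pow]
    gcongr
    calc K * ∫ p in Set.Ioo pStar pTop, Real.exp (-((2 * c * N) * (pTop - p)))
        ≤ K * (1 / (2 * c * N)) := by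
          gcongr
          exact setIntegral_exp_le (by positivity) h.observed.le
      _ = ε ^ 2 := by
          rw [hε, div_pow, mul_pow, Real.sq_sqrt hD0.le, hK, hD, ← pow_mul, mul_comm N 2]
          field_simp
  refine le_trans (ENNReal.ofReal_le_ofReal (le_of_eq ?_)) (le_condNumber _ U V hreas hε0 hFV hF0 hAF)
  rw [alphaRate, ← hR, hε, div_pow, one_pow]
  field_simp

theorem alphaRate_self (h : ReflectedGeometry pStar pTop pLo pHi) : alphaRate pLo pLo pHi = 1 := by
  rw [alphaRate, rho_eq_joukowskiInv h.pLo_pos h.medium]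
  have : observedArg pLo pHi pLo = 1 := by simp [observedArg]
  rw [this, joukowskiInv_one, div_one]

/-- The bound `C N αᴺ`. For `α = 1` it is contained in the root-exponential bound. -/
theorem exists_exp_le_condNumber (h : ReflectedGeometry pStar pTop pLo pHi) :
    ∃ C : ℝ, 0 < C ∧ ∀ (N : ℕ), 1 ≤ N →
      ∀ (U : Submodule ℝ (L2 pStar pTop)) [U.HasOrthogonalProjection]
        (V : Submodule ℝ (L2 pLo pHi)) [FiniteDimensional ℝ V],
        Module.finrank ℝ V = N → IsReasonable (reflectedOp h) U V →
          ENNReal.ofReal (C * N * alphaRate pTop pLo pHi ^ N) ≤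
            condNumber (reflectedOp h) U V := by
  rcases h.reflected.lt_or_eq with hlt | heq
  · exact exists_exp_le_condNumber_of_lt h hlt
  obtain ⟨C, hC, hbound⟩ := exists_rootExp_le_condNumber pStar pLo pHi
  have hrate : 0 < rootExpRate :=
    mul_pos (by positivity) (Real.log_pos (by linarith [sqrt_two_sub_one_pos]))
  refine ⟨C * (rootExpRate ^ 3 / 6), by positivity, ?_⟩
  intro N hN U _ V _ hV hreas
  refine le_trans (ENNReal.ofReal_le_ofReal ?_) (hbound pTop h N hN U V hV hreas)
  have hα : alphaRate pTop pLo pHi = 1 := by rw [heq]; exact alphaRate_self h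
  have hN0 : (1 : ℝ) ≤ N := by exact_mod_cast hN
  rw [hα, one_pow, mul_one]
  have h1 : (rootExpRate * √N) ^ 3 / 6 ≤ Real.exp (rootExpRate * √N) := by
    have := Real.pow_div_factorial_le_exp (rootExpRate * √N) (by positivity) 3
    simpa [Nat.factorial] using this
  have h2 : (N : ℝ) ≤ (N : ℝ) ^ (-(1 / 4) : ℝ) * √N ^ 3 := by
    have h3 : √(N : ℝ) ^ 3 = (N : ℝ) ^ (3 / 2 : ℝ) := by
      rw [Real.sqrt_eq_rpow, ← Real.rpow_natCast, ← Real.rpow_mul (by positivity)]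
      norm_num
    rw [h3, ← Real.rpow_add (by positivity)]
    calc (N : ℝ) = (N : ℝ) ^ (1 : ℝ) := (Real.rpow_one _).symm
      _ ≤ _ := Real.rpow_le_rpow_of_exponent_le hN0 (by norm_num)
  calc C * (rootExpRate ^ 3 / 6) * N
      ≤ C * (rootExpRate ^ 3 / 6) * ((N : ℝ) ^ (-(1 / 4) : ℝ) * √N ^ 3) := by gcongr
    _ = C * (N : ℝ) ^ (-(1 / 4) : ℝ) * ((rootExpRate * √N) ^ 3 / 6) := by ring
    _ ≤ _ := by gcongr

end Substitution

/-! ### Growth of Chebyshev expansions off the interval -/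

theorem exists_joukowski_eq (x : ℂ) : ∃ ζ : ℂ, 1 ≤ ‖ζ‖ ∧ x = (ζ + ζ⁻¹) / 2 := by
  obtain ⟨w, hw⟩ := IsAlgClosed.exists_pow_nat_eq (x ^ 2 - 1) (n := 2) two_pos
  have h1 : (x + w) * (x - w) = 1 := by linear_combination -hw
  have h2 : x + w ≠ 0 := left_ne_zero_of_mul_eq_one h1
  have h3 : x - w ≠ 0 := right_ne_zero_of_mul_eq_one h1
  have e1 : (x + w)⁻¹ = x - w := inv_eq_of_mul_eq_one_right h1
  have e2 : (x - w)⁻¹ = x + w := inv_eq_of_mul_eq_one_left h1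
  rcases le_total 1 ‖x + w‖ with h | h
  · exact ⟨x + w, h, by rw [e1]; ring⟩
  · refine ⟨x - w, ?_, by rw [e2]; ring⟩
    have h4 := congrArg norm h1
    rw [norm_mul, norm_one] at h4
    nlinarith [norm_nonneg (x - w), norm_pos_iff.mpr h2]

theorem eval_chebyshevT_joukowski {ζ : ℂ} (hζ : ζ ≠ 0) (n : ℕ) :
    (Polynomial.Chebyshev.T ℂ n).eval ((ζ + ζ⁻¹) / 2) = (ζ ^ n + ζ⁻¹ ^ n) / 2 := by
  induction n using Nat.twoStepInduction with
  | zero => simp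
  | one => simp
  | more n ih1 ih2 =>
    have h := Polynomial.Chebyshev.T_add_two ℂ n
    push_cast at ih2 ⊢
    rw [h]
    simp only [Polynomial.eval_sub, Polynomial.eval_mul, Polynomial.eval_X, Polynomial.eval_ofNat]
    rw [ih1, ih2]
    have h1 : ζ * ζ⁻¹ = 1 := mul_inv_cancel₀ hζ
    linear_combination (ζ ^ n + ζ⁻¹ ^ n) / 2 * h1

/-- `|ζ| + 1 / |ζ|` is the sum of the distances from `x = (ζ + 1 / ζ) / 2` to the foci `±1`. -/
theorem norm_add_inv_norm_eq {ζ : ℂ} (hζ : ζ ≠ 0) :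
    ‖ζ‖ + ‖ζ‖⁻¹ = ‖(ζ + ζ⁻¹) / 2 - 1‖ + ‖(ζ + ζ⁻¹) / 2 + 1‖ := by
  have h1 : (ζ + ζ⁻¹) / 2 - 1 = (ζ - 1) ^ 2 / (2 * ζ) := by field_simp; ring
  have h2 : (ζ + ζ⁻¹) / 2 + 1 = (ζ + 1) ^ 2 / (2 * ζ) := by field_simp; ring
  rw [h1, h2, norm_div, norm_div, norm_pow, norm_pow, norm_mul, Complex.norm_ofNat]
  have h3 := parallelogram_law_with_norm ℝ ζ 1
  rw [norm_one] at h3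
  have h4 : ‖ζ‖ ≠ 0 := norm_ne_zero_iff.mpr hζ
  field_simp
  nlinarith

/-- On the ellipse with foci `±1` and parameter `Z`, a Chebyshev expansion is bounded by the norm of
its coefficients times a power of `Z`. -/
theorem norm_sum_chebyshevT_sq_le {x : ℂ} {Z : ℝ} (hZ : 2 ≤ Z ^ 2) (hZ1 : 1 ≤ Z)
    (hx : ‖x - 1‖ + ‖x + 1‖ ≤ Z + Z⁻¹) (c : ℕ → ℝ) (M : ℕ) :
    ‖∑ k ∈ Finset.range M, (c k : ℂ) * (Polynomial.Chebyshev.T ℂ k).eval x‖ ^ 2 ≤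
      (∑ k ∈ Finset.range M, c k ^ 2) * (Z ^ 2) ^ M := by
  obtain ⟨ζ, hζ1, rfl⟩ := exists_joukowski_eq x
  have hζ0 : ζ ≠ 0 := by rintro rfl; simp at hζ1; linarith
  rw [← norm_add_inv_norm_eq hζ0] at hx
  have hζZ : ‖ζ‖ ≤ Z := by
    by_contra! h
    have hz0 : 0 < ‖ζ‖ := by linarith
    have h1 : (‖ζ‖ - Z) * (1 - (‖ζ‖ * Z)⁻¹) ≤ 0 := by
      have : (‖ζ‖ - Z) * (1 - (‖ζ‖ * Z)⁻¹) = (‖ζ‖ + ‖ζ‖⁻¹) - (Z + Z⁻¹) := by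
        have : Z ≠ 0 := by linarith
        field_simp
        ring
      linarith
    have h2 : (‖ζ‖ * Z)⁻¹ < 1 := inv_lt_one_of_one_lt₀ (by nlinarith)
    have h3 := mul_pos (sub_pos.mpr h) (sub_pos.mpr h2)
    linarith
  have hT : ∀ k : ℕ, ‖(Polynomial.Chebyshev.T ℂ k).eval ((ζ + ζ⁻¹) / 2)‖ ≤ Z ^ k := by
    intro k
    rw [eval_chebyshevT_joukowski hζ0, norm_div, Complex.norm_ofNat, div_le_iff₀ two_pos]
    have h1 : ‖ζ ^ k‖ ≤ Z ^ k := by rw [norm_pow]; gcongr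
    have h2 : ‖ζ⁻¹ ^ k‖ ≤ 1 := by
      rw [norm_pow, norm_inv]
      exact pow_le_one₀ (by positivity) (inv_le_one_of_one_le₀ hζ1)
    have h3 : 1 ≤ Z ^ k := one_le_pow₀ hZ1
    linarith [norm_add_le (ζ ^ k) (ζ⁻¹ ^ k)]
  have h1 : ‖∑ k ∈ Finset.range M, (c k : ℂ) * (Polynomial.Chebyshev.T ℂ k).eval ((ζ + ζ⁻¹) / 2)‖ ≤
      ∑ k ∈ Finset.range M, |c k| * Z ^ k := by
    refine norm_sum_le_of_le _ fun k _ => ?_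
    rw [norm_mul, Complex.norm_real, Real.norm_eq_abs]
    exact mul_le_mul_of_nonneg_left (hT k) (abs_nonneg _)
  have h2 : ∑ k ∈ Finset.range M, (Z ^ k) ^ 2 ≤ (Z ^ 2) ^ M := by
    have h3 : ∀ M : ℕ, ∑ k ∈ Finset.range M, (Z ^ k) ^ 2 ≤ (Z ^ 2) ^ M := by
      intro M
      induction M with
      | zero => simp
      | succ M ih =>
        rw [Finset.sum_range_succ, pow_succ (Z ^ 2) M, pow_right_comm Z M 2]
        have : 0 ≤ (Z ^ 2) ^ M := by positivity
        nlinarith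
    exact h3 M
  calc _ ≤ (∑ k ∈ Finset.range M, |c k| * Z ^ k) ^ 2 := pow_le_pow_left₀ (norm_nonneg _) h1 2
    _ ≤ (∑ k ∈ Finset.range M, |c k| ^ 2) * ∑ k ∈ Finset.range M, (Z ^ k) ^ 2 :=
      Finset.sum_mul_sq_le_sq_mul_sq _ _ _
    _ ≤ _ := by
      simp_rw [sq_abs]
      exact mul_le_mul_of_nonneg_left h2 (Finset.sum_nonneg fun k _ => sq_nonneg _)

/-- Bessel's inequality for Chebyshev expansions (an equality but for the constant term). -/
theorem sum_sq_le_integral_measureT (c : ℕ → ℝ) (M : ℕ) :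
    Real.pi / 2 * ∑ k ∈ Finset.range M, c k ^ 2 ≤
      ∫ x, (∑ k ∈ Finset.range M, c k * (Polynomial.Chebyshev.T ℝ k).eval x) ^ 2
        ∂Polynomial.Chebyshev.measureT := by
  have h1 : ∀ x : ℝ, (∑ k ∈ Finset.range M, c k * (Polynomial.Chebyshev.T ℝ k).eval x) ^ 2 =
      ∑ n ∈ Finset.range M, ∑ k ∈ Finset.range M, c n * c k *
        ((Polynomial.Chebyshev.T ℝ n).eval x * (Polynomial.Chebyshev.T ℝ k).eval x) := by
    intro x
    rw [sq, Finset.sum_mul_sum]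
    exact Finset.sum_congr rfl fun n _ => Finset.sum_congr rfl fun k _ => by ring
  have hi : ∀ f : ℝ → ℝ, Continuous f → Integrable f Polynomial.Chebyshev.measureT := fun f hf =>
    Polynomial.Chebyshev.integrable_measureT hf.continuousOn
  simp_rw [h1]
  rw [integral_finsetSum _ fun n _ => hi _ (by fun_prop), Finset.mul_sum]
  refine Finset.sum_le_sum fun n hn => ?_
  rw [integral_finsetSum _ fun k _ => hi _ (by fun_prop)]
  simp_rw [integral_const_mul]
  rw [Finset.sum_eq_single_of_mem n hn fun k _ hk => by
    rw [Polynomial.Chebyshev.integral_eval_T_real_mul_eval_T_real_measureT_of_ne hk.symm, mul_zero]]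
  have h2 : Real.pi / 2 ≤ ∫ x, (Polynomial.Chebyshev.T ℝ n).eval x *
      (Polynomial.Chebyshev.T ℝ n).eval x ∂Polynomial.Chebyshev.measureT := by
    rcases eq_or_ne n 0 with rfl | hn0
    · have := Polynomial.Chebyshev.integral_eval_T_real_mul_self_measureT_zero
      simp only [Nat.cast_zero]
      rw [this]
      linarith [Real.pi_pos]
    · rw [Polynomial.Chebyshev.integral_T_real_mul_self_measureT_of_ne_zero hn0]
  nlinarith [mul_le_mul_of_nonneg_left h2 (sq_nonneg (c n))]

theorem integral_sq_measureT_le (P : Polynomial ℝ) :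
    ∫ x, (P.eval x * (1 - x ^ 2)) ^ 2 ∂Polynomial.Chebyshev.measureT ≤
      2 * ∫ x in (-1 : ℝ)..1, P.eval x ^ 2 * (1 - x) := by
  rw [Polynomial.Chebyshev.integral_measureT, ← intervalIntegral.integral_const_mul]
  have hi : Continuous fun x : ℝ => (P.eval x * (1 - x ^ 2)) ^ 2 := by fun_prop
  refine intervalIntegral.integral_mono_on_of_le_Ioo (by norm_num)
    (Polynomial.Chebyshev.intervalIntegrable_sqrt_one_sub_sq_inv.continuousOn_mul hi.continuousOn)
    (Continuous.intervalIntegrable (by fun_prop) _ _) fun x hx => ?_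
  have hy0 : 0 < 1 - x ^ 2 := by nlinarith [hx.1, hx.2]
  have hy1 : 1 - x ^ 2 ≤ 1 := by nlinarith [sq_nonneg x]
  have h1 : (1 - x ^ 2) * √(1 - x ^ 2)⁻¹ ≤ 1 := by
    rw [Real.sqrt_inv, ← div_eq_mul_inv, div_le_one (Real.sqrt_pos.mpr hy0)]
    exact Real.le_sqrt_of_sq_le (by nlinarith)
  have h2 : 1 - x ^ 2 ≤ 2 * (1 - x) := by nlinarith [hx.1, hx.2]
  calc (P.eval x * (1 - x ^ 2)) ^ 2 * √(1 - x ^ 2)⁻¹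
      = P.eval x ^ 2 * ((1 - x ^ 2) * ((1 - x ^ 2) * √(1 - x ^ 2)⁻¹)) := by ring
    _ ≤ P.eval x ^ 2 * (2 * (1 - x) * 1) := by
      have : 0 ≤ 1 - x := by linarith [hx.2]
      gcongr
    _ = _ := by ring

/-- Parseval's identity on the unit circle. -/
theorem integral_norm_sum_pow_sq (a : ℕ → ℝ) (n : ℕ) :
    ∫ ψ in (-Real.pi)..Real.pi, ‖∑ k ∈ Finset.range n, (a k : ℂ) *
      Complex.exp (ψ * Complex.I) ^ k‖ ^ 2 = 2 * Real.pi * ∑ k ∈ Finset.range n, a k ^ 2 := by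
  have h1 : ∀ ψ : ℝ, ‖∑ k ∈ Finset.range n, (a k : ℂ) * Complex.exp (ψ * Complex.I) ^ k‖ ^ 2 =
      ∑ j ∈ Finset.range n, ∑ k ∈ Finset.range n, a j * a k * Real.cos (((j : ℝ) - k) * ψ) := by
    intro ψ
    have e : ∀ k : ℕ, (a k : ℂ) * Complex.exp (ψ * Complex.I) ^ k =
        (a k : ℂ) * Complex.exp ((k * ψ : ℝ) * Complex.I) := by
      intro k
      rw [← Complex.exp_nat_mul]
      push_cast
      ring_nf
    simp_rw [e]
    rw [← Complex.normSq_eq_norm_sq, Complex.normSq_apply, Complex.re_sum, Complex.im_sum]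
    simp_rw [Complex.re_ofReal_mul, Complex.im_ofReal_mul, Complex.exp_ofReal_mul_I_re,
      Complex.exp_ofReal_mul_I_im]
    rw [Finset.sum_mul_sum, Finset.sum_mul_sum, ← Finset.sum_add_distrib]
    refine Finset.sum_congr rfl fun j _ => ?_
    rw [← Finset.sum_add_distrib]
    refine Finset.sum_congr rfl fun k _ => ?_
    rw [sub_mul, Real.cos_sub]
    ring
  simp_rw [h1]
  rw [intervalIntegral.integral_finsetSum fun j _ => Continuous.intervalIntegrable (by fun_prop) _ _,
    Finset.mul_sum]
  refine Finset.sum_congr rfl fun j hj => ?_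
  rw [intervalIntegral.integral_finsetSum fun j _ => Continuous.intervalIntegrable (by fun_prop) _ _]
  simp_rw [intervalIntegral.integral_const_mul]
  rw [Finset.sum_eq_single_of_mem j hj]
  · simp
    ring
  · intro k _ hk
    have hne : (j : ℝ) - k ≠ 0 := sub_ne_zero.mpr (by exact_mod_cast hk.symm)
    have h2 : ∫ ψ in (-Real.pi)..Real.pi, Real.cos (((j : ℝ) - k) * ψ) = 0 := by
      rw [intervalIntegral.integral_comp_mul_left (fun x => Real.cos x) hne, integral_cos]
      have h3 : Real.sin (((j : ℝ) - k) * Real.pi) = 0 := by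
        have := Real.sin_int_mul_pi ((j : ℤ) - k)
        push_cast at this
        exact this
      rw [mul_neg, Real.sin_neg, h3]
      simp
    rw [h2, mul_zero]

/-! ### Coefficients of a polynomial and its weighted norm on a subinterval -/

theorem eval_map_mul_one_sub_sq {P : Polynomial ℝ} {c : ℕ → ℝ} {M : ℕ}
    (hP : P * (1 - Polynomial.X ^ 2) =
      ∑ k ∈ Finset.range M, Polynomial.C (c k) * Polynomial.Chebyshev.T ℝ k) (x : ℂ) :
    (P.map Complex.ofRealHom).eval x * (1 - x ^ 2) =
      ∑ k ∈ Finset.range M, (c k : ℂ) * (Polynomial.Chebyshev.T ℂ k).eval x := by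
  have h1 := congrArg (fun Q => (Q.map Complex.ofRealHom).eval x) hP
  simpa [Polynomial.map_sum, Polynomial.eval_finsetSum] using h1

/-- The factor `1 - x²` is divided out by the maximum principle in the disc of radius `1` about
the focus `1`; the other focus is kept away by assumption. -/
theorem norm_eval_map_sq_le {P : Polynomial ℝ} {c : ℕ → ℝ} {M : ℕ}
    (hP : P * (1 - Polynomial.X ^ 2) =
      ∑ k ∈ Finset.range M, Polynomial.C (c k) * Polynomial.Chebyshev.T ℝ k) {x : ℂ} {Z : ℝ}
    (hZ : 2 ≤ Z) (hx : ‖x - 1‖ + ‖x + 1‖ ≤ Z + Z⁻¹) (hx1 : 1 ≤ ‖x + 1‖) :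
    ‖(P.map Complex.ofRealHom).eval x‖ ^ 2 ≤
      (∑ k ∈ Finset.range M, c k ^ 2) * ((Z ^ 2) ^ M + 16 ^ M) := by
  have hS : 0 ≤ ∑ k ∈ Finset.range M, c k ^ 2 := Finset.sum_nonneg fun k _ => sq_nonneg _
  have key : ∀ (y : ℂ) (W : ℝ), 2 ≤ W → ‖y - 1‖ + ‖y + 1‖ ≤ W + W⁻¹ → 1 ≤ ‖y - 1‖ → 1 ≤ ‖y + 1‖ →
      ‖(P.map Complex.ofRealHom).eval y‖ ^ 2 ≤
        (∑ k ∈ Finset.range M, c k ^ 2) * (W ^ 2) ^ M := by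
    intro y W hW hy h1 h2
    have h3 := norm_sum_chebyshevT_sq_le (by nlinarith) (by linarith) hy c M
    rw [← eval_map_mul_one_sub_sq hP, norm_mul, mul_pow] at h3
    have h4 : 1 ≤ ‖1 - y ^ 2‖ := by
      have : (1 : ℂ) - y ^ 2 = -((y - 1) * (y + 1)) := by ring
      rw [this, norm_neg, norm_mul]
      nlinarith
    refine le_trans (le_mul_of_one_le_right (sq_nonneg _) ?_) h3
    nlinarith
  rcases le_or_gt 1 ‖x - 1‖ with h1 | h1
  · refine (key x Z hZ hx h1 hx1).trans (mul_le_mul_of_nonneg_left ?_ hS)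
    linarith [pow_pos (show (0 : ℝ) < 16 by norm_num) M]
  · have h2 : ‖(P.map Complex.ofRealHom).eval x‖ ≤ √((∑ k ∈ Finset.range M, c k ^ 2) * 16 ^ M) := by
      refine Complex.norm_le_of_forall_mem_frontier_norm_le (U := Metric.ball (1 : ℂ) 1)
        Metric.isBounded_ball (f := fun y => (P.map Complex.ofRealHom).eval y)
        (Polynomial.differentiable _).diffContOnCl ?_ (subset_closure ?_)
      · intro y hy
        rw [frontier_ball _ one_ne_zero, mem_sphere_iff_norm] at hy
        refine Real.le_sqrt_of_sq_le ?_
        have h3 : y + 1 = 2 + (y - 1) := by ring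
        have h4 : ‖y + 1‖ ≤ 3 := by
          rw [h3]
          refine (norm_add_le _ _).trans ?_
          rw [hy, Complex.norm_ofNat]
          norm_num
        have h5 : 1 ≤ ‖y + 1‖ := by
          have := norm_sub_norm_le (2 : ℂ) (-(y - 1))
          rw [norm_neg, hy, sub_neg_eq_add, ← h3, Complex.norm_ofNat] at this
          linarith
        have := key y 4 (by norm_num) (by rw [hy]; norm_num; linarith) hy.ge h5
        norm_num at this
        exact this
      · rwa [mem_ball_iff_norm]
    have h3 : ‖(P.map Complex.ofRealHom).eval x‖ ^ 2 ≤ (∑ k ∈ Finset.range M, c k ^ 2) * 16 ^ M := by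
      refine (pow_le_pow_left₀ (norm_nonneg _) h2 2).trans (le_of_eq ?_)
      exact Real.sq_sqrt (by positivity)
    refine h3.trans (mul_le_mul_of_nonneg_left ?_ hS)
    linarith [pow_nonneg (sq_nonneg Z) M]

theorem norm_exp_add_le {r : ℝ} (h0 : 0 ≤ r) (h1 : r ≤ 1) (ψ : ℝ) :
    ‖Complex.exp (ψ * Complex.I) + r‖ ≤ 1 + r - r * (1 - Real.cos ψ) / 2 := by
  have hc := Real.cos_le_one ψ
  have hc' := Real.neg_one_le_cos ψ
  refine le_of_sq_le_sq ?_ (by nlinarith)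
  rw [← Complex.normSq_eq_norm_sq, Complex.normSq_apply]
  simp only [Complex.add_re, Complex.add_im, Complex.exp_ofReal_mul_I_re,
    Complex.exp_ofReal_mul_I_im, Complex.ofReal_re, Complex.ofReal_im]
  have := Real.sin_sq_add_cos_sq ψ
  nlinarith [mul_nonneg (mul_nonneg h0 (sub_nonneg.mpr h1)) (sub_nonneg.mpr hc),
    sq_nonneg (r * (1 - Real.cos ψ))]

theorem le_norm_exp_add {r : ℝ} (h0 : 0 ≤ r) (ψ : ℝ) :
    1 - r ≤ ‖Complex.exp (ψ * Complex.I) + r‖ := by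
  have := norm_sub_norm_le (Complex.exp (ψ * Complex.I)) (-(r : ℂ))
  rw [norm_neg, sub_neg_eq_add, Complex.norm_exp_ofReal_mul_I, Complex.norm_real,
    Real.norm_of_nonneg h0] at this
  exact this

/-- The rate `β` belongs to the point `-1` of the unit circle. At the other points the rate is
smaller by a factor that is Gaussian in the angle `ψ`. -/
theorem exists_ellipse_param {s d : ℝ} (hd : 0 ≤ d) (hsd : 2 ≤ s - d) :
    ∃ Z : ℝ, 2 ≤ Z ∧ Z + Z⁻¹ = 2 * (s - d) ∧
      Z ≤ (s + √(s ^ 2 - 1)) * Real.exp (-(d / (s + √(s ^ 2 - 1)))) := by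
  have h1 : 0 ≤ (s - d) ^ 2 - 1 := by nlinarith
  have h2 := Real.sqrt_nonneg ((s - d) ^ 2 - 1)
  have h3 := Real.sq_sqrt h1
  refine ⟨(s - d) + √((s - d) ^ 2 - 1), by linarith, ?_, ?_⟩
  · have h4 : ((s - d) + √((s - d) ^ 2 - 1))⁻¹ = (s - d) - √((s - d) ^ 2 - 1) := by
      refine inv_eq_of_mul_eq_one_right ?_
      nlinarith
    rw [h4]
    ring
  · have h4 : √((s - d) ^ 2 - 1) ≤ √(s ^ 2 - 1) := Real.sqrt_le_sqrt (by nlinarith)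
    have h5 : 0 < s + √(s ^ 2 - 1) := by linarith
    have h6 := Real.add_one_le_exp (-(d / (s + √(s ^ 2 - 1))))
    have h7 := mul_le_mul_of_nonneg_left h6 h5.le
    have h8 : (s + √(s ^ 2 - 1)) * (-(d / (s + √(s ^ 2 - 1))) + 1) = s + √(s ^ 2 - 1) - d := by
      field_simp
      ring
    linarith

section Subinterval

variable {r₁ r₂ : ℝ}

theorem norm_eval_map_exp_sq_le (h0 : 0 < r₁) (h12 : r₁ < r₂) (h2 : r₂ ≤ 1) {P : Polynomial ℝ}
    {c : ℕ → ℝ} {M : ℕ} (hP : P * (1 - Polynomial.X ^ 2) =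
      ∑ k ∈ Finset.range M, Polynomial.C (c k) * Polynomial.Chebyshev.T ℝ k) {s β : ℝ}
    (hs : s = (r₂ + r₁ + 2) / (r₂ - r₁)) (hβ : β = s + √(s ^ 2 - 1))
    (hβ0 : 0 < β) {ψ : ℝ} (hψ : |ψ| ≤ Real.pi) :
    ‖(P.map Complex.ofRealHom).eval
        ((-Complex.exp (ψ * Complex.I) - ((r₁ + r₂) / 2 : ℝ)) / ((r₂ - r₁) / 2 : ℝ))‖ ^ 2 ≤
      (∑ k ∈ Finset.range M, c k ^ 2) * ((β ^ 2) ^ M *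
        Real.exp (-(M * (2 * (r₁ + r₂) / ((r₂ - r₁) * Real.pi ^ 2 * β))) * ψ ^ 2) + 16 ^ M) := by
  have hS : 0 ≤ ∑ k ∈ Finset.range M, c k ^ 2 := Finset.sum_nonneg fun k _ => sq_nonneg _
  have hg : 0 < r₂ - r₁ := sub_pos.mpr h12
  have hc := Real.cos_le_one ψ
  have hc' := Real.neg_one_le_cos ψ
  set d := (r₁ + r₂) * (1 - Real.cos ψ) / (2 * (r₂ - r₁)) with hd
  have hd0 : 0 ≤ d := div_nonneg (mul_nonneg (by linarith) (by linarith)) (by linarith)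
  have hsd : 2 ≤ s - d := by
    have : s - d = (2 + (r₁ + r₂) * (1 + Real.cos ψ) / 2) / (r₂ - r₁) := by
      rw [hs, hd]
      field_simp
      ring
    rw [this, le_div_iff₀ hg]
    nlinarith [mul_nonneg (show 0 ≤ r₁ + r₂ by linarith) (show 0 ≤ 1 + Real.cos ψ by linarith)]
  obtain ⟨Z, hZ2, hZ, hZβ⟩ := exists_ellipse_param hd0 hsd
  rw [← hβ] at hZβ
  set E := Complex.exp (ψ * Complex.I) with hE
  set x : ℂ := (-E - ((r₁ + r₂) / 2 : ℝ)) / ((r₂ - r₁) / 2 : ℝ) with hx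
  have hgc : ((r₂ : ℂ) - r₁) ≠ 0 := by exact_mod_cast hg.ne'
  have e1 : ‖x - 1‖ = ‖E + r₂‖ / ((r₂ - r₁) / 2) := by
    have : x - 1 = -(E + r₂) / ((r₂ - r₁) / 2 : ℝ) := by
      rw [hx]
      push_cast
      field_simp
      ring
    rw [this, norm_div, norm_neg, Complex.norm_real, Real.norm_of_nonneg (by linarith)]
  have e2 : ‖x + 1‖ = ‖E + r₁‖ / ((r₂ - r₁) / 2) := by
    have : x + 1 = -(E + r₁) / ((r₂ - r₁) / 2 : ℝ) := by
      rw [hx]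
      push_cast
      field_simp
      ring
    rw [this, norm_div, norm_neg, Complex.norm_real, Real.norm_of_nonneg (by linarith)]
  have hsum : ‖x - 1‖ + ‖x + 1‖ ≤ Z + Z⁻¹ := by
    rw [hZ, e1, e2, ← add_div, div_le_iff₀ (by linarith)]
    have h3 := norm_exp_add_le h0.le (h12.le.trans h2) ψ
    have h4 := norm_exp_add_le (h0.trans h12).le h2 ψ
    have h5 : 2 * (s - d) * ((r₂ - r₁) / 2) =
        (1 + r₁ - r₁ * (1 - Real.cos ψ) / 2) + (1 + r₂ - r₂ * (1 - Real.cos ψ) / 2) := by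
      rw [hs, hd]
      field_simp
      ring
    linarith
  have hx1 : 1 ≤ ‖x + 1‖ := by
    rw [e2, le_div_iff₀ (by linarith)]
    linarith [le_norm_exp_add h0.le ψ]
  refine (norm_eval_map_sq_le hP hZ2 hsum hx1).trans (mul_le_mul_of_nonneg_left ?_ hS)
  gcongr ?_ + _
  have hq : 2 / Real.pi ^ 2 * ψ ^ 2 ≤ 1 - Real.cos ψ := by
    linarith [Real.cos_le_one_sub_mul_cos_sq hψ]
  calc (Z ^ 2) ^ M ≤ ((β * Real.exp (-(d / β))) ^ 2) ^ M := by gcongr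
    _ = (β ^ 2) ^ M * Real.exp (-(M * (2 * (d / β)))) := by
      rw [mul_pow, mul_pow, ← Real.exp_nat_mul, ← Real.exp_nat_mul]
      congr 2
      push_cast
      ring
    _ ≤ _ := by
      have h3 : (r₁ + r₂) * (2 / Real.pi ^ 2 * ψ ^ 2) / (2 * (r₂ - r₁)) ≤ d := by
        rw [hd]
        gcongr
        linarith
      have h4 : 2 * (r₁ + r₂) / ((r₂ - r₁) * Real.pi ^ 2 * β) * ψ ^ 2 =
          2 * ((r₁ + r₂) * (2 / Real.pi ^ 2 * ψ ^ 2) / (2 * (r₂ - r₁)) / β) := by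
        have := Real.pi_pos.ne'
        field_simp
      rw [neg_mul, mul_assoc, h4]
      gcongr

theorem integral_gaussian_le {b : ℝ} (hb : 0 < b) (a : ℝ) :
    ∫ x in (-a)..a, Real.exp (-b * x ^ 2) ≤ √(Real.pi / b) := by
  rw [← integral_gaussian b]
  rcases le_or_gt (-a) a with h | h
  · rw [intervalIntegral.integral_of_le h]
    exact setIntegral_le_integral (integrable_exp_neg_mul_sq hb)
      (Filter.Eventually.of_forall fun x => (Real.exp_pos _).le)
  · rw [intervalIntegral.integral_of_ge h.le]
    have h1 : 0 ≤ ∫ x in Set.Ioc a (-a), Real.exp (-b * x ^ 2) :=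
      integral_nonneg fun x => (Real.exp_pos _).le
    have h2 : 0 ≤ ∫ x : ℝ, Real.exp (-b * x ^ 2) := integral_nonneg fun x => (Real.exp_pos _).le
    linarith

theorem sixteen_pow_mul_sqrt_le (M : ℕ) : 16 ^ M * √M ≤ 16 / 9 * (25 : ℝ) ^ M := by
  have h1 := one_add_mul_le_pow (show (-2 : ℝ) ≤ 9 / 16 by norm_num) M
  have h2 : √(M : ℝ) ≤ 16 / 9 * (1 + M * (9 / 16)) := by
    have := Real.sq_sqrt (Nat.cast_nonneg (α := ℝ) M)
    nlinarith [sq_nonneg (√(M : ℝ) - 1)]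
  have h3 : (25 : ℝ) ^ M = 16 ^ M * (1 + 9 / 16) ^ M := by
    rw [← mul_pow]
    norm_num
  rw [h3]
  have h4 : (0 : ℝ) < 16 ^ M := by positivity
  nlinarith

theorem sum_coeff_sq_le_of_chebyshev (h0 : 0 < r₁) (h12 : r₁ < r₂) (h2 : r₂ ≤ 1) {s β : ℝ}
    (hs : s = (r₂ + r₁ + 2) / (r₂ - r₁)) (hβ : β = s + √(s ^ 2 - 1)) (hβ5 : 5 ≤ β)
    {p : Polynomial ℝ} {n M : ℕ} (hp : p.natDegree < n) {c : ℕ → ℝ} (hM : 0 < M)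
    (hP : p.comp (Polynomial.C ((r₁ + r₂) / 2) + Polynomial.C ((r₂ - r₁) / 2) * Polynomial.X) *
      (1 - Polynomial.X ^ 2) =
      ∑ k ∈ Finset.range M, Polynomial.C (c k) * Polynomial.Chebyshev.T ℝ k) :
    ∑ k ∈ Finset.range n, p.coeff k ^ 2 ≤
      (√(Real.pi / (2 * (r₁ + r₂) / ((r₂ - r₁) * Real.pi ^ 2 * β))) / (2 * Real.pi) + 16 / 9) *
        ((β ^ 2) ^ M / √M) * ∑ k ∈ Finset.range M, c k ^ 2 := by
  have hS : 0 ≤ ∑ k ∈ Finset.range M, c k ^ 2 := Finset.sum_nonneg fun k _ => sq_nonneg _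
  have hg : 0 < r₂ - r₁ := sub_pos.mpr h12
  have hgc : ((r₂ : ℂ) - r₁) ≠ 0 := by exact_mod_cast hg.ne'
  have hπ := Real.pi_pos
  have hM0 : (0 : ℝ) < M := by exact_mod_cast hM
  set S := ∑ k ∈ Finset.range M, c k ^ 2 with hSdef
  set b := 2 * (r₁ + r₂) / ((r₂ - r₁) * Real.pi ^ 2 * β) with hb
  have hb0 : 0 < b := by
    have : 0 < r₁ + r₂ := by linarith
    positivity
  have hpar := integral_norm_sum_pow_sq (fun k => (-1) ^ k * p.coeff k) n
  have hsq : ∀ k, ((-1) ^ k * p.coeff k) ^ 2 = p.coeff k ^ 2 := fun k => by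
    rw [mul_pow, ← pow_mul, mul_comm k 2, pow_mul]
    norm_num
  simp_rw [hsq] at hpar
  have hle : ∫ ψ in (-Real.pi)..Real.pi, ‖∑ k ∈ Finset.range n,
        (((-1) ^ k * p.coeff k : ℝ) : ℂ) * Complex.exp (ψ * Complex.I) ^ k‖ ^ 2 ≤
      ∫ ψ in (-Real.pi)..Real.pi, (S * (β ^ 2) ^ M * Real.exp (-(M * b) * ψ ^ 2) + S * 16 ^ M) := by
    refine intervalIntegral.integral_mono_on (by linarith)
      (Continuous.intervalIntegrable (by fun_prop) _ _)
      (Continuous.intervalIntegrable (by fun_prop) _ _) fun ψ hψ => ?_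
    have h3 := norm_eval_map_exp_sq_le h0 h12 h2 hP hs hβ (by linarith) (abs_le.mpr hψ)
    refine le_trans (le_of_eq ?_) (h3.trans (le_of_eq (by rw [← hSdef, ← hb]; ring)))
    congr 2
    have h4 : ((r₁ + r₂) / 2 : ℝ) + ((r₂ - r₁) / 2 : ℝ) *
        ((-Complex.exp (ψ * Complex.I) - ((r₁ + r₂) / 2 : ℝ)) / ((r₂ - r₁) / 2 : ℝ)) =
        -Complex.exp (ψ * Complex.I) := by
      push_cast
      field_simp
      ring
    rw [Polynomial.map_comp, Polynomial.eval_comp]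
    simp only [Polynomial.map_add, Polynomial.map_mul, Polynomial.map_C, Polynomial.map_X,
      Polynomial.eval_add, Polynomial.eval_mul, Polynomial.eval_C, Polynomial.eval_X,
      Complex.ofRealHom_eq_coe]
    rw [h4, Polynomial.eval_eq_sum_range' ((Polynomial.natDegree_map_le).trans_lt hp)]
    refine Finset.sum_congr rfl fun k _ => ?_
    rw [Polynomial.coeff_map, neg_pow]
    push_cast
    simp only [Complex.ofRealHom_eq_coe]
    ring
  rw [hpar, intervalIntegral.integral_add (Continuous.intervalIntegrable (by fun_prop) _ _)
    (Continuous.intervalIntegrable (by fun_prop) _ _), intervalIntegral.integral_const_mul,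
    intervalIntegral.integral_const, smul_eq_mul] at hle
  have hG := integral_gaussian_le (b := M * b) (by positivity) Real.pi
  have hG' : √(Real.pi / (M * b)) = √(Real.pi / b) / √M := by
    rw [← Real.sqrt_div' _ hM0.le]
    congr 1
    field_simp
  rw [hG'] at hG
  have h16 : (16 : ℝ) ^ M ≤ 16 / 9 * ((β ^ 2) ^ M / √M) := by
    rw [mul_div_assoc', le_div_iff₀ (Real.sqrt_pos.mpr hM0)]
    refine (sixteen_pow_mul_sqrt_le M).trans ?_
    gcongr
    nlinarith
  have h5 : S * (β ^ 2) ^ M * ∫ ψ in (-Real.pi)..Real.pi, Real.exp (-(M * b) * ψ ^ 2) ≤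
      S * (β ^ 2) ^ M * (√(Real.pi / b) / √M) := by gcongr
  have h6 : S * 16 ^ M ≤ S * (16 / 9 * ((β ^ 2) ^ M / √M)) := by gcongr
  have h7 : (2 * Real.pi) * ∑ k ∈ Finset.range n, p.coeff k ^ 2 ≤ (2 * Real.pi) *
      ((√(Real.pi / b) / (2 * Real.pi) + 16 / 9) * ((β ^ 2) ^ M / √M) * S) := by
    have e : (2 * Real.pi) * ((√(Real.pi / b) / (2 * Real.pi) + 16 / 9) * ((β ^ 2) ^ M / √M) * S) =
        S * (β ^ 2) ^ M * (√(Real.pi / b) / √M) +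
          (2 * Real.pi) * (S * (16 / 9 * ((β ^ 2) ^ M / √M))) := by
      field_simp
    rw [e]
    nlinarith
  exact le_of_mul_le_mul_left h7 (by positivity)

theorem integral_comp_affine_eq (r₁ r₂ : ℝ) (p : Polynomial ℝ) :
    ∫ ρ in r₁..r₂, p.eval ρ ^ 2 * (r₂ - ρ) = ((r₂ - r₁) / 2) ^ 2 * ∫ x in (-1 : ℝ)..1,
      (p.comp (Polynomial.C ((r₁ + r₂) / 2) + Polynomial.C ((r₂ - r₁) / 2) * Polynomial.X)).eval x
        ^ 2 * (1 - x) := by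
  have h := intervalIntegral.smul_integral_comp_add_mul (a := -1) (b := 1)
    (fun ρ => p.eval ρ ^ 2 * (r₂ - ρ)) ((r₂ - r₁) / 2) ((r₁ + r₂) / 2)
  have e1 : (r₁ + r₂) / 2 + (r₂ - r₁) / 2 * -1 = r₁ := by ring
  have e2 : (r₁ + r₂) / 2 + (r₂ - r₁) / 2 * 1 = r₂ := by ring
  rw [e1, e2] at h
  rw [← h, smul_eq_mul, sq, mul_assoc]
  congr 1
  rw [← intervalIntegral.integral_const_mul]
  congr 1
  ext x
  simp only [Polynomial.eval_comp, Polynomial.eval_add, Polynomial.eval_mul, Polynomial.eval_C,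
    Polynomial.eval_X]
  ring

/-- The sum of the squares of the coefficients of a polynomial is its mean square on the unit
circle, which is dominated by a neighbourhood of `-1`; the width of that neighbourhood is
responsible for the factor `1 / √(n + 1)`. -/
theorem exists_sum_coeff_sq_le (h0 : 0 < r₁) (h12 : r₁ < r₂) (h2 : r₂ ≤ 1) {s β : ℝ}
    (hs : s = (r₂ + r₁ + 2) / (r₂ - r₁)) (hβ : β = s + √(s ^ 2 - 1)) :
    ∃ C : ℝ, 0 < C ∧ ∀ (n : ℕ) (p : Polynomial ℝ), p.natDegree ≤ n →
      ∑ k ∈ Finset.range (n + 1), p.coeff k ^ 2 ≤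
        C * ((β ^ 2) ^ n / √(n + 1)) * ∫ ρ in r₁..r₂, p.eval ρ ^ 2 * (r₂ - ρ) := by
  have hg : 0 < r₂ - r₁ := sub_pos.mpr h12
  have hπ := Real.pi_pos
  have hs3 : 3 ≤ s := by
    rw [hs, le_div_iff₀ hg]
    linarith
  have hβ5 : 5 ≤ β := by
    have : 2 ≤ √(s ^ 2 - 1) := Real.le_sqrt_of_sq_le (by nlinarith)
    linarith
  set K := √(Real.pi / (2 * (r₁ + r₂) / ((r₂ - r₁) * Real.pi ^ 2 * β))) / (2 * Real.pi) + 16 / 9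
    with hK
  have hK0 : 0 < K := by positivity
  refine ⟨K * (β ^ 2) ^ 3 * (4 / Real.pi) / ((r₂ - r₁) / 2) ^ 2, by positivity, ?_⟩
  intro n p hp
  set P := p.comp (Polynomial.C ((r₁ + r₂) / 2) + Polynomial.C ((r₂ - r₁) / 2) * Polynomial.X)
    with hP
  have hlin : (Polynomial.C ((r₁ + r₂) / 2) +
      Polynomial.C ((r₂ - r₁) / 2) * Polynomial.X).natDegree ≤ 1 := by compute_degree
  have hdeg : (P * (1 - Polynomial.X ^ 2)).degree < ((n + 3 : ℕ) : WithBot ℕ) := by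
    refine lt_of_le_of_lt Polynomial.degree_le_natDegree ?_
    have h3 : (1 - Polynomial.X ^ 2 : Polynomial ℝ).natDegree ≤ 2 := by compute_degree
    have h4 : P.natDegree ≤ n := by
      refine Polynomial.natDegree_comp_le.trans ?_
      calc _ ≤ n * 1 := Nat.mul_le_mul hp hlin
        _ = n := mul_one n
    have h5 := Polynomial.natDegree_mul_le (p := P) (q := (1 - Polynomial.X ^ 2 : Polynomial ℝ))
    exact_mod_cast (show _ < n + 3 by omega)
  obtain ⟨c, hc⟩ := exists_eq_sum_of_degree_lt (Polynomial.Chebyshev.chebyshevTsequence ℝ) hdeg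
  have hc' : P * (1 - Polynomial.X ^ 2) =
      ∑ k ∈ Finset.range (n + 3), Polynomial.C (c k) * Polynomial.Chebyshev.T ℝ k := hc
  have h6 := sum_coeff_sq_le_of_chebyshev h0 h12 h2 hs hβ hβ5 (Nat.lt_succ_of_le hp)
    (by omega) hc'
  rw [← hK] at h6
  have h7 : Real.pi / 2 * ∑ k ∈ Finset.range (n + 3), c k ^ 2 ≤
      2 * ∫ x in (-1 : ℝ)..1, P.eval x ^ 2 * (1 - x) := by
    refine (sum_sq_le_integral_measureT c (n + 3)).trans
      (le_trans (le_of_eq ?_) (integral_sq_measureT_le P))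
    congr 1
    ext x
    congr 1
    have := congrArg (Polynomial.eval x) hc'
    simp only [Polynomial.eval_finsetSum, Polynomial.eval_mul, Polynomial.eval_C,
      Polynomial.eval_sub, Polynomial.eval_one, Polynomial.eval_pow, Polynomial.eval_X] at this
    exact this.symm
  rw [integral_comp_affine_eq r₁ r₂, ← hP]
  set I := ∫ x in (-1 : ℝ)..1, P.eval x ^ 2 * (1 - x)
  have h8 : ∑ k ∈ Finset.range (n + 3), c k ^ 2 ≤ 4 / Real.pi * I := by
    rw [div_mul_eq_mul_div, le_div_iff₀ hπ]
    linarith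
  have h9 : (β ^ 2) ^ (n + 3) / √((n + 3 : ℕ) : ℝ) ≤ (β ^ 2) ^ 3 * ((β ^ 2) ^ n / √(n + 1)) := by
    rw [pow_add, mul_comm ((β ^ 2) ^ n), mul_div_assoc]
    gcongr
    push_cast
    linarith
  have hS : 0 ≤ ∑ k ∈ Finset.range (n + 3), c k ^ 2 := Finset.sum_nonneg fun k _ => sq_nonneg _
  calc _ ≤ _ := h6
    _ ≤ K * ((β ^ 2) ^ 3 * ((β ^ 2) ^ n / √(n + 1))) * (4 / Real.pi * I) := by gcongr
    _ = _ := by field_simp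

end Subinterval

/-! ### The upper bound for polynomials in the squared slowness -/

section UpperBound

variable {pStar pTop pLo pHi : ℝ}

theorem halfGap_mul_one_sub_mediumArg (h : ReflectedGeometry pStar pTop pLo pHi) (q : ℝ) :
    pLo ^ 2 + halfGap pLo pHi * (1 - mediumArg pLo pHi q) = q ^ 2 := by
  have hκ := halfGap_pos h
  rw [mediumArg]
  field_simp
  ring

/-- The Legendre coefficients of `q² f(q²)` in the variable `x` of the medium. -/
theorem exists_legendre_expansion (h : ReflectedGeometry pStar pTop pLo pHi) {N : ℕ}
    {f : Polynomial ℝ} (hf : f.degree < N) :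
    ∃ a : ℕ → ℝ, ∀ q : ℝ, q ^ 2 * f.eval (q ^ 2) =
      ∑ n ∈ Finset.range (N + 1), a n * (legendre n).eval (mediumArg pLo pHi q) := by
  set L : Polynomial ℝ := Polynomial.C (pLo ^ 2) +
    Polynomial.C (halfGap pLo pHi) * (1 - Polynomial.X) with hL
  have hL1 : L.natDegree ≤ 1 := by rw [hL]; compute_degree
  have hdeg : ((Polynomial.X * f).comp L).degree < ((N + 1 : ℕ) : WithBot ℕ) := by
    refine lt_of_le_of_lt Polynomial.degree_le_natDegree ?_
    rcases eq_or_ne f 0 with rfl | hf0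
    · simp only [mul_zero, Polynomial.zero_comp, Polynomial.natDegree_zero]
      exact_mod_cast Nat.succ_pos N
    · have h1 : f.natDegree < N := (Polynomial.natDegree_lt_iff_degree_lt hf0).mpr hf
      have h2 : (Polynomial.X * f).natDegree ≤ N := by
        rw [Polynomial.natDegree_X_mul hf0]
        omega
      have h3 : ((Polynomial.X * f).comp L).natDegree ≤ N * 1 :=
        Polynomial.natDegree_comp_le.trans (Nat.mul_le_mul h2 hL1)
      exact_mod_cast (show _ < N + 1 by omega)
  obtain ⟨a, ha⟩ := exists_eq_sum_of_degree_lt legendreSequence hdeg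
  refine ⟨a, fun q => ?_⟩
  have h1 := congrArg (Polynomial.eval (mediumArg pLo pHi q)) ha
  have h2 : L.eval (mediumArg pLo pHi q) = q ^ 2 := by
    rw [← halfGap_mul_one_sub_mediumArg h q, hL]
    simp
  rw [Polynomial.eval_comp, h2, Polynomial.eval_finsetSum] at h1
  simp only [Polynomial.eval_mul, Polynomial.eval_X, Polynomial.eval_C] at h1
  exact h1

theorem traveltime_polySq (h : ReflectedGeometry pStar pTop pLo pHi) {N : ℕ} {f : Polynomial ℝ}
    {a : ℕ → ℝ} (ha : ∀ q : ℝ, q ^ 2 * f.eval (q ^ 2) =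
      ∑ n ∈ Finset.range (N + 1), a n * (legendre n).eval (mediumArg pLo pHi q))
    {p : ℝ} (hp0 : 0 ≤ p) (hp : p < pLo) :
    traveltime pLo pHi (polySq pLo pHi f) p = √(2 * rho pLo pHi p * halfGap pLo pHi) *
      ∑ n ∈ Finset.range (N + 1), a n * (2 * rho pLo pHi p ^ n / (2 * n + 1)) := by
  have hκ := halfGap_pos h
  have hr0 := rho_pos h hp0 hp.le
  have hr1 := rho_lt_one h hp0 hp
  have h1 : ∫ q in Set.Ioo pLo pHi, 1 / √(q ^ 2 - p ^ 2) * (q ^ 3 * polySq pLo pHi f q) =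
      ∫ q in Set.Ioo pLo pHi, √(2 * rho pLo pHi p / halfGap pLo pHi) / 2 *
        ((fun x => (∑ n ∈ Finset.range (N + 1), a n * (legendre n).eval x) *
          legendreGen (rho pLo pHi p) x) (mediumArg pLo pHi q) * (2 * q)) := by
    refine integral_congr_ae ?_
    filter_upwards [(memLp_poly_sq pLo pHi f).coeFn_toLp] with q hq
    have hq' : polySq pLo pHi f q = f.eval (q ^ 2) := hq
    rw [hq', ← ha q, kernel_eq_legendreGen h hp0 hp.le]
    ring
  have hc : ContinuousOn (fun x => (∑ n ∈ Finset.range (N + 1), a n * (legendre n).eval x) *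
      legendreGen (rho pLo pHi p) x) (Set.Icc (-1) 1) :=
    (Continuous.continuousOn (by fun_prop)).mul (continuousOn_legendreGen hr0.le hr1)
  rw [traveltime, h1, integral_const_mul, integral_comp_mediumArg h hc,
    integral_sum_legendre_mul_legendreGen hr0 hr1]
  have h2 : √(2 * rho pLo pHi p * halfGap pLo pHi) =
      √(2 * rho pLo pHi p / halfGap pLo pHi) * halfGap pLo pHi := by
    rw [← Real.sqrt_sq hκ.le, ← Real.sqrt_mul (by positivity), Real.sqrt_sq hκ.le]
    congr 1
    field_simp
  rw [h2]
  ring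

theorem norm_polySq_sq_le (h : ReflectedGeometry pStar pTop pLo pHi) {N : ℕ} {f : Polynomial ℝ}
    {a : ℕ → ℝ} (ha : ∀ q : ℝ, q ^ 2 * f.eval (q ^ 2) =
      ∑ n ∈ Finset.range (N + 1), a n * (legendre n).eval (mediumArg pLo pHi q)) :
    ‖polySq pLo pHi f‖ ^ 2 ≤ halfGap pLo pHi / (2 * pLo ^ 5) *
      ((N + 1) * ∑ n ∈ Finset.range (N + 1), (2 * a n / (2 * n + 1)) ^ 2) := by
  have hκ := halfGap_pos h
  have hlo := h.pLo_pos
  have hx := continuous_mediumArg (pLo := pLo) (pHi := pHi)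
  have h1 : ‖polySq pLo pHi f‖ ^ 2 = ∫ q in Set.Ioo pLo pHi, f.eval (q ^ 2) ^ 2 :=
    norm_toLp_sq_eq_integral (memLp_poly_sq pLo pHi f)
  have hint : ∀ g : ℝ → ℝ, Continuous g → IntegrableOn g (Set.Ioo pLo pHi) := fun g hg =>
    hg.integrableOn_Icc.mono_set Set.Ioo_subset_Icc_self
  have h2 : ∫ q in Set.Ioo pLo pHi, f.eval (q ^ 2) ^ 2 ≤
      ∫ q in Set.Ioo pLo pHi, 1 / (2 * pLo ^ 5) *
        ((fun x => (∑ n ∈ Finset.range (N + 1), a n * (legendre n).eval x) ^ 2)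
          (mediumArg pLo pHi q) * (2 * q)) := by
    refine setIntegral_mono_on (hint _ (by fun_prop)) (hint _ (by fun_prop)) measurableSet_Ioo
      fun q hq => ?_
    simp only
    rw [← ha q, div_mul_eq_mul_div, le_div_iff₀ (by positivity)]
    have h3 : pLo ^ 5 ≤ q ^ 5 := pow_le_pow_left₀ hlo.le hq.1.le 5
    nlinarith [mul_le_mul_of_nonneg_left h3 (sq_nonneg (f.eval (q ^ 2)))]
  rw [integral_const_mul, integral_comp_mediumArg h
    (f := fun x => (∑ n ∈ Finset.range (N + 1), a n * (legendre n).eval x) ^ 2)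
    (Continuous.continuousOn (by fun_prop)),
    integral_sum_legendre_sq] at h2
  rw [h1]
  refine h2.trans ?_
  rw [← mul_assoc, one_div_mul_eq_div]
  refine mul_le_mul_of_nonneg_left ?_ (by positivity)
  rw [Finset.mul_sum]
  refine Finset.sum_le_sum fun n hn => ?_
  have hn' : (n : ℝ) ≤ N := by exact_mod_cast Nat.lt_succ_iff.mp (Finset.mem_range.mp hn)
  have h4 : a n ^ 2 * (2 / (2 * n + 1)) = (n + 1 / 2) * (2 * a n / (2 * n + 1)) ^ 2 := by
    field_simp
  rw [h4]
  gcongr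
  norm_num

/-! #### The observed slowness as a function of `ρ` -/

/-- The inverse function of `rho`. -/
noncomputable def slownessOfRho (pLo pHi ρ : ℝ) : ℝ :=
  √(pLo ^ 2 - halfGap pLo pHi * ((ρ + 1 / ρ) / 2 - 1))

theorem slownessOfRho_rho (h : ReflectedGeometry pStar pTop pLo pHi) {p : ℝ} (hp0 : 0 ≤ p)
    (hp : p ≤ pLo) : slownessOfRho pLo pHi (rho pLo pHi p) = p := by
  have hκ := halfGap_pos h
  have hr := rho_pos h hp0 hp
  have ht := one_le_observedArg h hp0 hp
  have h1 := joukowskiInv_sq_add_one ht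
  rw [← rho_eq_joukowskiInv h.pLo_pos h.medium] at h1
  have h2 : (rho pLo pHi p + 1 / rho pLo pHi p) / 2 = observedArg pLo pHi p := by
    field_simp
    linarith
  rw [slownessOfRho, h2, observedArg]
  have h3 : pLo ^ 2 - halfGap pLo pHi * (1 + (pLo ^ 2 - p ^ 2) / halfGap pLo pHi - 1) = p ^ 2 := by
    field_simp
    ring
  rw [h3, Real.sqrt_sq hp0]

theorem pStar_sq_le_of_rho_le (h : ReflectedGeometry pStar pTop pLo pHi) {ρ : ℝ}
    (hρ : rho pLo pHi pStar ≤ ρ) (hρ1 : ρ ≤ 1) :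
    pStar ^ 2 ≤ pLo ^ 2 - halfGap pLo pHi * ((ρ + 1 / ρ) / 2 - 1) := by
  have hκ := halfGap_pos h
  have hpl : pStar ≤ pLo := h.observed.le.trans h.reflected
  have hr := rho_pos h h.pos.le hpl
  have h1 := joukowskiInv_sq_add_one (one_le_observedArg h h.pos.le hpl)
  rw [← rho_eq_joukowskiInv h.pLo_pos h.medium] at h1
  set r := rho pLo pHi pStar
  have h2 : (ρ + 1 / ρ) / 2 ≤ observedArg pLo pHi pStar := by
    have h3 : observedArg pLo pHi pStar = (r + 1 / r) / 2 := by
      field_simp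
      linarith
    have h4 : (r + 1 / r) - (ρ + 1 / ρ) = (ρ - r) * (1 - r * ρ) / (r * ρ) := by
      have : ρ ≠ 0 := (hr.trans_le hρ).ne'
      field_simp
      ring
    have h5 : 0 ≤ (ρ - r) * (1 - r * ρ) / (r * ρ) := by
      have : 0 < ρ := hr.trans_le hρ
      refine div_nonneg (mul_nonneg (by linarith) ?_) (by positivity)
      nlinarith
    rw [h3]
    linarith
  have h6 : halfGap pLo pHi * (observedArg pLo pHi pStar - 1) = pLo ^ 2 - pStar ^ 2 := by
    rw [observedArg]
    field_simp
    ring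
  nlinarith [mul_le_mul_of_nonneg_left h2 hκ.le]

theorem rho_slownessOfRho (h : ReflectedGeometry pStar pTop pLo pHi) {ρ : ℝ}
    (hρ : rho pLo pHi pStar ≤ ρ) (hρ1 : ρ ≤ 1) :
    rho pLo pHi (slownessOfRho pLo pHi ρ) = ρ := by
  have hκ := halfGap_pos h
  have hρ0 : 0 < ρ := (rho_pos h h.pos.le (h.observed.le.trans h.reflected)).trans_le hρ
  have h1 := pStar_sq_le_of_rho_le h hρ hρ1
  rw [rho_eq_joukowskiInv h.pLo_pos h.medium, observedArg, slownessOfRho,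
    Real.sq_sqrt ((sq_nonneg _).trans h1)]
  have h2 : 1 + (pLo ^ 2 - (pLo ^ 2 - halfGap pLo pHi * ((ρ + 1 / ρ) / 2 - 1))) / halfGap pLo pHi =
      (ρ + 1 / ρ) / 2 := by
    field_simp
    ring
  rw [h2, joukowskiInv_of_add_inv hρ0 hρ1]

theorem hasDerivAt_slownessOfRho (h : ReflectedGeometry pStar pTop pLo pHi) {ρ : ℝ}
    (hρ : rho pLo pHi pStar ≤ ρ) (hρ1 : ρ ≤ 1) :
    HasDerivAt (slownessOfRho pLo pHi)
      (halfGap pLo pHi * (1 / ρ ^ 2 - 1) / (4 * slownessOfRho pLo pHi ρ)) ρ := by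
  have hρ0 : 0 < ρ := (rho_pos h h.pos.le (h.observed.le.trans h.reflected)).trans_le hρ
  have h1 := pStar_sq_le_of_rho_le h hρ hρ1
  have h2 : 0 < pLo ^ 2 - halfGap pLo pHi * ((ρ + 1 / ρ) / 2 - 1) :=
    (pow_pos h.pos 2).trans_le h1
  have h3 : HasDerivAt (fun ρ => pLo ^ 2 - halfGap pLo pHi * ((ρ + 1 / ρ) / 2 - 1))
      (-(halfGap pLo pHi * ((1 - 1 / ρ ^ 2) / 2))) ρ := by
    have h4 : HasDerivAt (fun ρ : ℝ => 1 / ρ) (-(1 / ρ ^ 2)) ρ := by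
      simpa [one_div] using hasDerivAt_inv hρ0.ne'
    exact (((((hasDerivAt_id ρ).add h4).div_const 2).sub_const 1).const_mul
      (halfGap pLo pHi)).const_sub (pLo ^ 2) |>.congr_deriv (by ring)
  refine (h3.sqrt h2.ne').congr_deriv ?_
  rw [slownessOfRho]
  have := (Real.sqrt_pos.mpr h2).ne'
  field_simp
  ring

theorem continuous_rho : Continuous (rho pLo pHi) := by
  unfold rho
  fun_prop

/-- The Jacobian of the substitution `p ↔ ρ` vanishes at worst linearly at `ρ^*`. -/
theorem integral_sq_mul_sub_le (h : ReflectedGeometry pStar pTop pLo pHi) (H : Polynomial ℝ) :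
    ∫ ρ in (rho pLo pHi pStar)..(rho pLo pHi pTop), H.eval ρ ^ 2 * (rho pLo pHi pTop - ρ) ≤
      2 * pLo / (halfGap pLo pHi ^ 2 * rho pLo pHi pStar) * ∫ p in Set.Ioo pStar pTop,
        2 * rho pLo pHi p * halfGap pLo pHi * H.eval (rho pLo pHi p) ^ 2 := by
  have hκ := halfGap_pos h
  have hlo := h.pLo_pos
  have hps := h.pos
  have hpl : pStar ≤ pLo := h.observed.le.trans h.reflected
  have hst := rho_pos h h.pos.le hpl
  have hlt := rho_strictMono h h.pos.le h.observed h.reflected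
  have htop1 := rho_le_one h (h.pos.trans h.observed).le h.reflected
  have e1 := slownessOfRho_rho h h.pos.le hpl
  have e2 := slownessOfRho_rho h (h.pos.trans h.observed).le h.reflected
  have hinv := fun ρ => rho_slownessOfRho h (ρ := ρ)
  have hder := fun ρ => hasDerivAt_slownessOfRho h (ρ := ρ)
  have hsq := fun ρ => pStar_sq_le_of_rho_le h (ρ := ρ)
  set r := rho pLo pHi pStar with hr
  set R := rho pLo pHi pTop with hR
  set κ := halfGap pLo pHi with hκdef
  have hcr := continuous_rho (pLo := pLo) (pHi := pHi)
  have hφ : ∀ ρ ∈ Set.Icc r R, pStar ≤ slownessOfRho pLo pHi ρ ∧ slownessOfRho pLo pHi ρ ≤ pLo := by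
    intro ρ hρ
    have hρ0 : 0 < ρ := hst.trans_le hρ.1
    refine ⟨Real.le_sqrt_of_sq_le (hsq ρ hρ.1 (hρ.2.trans htop1)), ?_⟩
    refine Real.sqrt_le_iff.mpr ⟨hlo.le, ?_⟩
    have h1 : 0 ≤ (ρ + 1 / ρ) / 2 - 1 := by
      have : (ρ + 1 / ρ) / 2 - 1 = (ρ - 1) ^ 2 / (2 * ρ) := by
        field_simp
        ring
      rw [this]
      positivity
    have := mul_nonneg hκ.le h1
    linarith
  have hφc : ContinuousOn (slownessOfRho pLo pHi) (Set.Icc r R) := fun ρ hρ =>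
    (hder ρ hρ.1 (hρ.2.trans htop1)).continuousAt.continuousWithinAt
  have hdc : ContinuousOn (fun ρ => κ * (1 / ρ ^ 2 - 1) / (4 * slownessOfRho pLo pHi ρ))
      (Set.Icc r R) := by
    refine ContinuousOn.div (continuousOn_const.mul ((continuousOn_const.div
      (by fun_prop) fun ρ hρ => ?_).sub continuousOn_const)) (continuousOn_const.mul hφc)
      fun ρ hρ => ?_
    · exact (pow_pos (hst.trans_le hρ.1) 2).ne'
    · have := hps.trans_le (hφ ρ hρ).1
      positivity
  have hw : Continuous fun p => 2 * rho pLo pHi p * κ * H.eval (rho pLo pHi p) ^ 2 := by fun_prop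
  have hsub := intervalIntegral.integral_comp_mul_deriv (a := r) (b := R)
    (fun ρ hρ => by
      rw [Set.uIcc_of_le hlt.le] at hρ
      exact hder ρ hρ.1 (hρ.2.trans htop1))
    (by rw [Set.uIcc_of_le hlt.le]; exact hdc) hw
  rw [e1, e2] at hsub
  rw [← integral_Ioc_eq_integral_Ioo, ← intervalIntegral.integral_of_le h.observed.le, ← hsub,
    ← intervalIntegral.integral_const_mul]
  refine intervalIntegral.integral_mono_on hlt.le (Continuous.intervalIntegrable (by fun_prop) _ _)
    ?_ fun ρ hρ => ?_
  · refine ContinuousOn.intervalIntegrable ?_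
    rw [Set.uIcc_of_le hlt.le]
    exact continuousOn_const.mul ((hw.comp_continuousOn hφc).mul hdc)
  · have hρ0 : 0 < ρ := hst.trans_le hρ.1
    obtain ⟨hφ1, hφ2⟩ := hφ ρ hρ
    simp only [Function.comp_apply]
    rw [hinv ρ hρ.1 (hρ.2.trans htop1)]
    set φ := slownessOfRho pLo pHi ρ
    have hφ0 : 0 < φ := hps.trans_le hφ1
    have h1 : R - ρ ≤ 1 / ρ ^ 2 - 1 := by
      have h2 : 1 ≤ 1 / ρ ^ 2 * ρ := by
        have : 1 / ρ ^ 2 * ρ = 1 / ρ := by field_simp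
        rw [this, le_div_iff₀ hρ0]
        linarith [hρ.2]
      have h3 : 0 < 1 / ρ ^ 2 := by positivity
      have h4 : ρ ≤ 1 := hρ.2.trans htop1
      nlinarith
    have h5 : κ * (R - ρ) / (4 * pLo) ≤ κ * (1 / ρ ^ 2 - 1) / (4 * φ) := by
      have h2 : 0 ≤ R - ρ := by linarith [hρ.2]
      have h3 := h2.trans h1
      gcongr
    calc H.eval ρ ^ 2 * (R - ρ)
        = 2 * pLo / (κ ^ 2 * r) * (2 * r * κ * H.eval ρ ^ 2 * (κ * (R - ρ) / (4 * pLo))) := by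
          field_simp
          ring
      _ ≤ _ := by
          have : 0 ≤ R - ρ := by linarith [hρ.2]
          have := hρ.1
          gcongr

/-- The operator is bounded below on the polynomials in `q²`. -/
theorem exists_norm_polySq_sq_le (h : ReflectedGeometry pStar pTop pLo pHi) :
    ∃ C : ℝ, 0 < C ∧ ∀ (N : ℕ) (f : Polynomial ℝ), f.degree < N →
      ‖polySq pLo pHi f‖ ^ 2 ≤ C * √(N + 1) * (betaRate pStar pTop pLo pHi ^ 2) ^ N *
        ‖reflectedOp h (polySq pLo pHi f)‖ ^ 2 := by
  have hκ := halfGap_pos h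
  have hlo := h.pLo_pos
  have hst := rho_pos h h.pos.le (h.observed.le.trans h.reflected)
  obtain ⟨C, hC, hbound⟩ := exists_sum_coeff_sq_le hst
    (rho_strictMono h h.pos.le h.observed h.reflected)
    (rho_le_one h (h.pos.trans h.observed).le h.reflected)
    (s := betaArg pStar pTop pLo pHi) (β := betaRate pStar pTop pLo pHi) rfl rfl
  refine ⟨halfGap pLo pHi / (2 * pLo ^ 5) * (C *
    (2 * pLo / (halfGap pLo pHi ^ 2 * rho pLo pHi pStar))), by positivity, ?_⟩
  intro N f hf
  obtain ⟨a, ha⟩ := exists_legendre_expansion h hf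
  set H : Polynomial ℝ := ∑ n ∈ Finset.range (N + 1),
    Polynomial.C (2 * a n / (2 * n + 1)) * Polynomial.X ^ n with hH
  have hHdeg : H.natDegree ≤ N := by
    refine Polynomial.natDegree_sum_le_of_forall_le _ _ fun n hn => ?_
    exact (Polynomial.natDegree_C_mul_X_pow_le _ _).trans
      (Nat.lt_succ_iff.mp (Finset.mem_range.mp hn))
  have hHcoeff : ∀ n ∈ Finset.range (N + 1), H.coeff n = 2 * a n / (2 * n + 1) := by
    intro n hn
    rw [hH, Polynomial.finsetSum_coeff]
    simp_rw [Polynomial.coeff_C_mul_X_pow]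
    rw [Finset.sum_eq_single_of_mem n hn fun k _ hk => if_neg hk.symm, if_pos rfl]
  have hHeval : ∀ ρ : ℝ, H.eval ρ = ∑ n ∈ Finset.range (N + 1), a n * (2 * ρ ^ n / (2 * n + 1)) := by
    intro ρ
    rw [hH, Polynomial.eval_finsetSum]
    refine Finset.sum_congr rfl fun n _ => ?_
    simp only [Polynomial.eval_mul, Polynomial.eval_C, Polynomial.eval_pow, Polynomial.eval_X]
    ring
  have hA : ‖reflectedOp h (polySq pLo pHi f)‖ ^ 2 = ∫ p in Set.Ioo pStar pTop,
      2 * rho pLo pHi p * halfGap pLo pHi * H.eval (rho pLo pHi p) ^ 2 := by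
    rw [norm_reflectedOp_sq]
    refine setIntegral_congr_fun measurableSet_Ioo fun p hp => ?_
    have hp0 : 0 ≤ p := (h.pos.trans hp.1).le
    have hpl : p < pLo := hp.2.trans_le h.reflected
    have := rho_pos h hp0 hpl.le
    rw [traveltime_polySq h ha hp0 hpl, ← hHeval, mul_pow, Real.sq_sqrt (by positivity)]
  have h1 := norm_polySq_sq_le h ha
  have h2 := hbound N H hHdeg
  rw [Finset.sum_congr rfl fun n hn => by rw [hHcoeff n hn]] at h2
  have h3 := integral_sq_mul_sub_le h H
  rw [← hA] at h3
  set T := ‖reflectedOp h (polySq pLo pHi f)‖ ^ 2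
  set B := (betaRate pStar pTop pLo pHi ^ 2) ^ N with hB
  have hB0 : 0 ≤ B := by positivity
  have hs : ((N : ℝ) + 1) / √((N : ℝ) + 1) = √((N : ℝ) + 1) := Real.div_sqrt
  calc _ ≤ _ := h1
    _ ≤ halfGap pLo pHi / (2 * pLo ^ 5) * ((N + 1) * (C * (B / √(N + 1)) *
        (2 * pLo / (halfGap pLo pHi ^ 2 * rho pLo pHi pStar) * T))) := by
      refine mul_le_mul_of_nonneg_left (mul_le_mul_of_nonneg_left (h2.trans ?_) (by positivity))
        (by positivity)
      exact mul_le_mul_of_nonneg_left h3 (by positivity)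
    _ = halfGap pLo pHi / (2 * pLo ^ 5) * (C * (2 * pLo / (halfGap pLo pHi ^ 2 *
        rho pLo pHi pStar))) * (((N : ℝ) + 1) / √((N : ℝ) + 1)) * B * T := by ring
    _ = _ := by rw [hs]

theorem polySq_injective (hlo : 0 < pLo) (hlohi : pLo < pHi) :
    Function.Injective (polySq pLo pHi) := by
  rw [← LinearMap.ker_eq_bot, LinearMap.ker_eq_bot']
  intro f hf
  have h1 : (fun q : ℝ => f.eval (q ^ 2)) =ᵐ[volume.restrict (Set.Ioo pLo pHi)] fun _ => (0 : ℝ) := by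
    have h2 : (polySq pLo pHi f : ℝ → ℝ) =ᵐ[volume.restrict (Set.Ioo pLo pHi)]
        fun q => f.eval (q ^ 2) := (memLp_poly_sq pLo pHi f).coeFn_toLp
    rw [hf] at h2
    filter_upwards [h2, Lp.coeFn_zero ℝ 2 (volume.restrict (Set.Ioo pLo pHi))] with q e1 e2
    rw [← e1, e2]
    rfl
  have h3 := Measure.eqOn_open_of_ae_eq h1 isOpen_Ioo
    (Continuous.continuousOn (by fun_prop)) continuousOn_const
  refine Polynomial.eq_zero_of_infinite_isRoot f (Set.Infinite.mono (s := (fun q => q ^ 2) ''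
    Set.Ioo pLo pHi) ?_ ((Set.Ioo_infinite hlohi).image ?_))
  · rintro _ ⟨q, hq, rfl⟩
    exact h3 hq
  · intro x hx y hy hxy
    exact (sq_eq_sq₀ (hlo.trans hx.1).le (hlo.trans hy.1).le).mp hxy

theorem finrank_polySqSubspace (hlo : 0 < pLo) (hlohi : pLo < pHi) (N : ℕ) :
    Module.finrank ℝ (polySqSubspace pLo pHi N) = N := by
  rw [polySqSubspace, ← (Submodule.equivMapOfInjective _ (polySq_injective hlo hlohi)
    (Polynomial.degreeLT ℝ N)).finrank_eq, (Polynomial.degreeLTEquiv ℝ N).finrank_eq,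
    Module.finrank_fin_fun]

/-- The projector on the observations is taken onto the image of the polynomials under the
operator, so that it loses nothing. -/
theorem exists_condNumber_polySqSubspace_le (h : ReflectedGeometry pStar pTop pLo pHi) :
    ∃ C : ℝ, 0 < C ∧ ∀ (N : ℕ), 1 ≤ N →
      Module.finrank ℝ (polySqSubspace pLo pHi N) = N ∧
      ∃ (U : Submodule ℝ (L2 pStar pTop)) (_ : FiniteDimensional ℝ U),
        Module.finrank ℝ U = N ∧
          condNumber (reflectedOp h) U (polySqSubspace pLo pHi N) ≤
            ENNReal.ofReal (C * (N : ℝ) ^ ((1 / 4) : ℝ) * betaRate pStar pTop pLo pHi ^ N) := by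
  obtain ⟨D, hD, hbound⟩ := exists_norm_polySq_sq_le h
  have hA := norm_reflectedOp_pos h
  have hβ : 0 < betaRate pStar pTop pLo pHi := by
    have h1 := rho_strictMono h h.pos.le h.observed h.reflected
    have h2 := rho_pos h h.pos.le (h.observed.le.trans h.reflected)
    have h3 : 0 < betaArg pStar pTop pLo pHi := by
      rw [betaArg]
      exact div_pos (by linarith) (by linarith)
    rw [betaRate]
    positivity
  set β := betaRate pStar pTop pLo pHi
  refine ⟨‖reflectedOp h‖ * √(2 * D), by positivity, fun N hN => ?_⟩
  have hfin := finrank_polySqSubspace h.pLo_pos h.medium N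
  have hN0 : (1 : ℝ) ≤ N := by exact_mod_cast hN
  set K := √(2 * D) * (N : ℝ) ^ ((1 / 4) : ℝ) * β ^ N with hK
  have hK0 : 0 < K := by positivity
  have hsq : K ^ 2 = 2 * D * √N * (β ^ 2) ^ N := by
    have h1 : ((N : ℝ) ^ ((1 / 4) : ℝ)) ^ 2 = √N := by
      rw [Real.sqrt_eq_rpow, ← Real.rpow_natCast, ← Real.rpow_mul (by positivity)]
      norm_num
    rw [hK, mul_pow, mul_pow, h1, Real.sq_sqrt (by positivity), pow_right_comm]
  have hAV : ∀ F ∈ polySqSubspace pLo pHi N, 1 / K * ‖F‖ ≤ ‖reflectedOp h F‖ := by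
    rintro _ ⟨f, hf, rfl⟩
    rw [one_div_mul_eq_div, div_le_iff₀ hK0]
    refine le_of_sq_le_sq ((hbound N f (Polynomial.mem_degreeLT.mp hf)).trans ?_) (by positivity)
    rw [mul_pow, hsq, mul_comm (_ ^ 2)]
    have h1 : √((N : ℝ) + 1) ≤ 2 * √N := by
      refine Real.sqrt_le_iff.mpr ⟨by positivity, ?_⟩
      rw [mul_pow, Real.sq_sqrt (by positivity)]
      linarith
    have h2 : D * √((N : ℝ) + 1) ≤ 2 * D * √N := by nlinarith
    gcongr
  obtain ⟨hU, hcond⟩ := condNumber_map_le (reflectedOp h) (polySqSubspace pLo pHi N)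
    (hN.trans hfin.ge) (by positivity) hAV
  refine ⟨hfin, _, inferInstance, hU.trans hfin, hcond.trans (ENNReal.ofReal_le_ofReal ?_)⟩
  rw [div_div_eq_mul_div, div_one, hK]
  exact le_of_eq (by ring)

end UpperBound

theorem theorem1 (pStar pLo pHi : ℝ) :
    (∀ (pTop : ℝ) (h : ReflectedGeometry pStar pTop pLo pHi),
      ∃ C : ℝ, 0 < C ∧ ∀ (N : ℕ), 1 ≤ N →
        ∀ (U : Submodule ℝ (L2 pStar pTop)) [U.HasOrthogonalProjection]
          (V : Submodule ℝ (L2 pLo pHi)) [FiniteDimensional ℝ V],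
          Module.finrank ℝ V = N → IsReasonable (reflectedOp h) U V →
            ENNReal.ofReal (C * N * alphaRate pTop pLo pHi ^ N) ≤
              condNumber (reflectedOp h) U V) ∧
    (∃ C : ℝ, 0 < C ∧
      ∀ (pTop : ℝ) (h : ReflectedGeometry pStar pTop pLo pHi) (N : ℕ), 1 ≤ N →
        ∀ (U : Submodule ℝ (L2 pStar pTop)) [U.HasOrthogonalProjection]
          (V : Submodule ℝ (L2 pLo pHi)) [FiniteDimensional ℝ V],
          Module.finrank ℝ V = N → IsReasonable (reflectedOp h) U V →
            ENNReal.ofReal (C * (N : ℝ) ^ (-(1 / 4) : ℝ) * Real.exp (rootExpRate * √N)) ≤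
              condNumber (reflectedOp h) U V) ∧
    (∀ (pTop : ℝ) (h : ReflectedGeometry pStar pTop pLo pHi),
      ∃ C : ℝ, 0 < C ∧ ∀ (N : ℕ), 1 ≤ N →
        Module.finrank ℝ (polySqSubspace pLo pHi N) = N ∧
        ∃ (U : Submodule ℝ (L2 pStar pTop)) (_ : FiniteDimensional ℝ U),
          Module.finrank ℝ U = N ∧
            condNumber (reflectedOp h) U (polySqSubspace pLo pHi N) ≤
              ENNReal.ofReal (C * (N : ℝ) ^ ((1 / 4) : ℝ) *
                betaRate pStar pTop pLo pHi ^ N)) := by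
  exact ⟨fun _ h => exists_exp_le_condNumber h, exists_rootExp_le_condNumber pStar pLo pHi,
    fun _ h => exists_condNumber_polySqSubspace_le h⟩
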